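/- Let $Q=(0,1)^2$ be the open unit square, let $1\le p<\infty$ and let $f\in C^2(\overline Q)$ be real-valued. A partition of $\overline Q$ is a finite family of nondegenerate closed rectangles with sides parallel to the axes whose union is $\overline Q$ and whose interiors are pairwise disjoint. The harmonic spline $s(f,\square)$ on a partition $\square$ is the continuous function on $\overline Q$ that is harmonic in the interior of every element of $\square$ and equals $f$ on the boundary of every element. For $x\in Q$ let $G_Q(x;v)=\frac1{2\pi}\ln\frac1{|x-v|}+g(x;v)$ be the Green's function of the Dirichlet problem in $Q$, where $g(x;\cdot)$ is continuous on $\overline Q$, harmonic in $Q$, and such that $G_Q(x;v)=0$ for $v\in\partial Q$; let $I(x)=\int_Q G_Q(x;v)\,dv$. For $q>0$ write $\|h\|_{L_q}=\left(\int_Q|h(x)|^q\,dx\right)^{1/q}$. Then $G_Q$ exists, $G_Q(x;\cdot)$ is integrable on $Q$ for every $x\in Q$, the functions $I$ and $\Delta f$ are measurable with $\|I\|_{L_p}<\infty$ and $\|\Delta f\|_{L_{p/(p+1)}}<\infty$, and there is a sequence of partitions $\square^*_N$ of $\overline Q$ such that, as $N\to\infty$, the number of elements of $\square^*_N$ divided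 by $N$ tends to $1$, the number of elements of $\square^*_N$ that are not squares is $o(N)$, the harmonic splines $s(f,\square^*_N)$ exist, and $$\lim_{N\to\infty}N\,\|f-s(f,\square^*_N)\|_{L_p}=\|I\|_{L_p}\,\|\Delta f\|_{L_{p/(p+1)}}.$$ -/

import Mathlib

open Filter Topology MeasureTheory
open scoped ENNReal

namespace HarmonicSpline

noncomputable section

/-- The Euclidean plane `ℝ²`. -/
abbrev Plane : Type := EuclideanSpace ℝ (Fin 2)

/-- The open unit square. -/
def openSquare : Set Plane := {x | ∀ i, x i ∈ Set.Ioo (0 : ℝ) 1}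

/-- The closed unit square. -/
def closedSquare : Set Plane := {x | ∀ i, x i ∈ Set.Icc (0 : ℝ) 1}

/-- A nondegenerate rectangle with sides parallel to the coordinate axes; `lo i` and `hi i` are the
end points of its projection to the `i`-th axis. -/
@[ext]
structure Rect where
  lo : Fin 2 → ℝ
  hi : Fin 2 → ℝ
  lo_lt_hi : ∀ i, lo i < hi i

namespace Rect

/-- The interior of the rectangle. -/
def openCell (R : Rect) : Set Plane := {x | ∀ i, x i ∈ Set.Ioo (R.lo i) (R.hi i)}

/-- The closed rectangle. -/
def closedCell (R : Rect) : Set Plane := {x | ∀ i, x i ∈ Set.Icc (R.lo i) (R.hi i)}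

/-- The boundary of the rectangle. -/
def boundary (R : Rect) : Set Plane := R.closedCell \ R.openCell

/-- The rectangle is a square. -/
def IsSquare (R : Rect) : Prop := R.hi 0 - R.lo 0 = R.hi 1 - R.lo 1

end Rect

/-- A finite family of rectangles is a partition of the closed unit square: the closed rectangles
cover exactly the closed unit square and their interiors are pairwise disjoint. -/
structure IsPartition (P : Finset Rect) : Prop where
  iUnion_eq : ⋃ R ∈ P, R.closedCell = closedSquare
  pairwise_disjoint : ∀ R ∈ P, ∀ R' ∈ P, R ≠ R' → Disjoint R.openCell R'.openCell

open Classical in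
/-- The number of elements of the family that are not squares. -/
def numNonSquares (P : Finset Rect) : ℕ := (P.filter fun R => ¬ R.IsSquare).card

/-- `s` is a harmonic spline on the partition `P`: it is continuous on the closed unit square and
harmonic in the interior of every element. -/
structure IsHarmonicSpline (P : Finset Rect) (s : Plane → ℝ) : Prop where
  continuousOn : ContinuousOn s closedSquare
  harmonic : ∀ R ∈ P, InnerProductSpace.HarmonicOnNhd s R.openCell

/-- `s` is the harmonic spline on `P` that coincides with `f` on the boundaries of all elements. -/
structure IsInterlineatingSpline (f : Plane → ℝ) (P : Finset Rect) (s : Plane → ℝ) : Prop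
    extends IsHarmonicSpline P s where
  eqOn_boundary : ∀ R ∈ P, Set.EqOn s f R.boundary

/-- The logarithmic fundamental solution `(1 / 2π) log (1 / |x - v|)`. -/
def logKernel (x v : Plane) : ℝ := 1 / (2 * Real.pi) * Real.log (1 / ‖x - v‖)

/-- `g` is the regular part, with pole `x`, of the Green's function of the Dirichlet problem
in `Ω`: harmonic in `Ω`, continuous on its closure, and such that `logKernel x + g` vanishes on the
boundary. -/
structure IsGreenRegularPart (Ω : Set Plane) (x : Plane) (g : Plane → ℝ) : Prop where
  harmonic : InnerProductSpace.HarmonicOnNhd g Ω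
  continuousOn : ContinuousOn g (closure Ω)
  boundary : ∀ v ∈ frontier Ω, logKernel x v + g v = 0

open Classical in
/-- The regular part of the Green's function. For bounded `Ω` it is unique on the closure of `Ω`
by the maximum principle (and `0` is a default value if there is none). -/
def greenRegularPart (Ω : Set Plane) (x : Plane) : Plane → ℝ :=
  if h : ∃ g, IsGreenRegularPart Ω x g then h.choose else 0

/-- The Green's function `G_Ω(x; v)` of the Dirichlet problem in `Ω`. -/
def greenFunction (Ω : Set Plane) (x v : Plane) : ℝ := logKernel x v + greenRegularPart Ω x v

/-- `I(x) = ∫ G(x; v) dv`, with the Green's function of the open unit square. -/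
def greenIntegral (x : Plane) : ℝ := ∫ v in openSquare, greenFunction openSquare x v

end

end HarmonicSpline

open HarmonicSpline

/-! On a square of side `h` with lower left corner `a`, on which `Δ f` is close to a constant `c`,
the error `f - s` vanishes on the boundary and has Laplacian `Δ f`. Hence it is close to `-c h² W((x
- a) / h)`, where `W` is the torsion function of the unit square: `Δ W = -1`, zero on the boundary.
The maximum principle bounds the discrepancy by the oscillation of `Δ f` times `4 h²`
(`IsInterlineatingSpline.abs_sub_add_le`). By scaling, the principal part has norm `(∑ (|c| h²)^p
h²)^(1/p) ‖W‖_p` (`IsPartition.eLpNorm_principalError`).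

It remains to distribute about `N` squares. Cut the unit square into a coarse grid and divide a
coarse cell `B`, on which `Δ f ≈ c_B`, into about `N ρ_B` equal squares, with `ρ_B` proportional to
a weight `a_B`. Then `N` times the error tends, up to a small remainder, to a Riemann sum for `∫ a ·
(∫ (|Δ f| / a)^p)^(1/p) · ‖W‖_p` (`eventually_exists_spline`). The minimizing weight is `a = |Δ
f|^r` with `r = p / (p + 1)`; both integrals then equal `∫ |Δ f|^r`, and `1 + 1/p = 1/r` yields `‖Δ
f‖_r`. Since this weight may vanish, `(|Δ f| + η)^r` is used and `η → 0` afterwards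
(`tendsto_regularized_constant`). The coarse cells are squares divided evenly in both directions, so
no non-squares occur at all.

Two existence questions remain. Splines, the Green's function and `W` all come from the Dirichlet
problem in a rectangle with edgewise `C²` data, solved by sine series (`Rect.exists_dirichlet`).
That `W` is the integral `I` of the Green's function is shown without differentiating `I`: the mean
of `I` over a small circle of radius `r` is `I(x) - r²/4`, as for `W`; `I` tends to `0` at the
boundary by comparison with image charges; and a function with zero boundary values and the mean
value property vanishes (`IsTorsionFunction.eqOn_greenIntegral`). -/

namespace HarmonicSpline

open InnerProductSpace Laplacian

/-! ### The Laplacian along lines, similarities and the maximum principle. -/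

section Laplace

variable {E : Type*} [NormedAddCommGroup E] [InnerProductSpace ℝ E]
  {F : Type*} [NormedAddCommGroup F] [InnerProductSpace ℝ F]

lemma hasDerivAt_line (x e : E) (t : ℝ) : HasDerivAt (fun t : ℝ => x + t • e) e t := by
  simpa using ((hasDerivAt_id t).smul_const e).const_add x

lemma eventually_deriv_line {u : E → ℝ} {x : E} (hu : ContDiffAt ℝ 2 u x) (e : E) :
    deriv (fun t : ℝ => u (x + t • e)) =ᶠ[𝓝 0] fun t => fderiv ℝ u (x + t • e) e := by
  have h1 : ∀ᶠ y in 𝓝 x, ContDiffAt ℝ 2 u y := hu.eventually (by simp)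
  have hc : Tendsto (fun t : ℝ => x + t • e) (𝓝 0) (𝓝 x) := by
    have : ContinuousAt (fun t : ℝ => x + t • e) 0 := (hasDerivAt_line x e 0).continuousAt
    simpa [ContinuousAt] using this
  filter_upwards [hc.eventually h1] with t ht
  exact ((ht.differentiableAt (by simp)).hasFDerivAt.comp_hasDerivAt t
    (hasDerivAt_line x e t)).deriv

lemma deriv_deriv_line {u : E → ℝ} {x : E} (hu : ContDiffAt ℝ 2 u x) (e : E) :
    deriv (deriv (fun t : ℝ => u (x + t • e))) 0 = iteratedFDeriv ℝ 2 u x ![e, e] := by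
  rw [(eventually_deriv_line hu e).deriv_eq, iteratedFDeriv_two_apply]
  have h1 : DifferentiableAt ℝ (fderiv ℝ u) (x + (0 : ℝ) • e) := by
    simpa using (hu.fderiv_right (m := 1) (by norm_num)).differentiableAt (by simp)
  have h2 := h1.hasFDerivAt.comp_hasDerivAt (0 : ℝ) (hasDerivAt_line x e 0)
  have h3 := (ContinuousLinearMap.apply ℝ ℝ e).hasFDerivAt.comp_hasDerivAt (0 : ℝ) h2
  have := h3.deriv
  simpa [Function.comp_def] using this

lemma contDiff_norm_sub_sq (c : E) : ContDiff ℝ 2 fun x : E => ‖x - c‖ ^ 2 :=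
  (contDiff_id.sub contDiff_const).norm_sq ℝ

lemma contDiffAt_add_smul_norm_sub_sq {u : E → ℝ} {x : E} (hu : ContDiffAt ℝ 2 u x) (M : ℝ)
    (c : E) : ContDiffAt ℝ 2 (u + M • fun x : E => ‖x - c‖ ^ 2) x :=
  hu.add ((contDiff_norm_sub_sq c).contDiffAt.const_smul M)

variable [FiniteDimensional ℝ E] [FiniteDimensional ℝ F]

lemma laplacian_eq_sum_line {ι : Type*} [Fintype ι] (b : OrthonormalBasis ι ℝ E) {u : E → ℝ}
    {x : E} (hu : ContDiffAt ℝ 2 u x) :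
    Δ u x = ∑ i, deriv (deriv (fun t : ℝ => u (x + t • b i))) 0 := by
  rw [laplacian_eq_iteratedFDeriv_orthonormalBasis u b]
  simp only [deriv_deriv_line hu]

/-- The Laplacian of the composition with a similarity. -/
lemma laplacian_comp_similarity (A : E ≃ₗᵢ[ℝ] F) (c : ℝ) (a : F) {u : F → ℝ} {x : E}
    (hu : ContDiffAt ℝ 2 u (c • A x + a)) :
    Δ (fun y => u (c • A y + a)) x = c ^ 2 * Δ u (c • A x + a) := by
  have hA : ContDiff ℝ 2 fun y : E => c • A y + a :=
    ((A.contDiff).const_smul c).add contDiff_const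
  have hcomp : ContDiffAt ℝ 2 (fun y => u (c • A y + a)) x := hu.comp x hA.contDiffAt
  set b := stdOrthonormalBasis ℝ E
  rw [laplacian_eq_sum_line b hcomp, laplacian_eq_iteratedFDeriv_orthonormalBasis u (b.map A),
    Finset.mul_sum]
  refine Finset.sum_congr rfl fun i _ => ?_
  have : (fun t : ℝ => u (c • A (x + t • b i) + a))
      = fun t : ℝ => u ((c • A x + a) + t • (c • A (b i))) := by
    ext t
    congr 1
    simp only [map_add, map_smul, smul_add, smul_comm c t]
    abel
  rw [this, deriv_deriv_line hu, iteratedFDeriv_two_apply, iteratedFDeriv_two_apply]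
  simp
  ring

lemma harmonicAt_comp_similarity (A : E ≃ₗᵢ[ℝ] F) (c : ℝ) (a : F) {u : F → ℝ} {x : E}
    (hu : HarmonicAt u (c • A x + a)) : HarmonicAt (fun y => u (c • A y + a)) x := by
  have hA : ContDiff ℝ 2 fun y : E => c • A y + a :=
    ((A.contDiff).const_smul c).add contDiff_const
  refine ⟨hu.1.comp x hA.contDiffAt, ?_⟩
  filter_upwards [(hA.continuous.tendsto x).eventually hu.eventually] with y hy
  rw [laplacian_comp_similarity A c a hy.1, hy.2.eq_of_nhds]
  simp

/-- If the second derivative along some axis were positive, the maximum would also be a local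
minimum along that line. The function would then be constant near the point, which forces that
derivative to be zero. -/
lemma laplacian_nonpos_of_isLocalMax {u : E → ℝ} {x : E} (hu : ContDiffAt ℝ 2 u x)
    (hx : IsLocalMax u x) : Δ u x ≤ 0 := by
  rw [laplacian_eq_sum_line (stdOrthonormalBasis ℝ E) hu]
  refine Finset.sum_nonpos fun i _ => ?_
  set e := stdOrthonormalBasis ℝ E i
  by_contra! hpos
  have hc : Tendsto (fun t : ℝ => x + t • e) (𝓝 0) (𝓝 x) := by
    have : ContinuousAt (fun t : ℝ => x + t • e) 0 := (hasDerivAt_line x e 0).continuousAt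
    simpa [ContinuousAt] using this
  have hmax : IsLocalMax (fun t : ℝ => u (x + t • e)) 0 := by
    filter_upwards [hc.eventually hx] with t ht
    simpa using ht
  have hcont : ContinuousAt (fun t : ℝ => u (x + t • e)) 0 := by
    have : ContinuousAt u x := hu.continuousAt
    have h := this.tendsto.comp hc
    simpa [ContinuousAt, Function.comp_def] using h
  have hmin := isLocalMin_of_deriv_deriv_pos hpos hmax.deriv_eq_zero hcont
  have hconst : (fun t : ℝ => u (x + t • e)) =ᶠ[𝓝 0] fun _ => u (x + (0 : ℝ) • e) := by
    filter_upwards [hmax, hmin] with t h1 h2 using le_antisymm h1 h2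
  rw [hconst.deriv.deriv_eq] at hpos
  simp at hpos

lemma laplacian_norm_sub_sq (c x : E) :
    Δ (fun x : E => ‖x - c‖ ^ 2) x = 2 * Module.finrank ℝ E := by
  rw [laplacian_eq_sum_line (stdOrthonormalBasis ℝ E) (contDiff_norm_sub_sq c).contDiffAt]
  have : ∀ i, deriv (deriv (fun t : ℝ => ‖x + t • stdOrthonormalBasis ℝ E i - c‖ ^ 2)) 0 = 2 := by
    intro i
    set e := stdOrthonormalBasis ℝ E i
    have he : ‖e‖ = 1 := (stdOrthonormalBasis ℝ E).orthonormal.1 i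
    have h1 : (fun t : ℝ => ‖x + t • e - c‖ ^ 2)
        = fun t => ‖x - c‖ ^ 2 + t * (2 * inner ℝ (x - c) e) + t ^ 2 := by
      ext t
      have : x + t • e - c = (x - c) + t • e := by abel
      rw [this, norm_add_sq_real, norm_smul, he, inner_smul_right]
      simp
      ring
    have h2 : deriv (fun t : ℝ => ‖x - c‖ ^ 2 + t * (2 * inner ℝ (x - c) e) + t ^ 2)
        = fun t => 2 * inner ℝ (x - c) e + 2 * t := by
      ext t
      simp
    rw [h1, h2]
    simp
  simp only [this]
  simp [mul_comm]

lemma laplacian_add_smul_norm_sub_sq {u : E → ℝ} {x : E} (hu : ContDiffAt ℝ 2 u x) (M : ℝ)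
    (c : E) : Δ (u + M • fun x : E => ‖x - c‖ ^ 2) x = Δ u x + M * (2 * Module.finrank ℝ E) := by
  have hq := (contDiff_norm_sub_sq c).contDiffAt (x := x)
  have hs : ContDiffAt ℝ 2 (M • fun x : E => ‖x - c‖ ^ 2) x := hq.const_smul M
  rw [hu.laplacian_add hs, laplacian_smul _ hq, laplacian_norm_sub_sq, smul_eq_mul]

/-- A function with positive Laplacian has no positive maximum in the interior. -/
lemma nonpos_of_laplacian_pos {K U : Set E} (hK : IsCompact K) (hU : IsOpen U) (hUK : U ⊆ K)
    {u : E → ℝ} (hc : ContinuousOn u K) (hd : ∀ x ∈ U, ContDiffAt ℝ 2 u x)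
    (hL : ∀ x ∈ U, 0 < Δ u x) {M : ℝ} (hb : ∀ x ∈ K \ U, u x ≤ M) : ∀ x ∈ K, u x ≤ M := by
  intro x hx
  obtain ⟨y, hy, hmax⟩ := hK.exists_isMaxOn ⟨x, hx⟩ hc
  refine (hmax hx).trans ?_
  by_contra! hlt
  have hyU : y ∈ U := by
    by_contra h
    exact absurd (hb y ⟨hy, h⟩) (not_le.2 hlt)
  have hloc : IsLocalMax u y :=
    (hmax.on_subset hUK).isLocalMax (hU.mem_nhds hyU)
  exact absurd (laplacian_nonpos_of_isLocalMax (hd y hyU) hloc) (not_le.2 (hL y hyU))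

variable [Nontrivial E]

/-- The weak maximum principle. -/
lemma nonpos_of_laplacian_nonneg {K U : Set E} (hK : IsCompact K) (hU : IsOpen U) (hUK : U ⊆ K)
    {u : E → ℝ} (hc : ContinuousOn u K) (hd : ∀ x ∈ U, ContDiffAt ℝ 2 u x)
    (hL : ∀ x ∈ U, 0 ≤ Δ u x) (hb : ∀ x ∈ K \ U, u x ≤ 0) : ∀ x ∈ K, u x ≤ 0 := by
  intro x hx
  obtain ⟨B, hB⟩ := hK.isBounded.exists_norm_le
  refine le_of_forall_pos_le_add fun ε hε => ?_
  -- Adding `δ ‖x‖²` makes the Laplacian strictly positive, and this `δ` keeps the perturbation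
  -- below `ε` on `K`.
  set δ := ε / (B ^ 2 + 1) with hδ
  have hδ0 : 0 < δ := by positivity
  have hq := contDiff_norm_sub_sq (0 : E)
  have h := nonpos_of_laplacian_pos hK hU hUK (u := u + δ • fun x : E => ‖x - 0‖ ^ 2) (M := ε)
    (hc.add (hq.continuous.continuousOn.const_smul δ))
    (fun y hy => contDiffAt_add_smul_norm_sub_sq (hd y hy) δ 0) (fun y hy => ?_) (fun y hy => ?_) x hx
  · have : 0 ≤ δ * ‖x‖ ^ 2 := by positivity
    simp at h
    linarith
  · rw [laplacian_add_smul_norm_sub_sq (hd y hy)]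
    have h1 := hL y hy
    have h2 : (0 : ℝ) < Module.finrank ℝ E := by exact_mod_cast Module.finrank_pos
    have : 0 < δ * (2 * Module.finrank ℝ E) := by positivity
    linarith
  · have h1 := hb y hy
    have h2 : ‖y‖ ^ 2 ≤ B ^ 2 := pow_le_pow_left₀ (norm_nonneg _) (hB y hy.1) 2
    have : δ * ‖y‖ ^ 2 ≤ ε := by
      rw [hδ, div_mul_eq_mul_div, div_le_iff₀ (by positivity)]
      nlinarith
    simp
    linarith

/-- A function with zero boundary values is controlled by its Laplacian. -/
lemma abs_le_of_abs_laplacian_le {K U : Set E} (hK : IsCompact K) (hU : IsOpen U) (hUK : U ⊆ K)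
    {u : E → ℝ} (hc : ContinuousOn u K) (hd : ∀ x ∈ U, ContDiffAt ℝ 2 u x) {M : ℝ} (hM : 0 ≤ M)
    (hL : ∀ x ∈ U, |Δ u x| ≤ M) (hb : ∀ x ∈ K \ U, u x = 0) {c : E} {r : ℝ}
    (hr : ∀ x ∈ K, ‖x - c‖ ≤ r) : ∀ x ∈ K, |u x| ≤ M * r ^ 2 := by
  have hq := contDiff_norm_sub_sq c
  have key : ∀ {u : E → ℝ}, ContinuousOn u K → (∀ x ∈ U, ContDiffAt ℝ 2 u x) →
      (∀ x ∈ U, |Δ u x| ≤ M) → (∀ x ∈ K \ U, u x = 0) → ∀ x ∈ K, u x ≤ M * r ^ 2 := by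
    intro u hc hd hL hb x hx
    -- Barrier `M (‖x - c‖² - r²)`: it is nonpositive on `K`, and its Laplacian, `2 M` times the
    -- dimension, outweighs `-M`.
    have h := nonpos_of_laplacian_nonneg hK hU hUK
      (u := (u + M • fun x : E => ‖x - c‖ ^ 2) + fun _ => -(M * r ^ 2))
      ((hc.add (hq.continuous.continuousOn.const_smul M)).add continuousOn_const)
      (fun y hy => (contDiffAt_add_smul_norm_sub_sq (hd y hy) M c).add contDiffAt_const)
      (fun y hy => ?_) (fun y hy => ?_) x hx
    · have : 0 ≤ M * ‖x - c‖ ^ 2 := by positivity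
      simp at h
      linarith
    · rw [(contDiffAt_add_smul_norm_sub_sq (hd y hy) M c).laplacian_add contDiffAt_const,
        laplacian_add_smul_norm_sub_sq (hd y hy)]
      have h1 := neg_le_of_abs_le (hL y hy)
      have h2 : (1 : ℝ) ≤ Module.finrank ℝ E := by exact_mod_cast Module.finrank_pos
      simp only [laplacian_const, Pi.zero_apply]
      nlinarith
    · have h2 : ‖y - c‖ ^ 2 ≤ r ^ 2 := pow_le_pow_left₀ (norm_nonneg _) (hr y hy.1) 2
      have := mul_le_mul_of_nonneg_left h2 hM
      simp [hb y hy]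
      linarith
  intro x hx
  refine abs_le.2 ⟨?_, key hc hd hL hb x hx⟩
  have := key (u := -u) hc.neg (fun y hy => (hd y hy).neg)
    (fun y hy => by rw [laplacian_neg]; simpa using hL y hy)
    (fun y hy => by simp [hb y hy]) x hx
  simp at this
  linarith

end Laplace

/-! ### Absolutely convergent sine series of `C²` functions. -/

section SineSeries

/-- The eigenfunction expansion of the Green's kernel of `-d²/dt²` on `[0, 1]`. The product of sines
is a difference of cosines, so the sum is a difference of two values of the Fourier series of the
second Bernoulli polynomial, at `|t - s| / 2` and `(t + s) / 2`. -/
lemma hasSum_sin_mul_sin {t s : ℝ} (ht : t ∈ Set.Icc (0 : ℝ) 1) (hs : s ∈ Set.Icc (0 : ℝ) 1) :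
    HasSum (fun n : ℕ => 2 / ((n : ℝ) ^ 2 * Real.pi ^ 2) * Real.sin (n * Real.pi * t) *
      Real.sin (n * Real.pi * s)) (min t s - t * s) := by
  have hB : ∀ x ∈ Set.Icc (0 : ℝ) 1,
      HasSum (fun n : ℕ => 1 / (n : ℝ) ^ 2 * Real.cos (2 * Real.pi * n * x))
        (Real.pi ^ 2 * (x ^ 2 - x + 1 / 6)) := by
    intro x hx
    have h := hasSum_one_div_nat_pow_mul_cos (k := 1) one_ne_zero hx
    have e : Polynomial.eval x (Polynomial.map (algebraMap ℚ ℝ) (Polynomial.bernoulli (2 * 1)))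
        = x ^ 2 - x + 1 / 6 := by
      simp [Polynomial.bernoulli_def, Finset.sum_range_succ, bernoulli_one, bernoulli_two]
      ring
    rw [e] at h
    simp only [mul_one] at h
    convert! h using 1
    rw [show Nat.factorial 2 = 2 from rfl]
    push_cast
    ring
  have h1 := hB (|t - s| / 2) ⟨by positivity, by
    have := abs_sub_le_iff.2 (⟨by linarith [ht.2, hs.1], by linarith [ht.1, hs.2]⟩ :
      t - s ≤ 1 ∧ s - t ≤ 1)
    linarith⟩
  have h2 := hB ((t + s) / 2) ⟨by linarith [ht.1, hs.1], by linarith [ht.2, hs.2]⟩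
  have h := (h1.sub h2).mul_left (1 / Real.pi ^ 2)
  have hpi := Real.pi_pos.ne'
  convert! h using 1
  · ext n
    have e1 : Real.cos (2 * Real.pi * n * (|t - s| / 2))
        = Real.cos (n * Real.pi * t - n * Real.pi * s) := by
      rw [show 2 * Real.pi * n * (|t - s| / 2) = |n * Real.pi * t - n * Real.pi * s| by
        rw [← mul_sub, abs_mul, abs_of_nonneg (by positivity : (0 : ℝ) ≤ n * Real.pi)]; ring]
      exact Real.cos_abs _
    have e2 : 2 * Real.pi * n * ((t + s) / 2) = n * Real.pi * t + n * Real.pi * s := by ring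
    rw [e1, e2, Real.cos_sub, Real.cos_add]
    field_simp
    ring
  · rcases le_total t s with hts | hts
    · rw [min_eq_left hts, abs_of_nonpos (by linarith)]
      field_simp
      ring
    · rw [min_eq_right hts, abs_of_nonneg (by linarith)]
      field_simp
      ring

/-- The solution of the two-point boundary value problem in terms of its Green's function. -/
lemma integral_greenKernel {φ φ₁ φ₂ : ℝ → ℝ} (h0 : ContinuousOn φ (Set.Icc 0 1))
    (h1 : ContinuousOn φ₁ (Set.Icc 0 1)) (h2 : ContinuousOn φ₂ (Set.Icc 0 1))
    (hd : ∀ t ∈ Set.Ioo (0 : ℝ) 1, HasDerivAt φ (φ₁ t) t)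
    (hd1 : ∀ t ∈ Set.Ioo (0 : ℝ) 1, HasDerivAt φ₁ (φ₂ t) t) (hz : φ 0 = 0) (ho : φ 1 = 0)
    {t : ℝ} (ht : t ∈ Set.Icc (0 : ℝ) 1) :
    ∫ s in (0 : ℝ)..1, (min t s - t * s) * φ₂ s = -φ t := by
  have hcont : ContinuousOn (fun s => (min t s - t * s) * φ₂ s) (Set.Icc 0 1) :=
    (by fun_prop : Continuous fun s => min t s - t * s).continuousOn.mul h2
  have sub1 : Set.Icc 0 t ⊆ Set.Icc (0 : ℝ) 1 := Set.Icc_subset_Icc le_rfl ht.2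
  have sub2 : Set.Icc t 1 ⊆ Set.Icc (0 : ℝ) 1 := Set.Icc_subset_Icc ht.1 le_rfl
  -- Left of `t` the kernel is `(1 - t) s`, right of `t` it is `t (1 - s)`; in both cases
  -- integration by parts gives an explicit antiderivative.
  have i1 : ∫ s in (0 : ℝ)..t, (min t s - t * s) * φ₂ s
      = (1 - t) * (t * φ₁ t - φ t) - (1 - t) * (0 * φ₁ 0 - φ 0) := by
    have hc : ContinuousOn (fun s => (1 - t) * (s * φ₁ s - φ s)) (Set.Icc 0 t) :=
      continuousOn_const.mul ((continuousOn_id.mul (h1.mono sub1)).sub (h0.mono sub1))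
    refine intervalIntegral.integral_eq_sub_of_hasDerivAt_of_le ht.1 hc (fun s hs => ?_)
      ((hcont.mono sub1).intervalIntegrable_of_Icc ht.1)
    have hs' : s ∈ Set.Ioo (0 : ℝ) 1 := ⟨hs.1, hs.2.trans_le ht.2⟩
    have := (((hasDerivAt_id s).mul (hd1 s hs')).sub (hd s hs')).const_mul (1 - t)
    refine this.congr_deriv ?_
    rw [min_eq_right hs.2.le]
    simp
    ring
  have i2 : ∫ s in t..1, (min t s - t * s) * φ₂ s
      = t * ((1 - 1) * φ₁ 1 + φ 1) - t * ((1 - t) * φ₁ t + φ t) := by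
    have hc : ContinuousOn (fun s => t * ((1 - s) * φ₁ s + φ s)) (Set.Icc t 1) :=
      continuousOn_const.mul (((continuousOn_const.sub continuousOn_id).mul (h1.mono sub2)).add
        (h0.mono sub2))
    refine intervalIntegral.integral_eq_sub_of_hasDerivAt_of_le ht.2 hc (fun s hs => ?_)
      ((hcont.mono sub2).intervalIntegrable_of_Icc ht.2)
    have hs' : s ∈ Set.Ioo (0 : ℝ) 1 := ⟨ht.1.trans_lt hs.1, hs.2⟩
    have := ((((hasDerivAt_id s).const_sub 1).mul (hd1 s hs')).add (hd s hs')).const_mul t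
    refine this.congr_deriv ?_
    rw [min_eq_left hs.1.le]
    simp
    ring
  rw [← intervalIntegral.integral_add_adjacent_intervals
    ((hcont.mono sub1).intervalIntegrable_of_Icc ht.1)
    ((hcont.mono sub2).intervalIntegrable_of_Icc ht.2), i1, i2, hz, ho]
  ring

/-- A `C²` function on `[0, 1]` that vanishes at the end points is the sum of an absolutely
convergent sine series. -/
lemma exists_sine_series {φ : ℝ → ℝ} (hφ : ContDiffOn ℝ 2 φ (Set.Icc 0 1)) (hz : φ 0 = 0)
    (ho : φ 1 = 0) : ∃ b : ℕ → ℝ, Summable (fun n => |b n|) ∧ b 0 = 0 ∧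
      ∀ t ∈ Set.Icc (0 : ℝ) 1, HasSum (fun n : ℕ => b n * Real.sin (n * Real.pi * t)) (φ t) := by
  have hu : UniqueDiffOn ℝ (Set.Icc (0 : ℝ) 1) := uniqueDiffOn_Icc zero_lt_one
  set φ₁ := derivWithin φ (Set.Icc 0 1) with hφ₁
  set φ₂ := derivWithin φ₁ (Set.Icc 0 1) with hφ₂
  have c1 : ContDiffOn ℝ 1 φ₁ (Set.Icc 0 1) :=
    ((contDiffOn_succ_iff_derivWithin (n := 1) hu).1 hφ).2.2
  have c2 : ContinuousOn φ₂ (Set.Icc 0 1) := c1.continuousOn_derivWithin hu le_rfl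
  have hder : ∀ {ψ : ℝ → ℝ}, DifferentiableOn ℝ ψ (Set.Icc 0 1) → ∀ t ∈ Set.Ioo (0 : ℝ) 1,
      HasDerivAt ψ (derivWithin ψ (Set.Icc 0 1) t) t := fun hψ t ht =>
    (hψ t (Set.Ioo_subset_Icc_self ht)).hasDerivWithinAt.hasDerivAt (Icc_mem_nhds ht.1 ht.2)
  obtain ⟨C, hC⟩ := isCompact_Icc.exists_bound_of_continuousOn c2
  have hC0 : 0 ≤ C := (norm_nonneg _).trans (hC 0 (by simp))
  have hii : (Set.uIoc (0 : ℝ) 1) ⊆ Set.Icc 0 1 := by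
    rw [Set.uIoc_of_le zero_le_one]
    exact Set.Ioc_subset_Icc_self
  -- These coefficients result from inserting the kernel expansion into `φ t = -∫ (min t s - t s)
  -- φ''(s) ds`. The factor `1 / n²` gives absolute summability and justifies integrating term by
  -- term.
  set b : ℕ → ℝ := fun n => -∫ s in (0 : ℝ)..1,
    2 / ((n : ℝ) ^ 2 * Real.pi ^ 2) * Real.sin (n * Real.pi * s) * φ₂ s with hb
  have hsum : Summable fun n : ℕ => 2 / ((n : ℝ) ^ 2 * Real.pi ^ 2) * C := by
    have := (Real.summable_one_div_nat_pow.2 one_lt_two).mul_left (2 / Real.pi ^ 2 * C)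
    refine this.congr fun n => ?_
    rw [div_mul_eq_div_mul_one_div 2 ((n : ℝ) ^ 2)]
    ring
  have hbd : ∀ (n : ℕ), ∀ s ∈ Set.Icc (0 : ℝ) 1,
      ‖2 / ((n : ℝ) ^ 2 * Real.pi ^ 2) * Real.sin (n * Real.pi * s) * φ₂ s‖
        ≤ 2 / ((n : ℝ) ^ 2 * Real.pi ^ 2) * C := by
    intro n s hs
    have h0 : 0 ≤ 2 / ((n : ℝ) ^ 2 * Real.pi ^ 2) := by positivity
    rw [norm_mul, norm_mul, Real.norm_of_nonneg h0]
    calc _ ≤ 2 / ((n : ℝ) ^ 2 * Real.pi ^ 2) * 1 * C := by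
          gcongr
          · exact Real.abs_sin_le_one _
          · exact hC s hs
      _ = _ := by ring
  refine ⟨b, Summable.of_nonneg_of_le (fun _ => abs_nonneg _) (fun n => ?_) hsum, by simp [hb],
    fun t ht => ?_⟩
  · rw [hb, abs_neg]
    refine (intervalIntegral.norm_integral_le_of_norm_le_const fun s hs => hbd n s (hii hs)).trans ?_
    simp
  · have hK := integral_greenKernel hφ.continuousOn c1.continuousOn c2
      (hder (hφ.differentiableOn (by simp))) (hder (c1.differentiableOn (by simp))) hz ho ht
    have key : HasSum (fun n : ℕ => ∫ s in (0 : ℝ)..1, 2 / ((n : ℝ) ^ 2 * Real.pi ^ 2) *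
        Real.sin (n * Real.pi * t) * Real.sin (n * Real.pi * s) * φ₂ s)
        (∫ s in (0 : ℝ)..1, (min t s - t * s) * φ₂ s) := by
      refine intervalIntegral.hasSum_integral_of_dominated_convergence
        (fun n _ => 2 / ((n : ℝ) ^ 2 * Real.pi ^ 2) * C) (fun n => ?_) (fun n => ?_) ?_ ?_ ?_
      · have : ContinuousOn (fun s => 2 / ((n : ℝ) ^ 2 * Real.pi ^ 2) *
          Real.sin (n * Real.pi * t) * Real.sin (n * Real.pi * s) * φ₂ s) (Set.Icc 0 1) :=
          (by fun_prop : Continuous fun s => 2 / ((n : ℝ) ^ 2 * Real.pi ^ 2) *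
            Real.sin (n * Real.pi * t) * Real.sin (n * Real.pi * s)).continuousOn.mul c2
        exact (this.mono hii).aestronglyMeasurable measurableSet_uIoc
      · refine Eventually.of_forall fun s hs => ?_
        have := hbd n s (hii hs)
        have h1 := Real.abs_sin_le_one (n * Real.pi * t)
        calc _ = |Real.sin (n * Real.pi * t)| *
              ‖2 / ((n : ℝ) ^ 2 * Real.pi ^ 2) * Real.sin (n * Real.pi * s) * φ₂ s‖ := by
              simp only [norm_mul, Real.norm_eq_abs]
              ring
          _ ≤ 1 * (2 / ((n : ℝ) ^ 2 * Real.pi ^ 2) * C) := by gcongr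
          _ = _ := one_mul _
      · exact Eventually.of_forall fun s _ => hsum
      · simp
      · exact Eventually.of_forall fun s hs => (hasSum_sin_mul_sin ht (hii hs)).mul_right _
    rw [hK] at key
    have := key.neg
    rw [neg_neg] at this
    convert! this using 2 with n
    rw [hb, neg_mul, ← intervalIntegral.integral_mul_const]
    congr 2
    ext s
    ring

end SineSeries

/-! ### The Dirichlet problem in a rectangle. -/

section Dirichlet

lemma norm_cos_le_cosh (z : ℂ) : ‖Complex.cos z‖ ≤ Real.cosh z.im := by
  rw [Complex.cos, norm_div, Real.cosh_eq]
  have h := norm_add_le (Complex.exp (z * Complex.I)) (Complex.exp (-z * Complex.I))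
  rw [Complex.norm_exp, Complex.norm_exp] at h
  simp only [Complex.mul_I_re, Complex.neg_im, neg_neg] at h
  simp only [Complex.norm_ofNat]
  linarith

lemma cos_im (z : ℂ) : (Complex.cos z).im = -(Real.sin z.re * Real.sinh z.im) := by
  conv_lhs => rw [← Complex.re_add_im z]
  rw [Complex.cos_add_mul_I, ← Complex.ofReal_cos, ← Complex.ofReal_cosh, ← Complex.ofReal_sin,
    ← Complex.ofReal_sinh]
  simp only [Complex.sub_im, Complex.mul_im, Complex.mul_re, Complex.ofReal_re,
    Complex.ofReal_im, Complex.I_re, Complex.I_im]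
  ring

/-- The solution of the Dirichlet problem in the rectangle `[0, 1] × [0, β]` with data on one
side, extended to a strip. -/
lemma exists_harmonic_strip {φ : ℝ → ℝ} (hφ : ContDiffOn ℝ 2 φ (Set.Icc 0 1)) (hz : φ 0 = 0)
    (ho : φ 1 = 0) {β : ℝ} (hβ : 0 < β) : ∃ u : ℂ → ℝ,
      HarmonicOnNhd u {z | |z.im| < β} ∧ ContinuousOn u {z | |z.im| ≤ β} ∧
      (∀ z : ℂ, z.re ∈ Set.Icc (0 : ℝ) 1 → z.im = β → u z = φ z.re) ∧
      (∀ z : ℂ, z.im = 0 → u z = 0) ∧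
      (∀ z : ℂ, |z.im| ≤ β → (z.re = 0 ∨ z.re = 1) → u z = 0) := by
  obtain ⟨b, hb, hb0, hs⟩ := exists_sine_series hφ hz ho
  have hpi := Real.pi_pos
  -- The imaginary part of the `n`-th term is `b n sin(nπx) sinh(nπy) / sinh(nπβ)`. Summing
  -- holomorphic functions makes harmonicity a consequence of locally uniform convergence.
  set f : ℕ → ℂ → ℂ := fun n z =>
    -((b n / Real.sinh (n * Real.pi * β) : ℝ) : ℂ) * Complex.cos ((n * Real.pi : ℝ) * z) with hf
  -- Bounds `cosh(nπβ) / sinh(nπβ)` for all `n ≥ 1`, because `cosh - sinh ≤ 1` there and `sinh(πβ) ≤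
  -- sinh(nπβ)`. The term `n = 0`, where `sinh` vanishes, is removed by `b 0 = 0`.
  set C := 1 + 1 / Real.sinh (Real.pi * β) with hC
  have hS : 0 < Real.sinh (Real.pi * β) := Real.sinh_pos_iff.2 (by positivity)
  have hbound : ∀ n (z : ℂ), |z.im| ≤ β → ‖f n z‖ ≤ |b n| * C := by
    intro n z hz
    rcases Nat.eq_zero_or_pos n with rfl | hn
    · simp [hf, hb0]
    have hn1 : (1 : ℝ) ≤ n := by exact_mod_cast hn
    have h1 : Real.sinh (Real.pi * β) ≤ Real.sinh (n * Real.pi * β) := by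
      rw [Real.sinh_le_sinh, mul_assoc]
      exact le_mul_of_one_le_left (by positivity) hn1
    have h2 : 0 < Real.sinh (n * Real.pi * β) := hS.trans_le h1
    have h3 : ‖Complex.cos ((n * Real.pi : ℝ) * z)‖ ≤ Real.cosh (n * Real.pi * β) := by
      have h0 : 0 ≤ n * Real.pi := by positivity
      refine (norm_cos_le_cosh _).trans ?_
      rw [Complex.im_ofReal_mul, Real.cosh_le_cosh, abs_mul, abs_mul _ β, abs_of_pos hβ]
      gcongr
    have h4 : Real.cosh (n * Real.pi * β) ≤ C * Real.sinh (n * Real.pi * β) := by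
      have e := Real.cosh_sub_sinh (n * Real.pi * β)
      have e1 : Real.exp (-(n * Real.pi * β)) ≤ 1 := Real.exp_le_one_iff.2 (by
        have : 0 ≤ n * Real.pi * β := by positivity
        linarith)
      have e2 : 1 ≤ 1 / Real.sinh (Real.pi * β) * Real.sinh (n * Real.pi * β) := by
        rw [div_mul_eq_mul_div, one_mul]
        exact (one_le_div hS).2 h1
      rw [hC, add_mul, one_mul]
      linarith
    rw [hf]
    simp only [norm_mul, norm_neg, Complex.norm_real, norm_div, Real.norm_eq_abs]
    rw [abs_of_pos h2, div_mul_eq_mul_div, div_le_iff₀ h2, mul_assoc]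
    exact mul_le_mul_of_nonneg_left (h3.trans h4) (abs_nonneg _)
  have hsummable : Summable fun n => |b n| * C := hb.mul_right C
  set F : ℂ → ℂ := fun z => ∑' n, f n z with hF
  have hopen : IsOpen {z : ℂ | |z.im| < β} :=
    isOpen_lt (continuous_abs.comp Complex.continuous_im) continuous_const
  have hdiff : DifferentiableOn ℂ F {z | |z.im| < β} := by
    refine Complex.differentiableOn_tsum_of_summable_norm hsummable (fun n => ?_) hopen
      fun n z hz => hbound n z (le_of_lt hz)
    exact (by fun_prop : Differentiable ℂ (f n)).differentiableOn
  have hcont : ContinuousOn F {z | |z.im| ≤ β} :=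
    continuousOn_tsum (fun n => (by fun_prop : Continuous (f n)).continuousOn) hsummable
      fun n z hz => hbound n z hz
  have him : ∀ z : ℂ, |z.im| ≤ β → (F z).im = ∑' n : ℕ, b n / Real.sinh (n * Real.pi * β) *
      (Real.sin (n * Real.pi * z.re) * Real.sinh (n * Real.pi * z.im)) := by
    intro z hz
    have hsum : Summable fun n => f n z :=
      Summable.of_norm_bounded hsummable fun n => hbound n z hz
    rw [hF, Complex.im_tsum hsum]
    refine tsum_congr fun n => ?_
    rw [hf]
    simp only
    rw [← Complex.ofReal_neg, Complex.im_ofReal_mul, cos_im, Complex.re_ofReal_mul,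
      Complex.im_ofReal_mul]
    ring
  refine ⟨fun z => (F z).im, fun z hz => ?_, Complex.continuous_im.comp_continuousOn hcont,
    fun z hz hi => ?_, fun z hi => ?_, fun z hi hr => ?_⟩
  · exact (hdiff.analyticAt (hopen.mem_nhds hz)).harmonicAt_im
  · simp only
    rw [him z (by rw [hi, abs_of_pos hβ]), ← (hs z.re hz).tsum_eq]
    refine tsum_congr fun n => ?_
    rcases Nat.eq_zero_or_pos n with rfl | hn
    · simp [hb0]
    have hn1 : (0 : ℝ) < n := by exact_mod_cast hn
    have : 0 < Real.sinh (n * Real.pi * β) := Real.sinh_pos_iff.2 (by positivity)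
    rw [hi]
    field_simp
  · simp only
    rw [him z (by rw [hi]; simpa using hβ.le)]
    simp [hi]
  · simp only
    rw [him z hi]
    rcases hr with hr | hr
    · simp [hr]
    · simp [hr, Real.sin_nat_mul_pi]

/-- The isometry `x ↦ x (1 - i) + σ x i I` of the plane onto `ℂ`. -/
noncomputable def toComplex (i : Fin 2) (σ : ℝ) (hσ : σ ^ 2 = 1) : Plane ≃ₗᵢ[ℝ] ℂ :=
  LinearIsometry.toLinearIsometryEquiv
    { toFun := fun x => ⟨x (1 - i), σ * x i⟩
      map_add' := fun x y => by apply Complex.ext <;> simp [mul_add]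
      map_smul' := fun c x => by apply Complex.ext <;> simp [mul_left_comm]
      norm_map' := fun x => by
        rw [EuclideanSpace.norm_eq]
        change ‖(⟨x (1 - i), σ * x i⟩ : ℂ)‖ = _
        rw [← Real.sqrt_sq (norm_nonneg _), Complex.sq_norm, Complex.normSq_mk, Fin.sum_univ_two]
        congr 1
        simp only [Real.norm_eq_abs, sq_abs]
        fin_cases i
        · simp
          linear_combination (x 0) ^ 2 * hσ
        · simp
          linear_combination (x 1) ^ 2 * hσ }
    (by simp)

lemma toComplex_re (i : Fin 2) (σ : ℝ) (hσ : σ ^ 2 = 1) (x : Plane) :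
    (toComplex i σ hσ x).re = x (1 - i) := rfl

lemma toComplex_im (i : Fin 2) (σ : ℝ) (hσ : σ ^ 2 = 1) (x : Plane) :
    (toComplex i σ hσ x).im = σ * x i := rfl

namespace Rect

/-- The point of the edge `x i = b` of the rectangle with relative position `t`. -/
noncomputable def edgePoint (R : Rect) (i : Fin 2) (b t : ℝ) : Plane :=
  WithLp.toLp 2 fun k => if k = i then b else R.lo k + t * (R.hi k - R.lo k)

lemma edgePoint_eq (R : Rect) {i : Fin 2} {b : ℝ} {x : Plane} (hx : x i = b) :
    R.edgePoint i b ((x (1 - i) - R.lo (1 - i)) / (R.hi (1 - i) - R.lo (1 - i))) = x := by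
  have h := sub_pos.2 (R.lo_lt_hi (1 - i))
  ext k
  by_cases hk : k = i
  · simp [edgePoint, hk, hx]
  · have hk' : k = 1 - i := by omega
    have : (1 - i : Fin 2) ≠ i := by rw [← hk']; exact hk
    simp only [edgePoint, hk', this, if_false]
    field_simp
    ring

/-- The harmonic function in the rectangle whose boundary values are supported on one edge. -/
lemma exists_harmonic_edge (R : Rect) (i : Fin 2) {σ b b' : ℝ}
    (hb : (σ = 1 ∧ b = R.hi i ∧ b' = R.lo i) ∨ (σ = -1 ∧ b = R.lo i ∧ b' = R.hi i))
    {φ : ℝ → ℝ} (hφ : ContDiffOn ℝ 2 φ (Set.Icc 0 1)) (hz : φ 0 = 0) (ho : φ 1 = 0) :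
    ∃ u : Plane → ℝ, HarmonicOnNhd u R.openCell ∧ ContinuousOn u R.closedCell ∧
      (∀ x ∈ R.closedCell, x i = b →
        u x = φ ((x (1 - i) - R.lo (1 - i)) / (R.hi (1 - i) - R.lo (1 - i)))) ∧
      (∀ x ∈ R.closedCell, x i = b' → u x = 0) ∧
      (∀ x ∈ R.closedCell, (x (1 - i) = R.lo (1 - i) ∨ x (1 - i) = R.hi (1 - i)) → u x = 0) := by
  have hσ : σ ^ 2 = 1 := by rcases hb with ⟨h, -⟩ | ⟨h, -⟩ <;> rw [h] <;> norm_num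
  have ha := sub_pos.2 (R.lo_lt_hi (1 - i))
  have hi := sub_pos.2 (R.lo_lt_hi i)
  set a := R.hi (1 - i) - R.lo (1 - i) with hadef
  set A := toComplex i σ hσ
  set w : ℂ := -(a⁻¹ : ℝ) * ⟨R.lo (1 - i), σ * b'⟩ with hw
  -- `T` maps the rectangle onto `[0, 1] × [0, β]` and the edge `x i = b` to the top side. The sign
  -- `σ` turns the picture over when `b` is the lower end.
  set T : Plane → ℂ := fun x => a⁻¹ • A x + w with hT
  have hre : ∀ x, (T x).re = (x (1 - i) - R.lo (1 - i)) / a := by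
    intro x
    rw [hT, hw, ← Complex.ofReal_neg]
    simp only [Complex.add_re, Complex.smul_re, Complex.re_ofReal_mul, A, toComplex_re, smul_eq_mul]
    ring
  have him : ∀ x, (T x).im = σ * (x i - b') / a := by
    intro x
    rw [hT, hw, ← Complex.ofReal_neg]
    simp only [Complex.add_im, Complex.smul_im, Complex.im_ofReal_mul, A, toComplex_im, smul_eq_mul]
    ring
  have hTc : Continuous T := by
    rw [hT]
    exact (A.continuous.const_smul a⁻¹).add continuous_const
  obtain ⟨u, hu, huc, h1, h2, h3⟩ := exists_harmonic_strip hφ hz ho (div_pos hi ha)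
  have hnn : ∀ x ∈ R.closedCell, 0 ≤ σ * (x i - b') ∧ σ * (x i - b') ≤ R.hi i - R.lo i := by
    intro x hx
    have := hx i
    rcases hb with ⟨h, -, h'⟩ | ⟨h, -, h'⟩ <;> rw [h, h'] <;> constructor <;>
      linarith [this.1, this.2]
  have habs : ∀ x ∈ R.closedCell, |(T x).im| ≤ (R.hi i - R.lo i) / a := by
    intro x hx
    obtain ⟨l, r⟩ := hnn x hx
    rw [him, abs_of_nonneg (div_nonneg l ha.le)]
    exact div_le_div_of_nonneg_right r ha.le
  refine ⟨fun x => u (T x), fun x hx => ?_, huc.comp hTc.continuousOn habs, fun x hx hxb => ?_,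
    fun x hx hxb => ?_, fun x hx hxb => ?_⟩
  · refine harmonicAt_comp_similarity A a⁻¹ w (hu _ ?_)
    change |(T x).im| < _
    have hlt : σ * (x i - b') < R.hi i - R.lo i := by
      have := hx i
      rcases hb with ⟨h, -, h'⟩ | ⟨h, -, h'⟩ <;> rw [h, h'] <;> linarith [this.1, this.2]
    rw [him, abs_of_nonneg (div_nonneg (hnn x fun k => Set.Ioo_subset_Icc_self (hx k)).1 ha.le)]
    exact div_lt_div_of_pos_right hlt ha
  · simp only
    rw [h1 (T x), hre]
    · rw [hre]
      have := hx (1 - i)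
      exact ⟨div_nonneg (by linarith [this.1]) ha.le, (div_le_one ha).2 (by linarith [this.2])⟩
    · rw [him, hxb]
      congr 1
      rcases hb with ⟨h, h', h''⟩ | ⟨h, h', h''⟩ <;> rw [h, h', h''] <;> ring
  · exact h2 _ (by rw [him, hxb]; simp)
  · refine h3 _ (habs x hx) ?_
    rw [hre]
    rcases hxb with h | h
    · left; rw [h]; simp
    · right; rw [h]; exact div_self ha.ne'

end Rect

lemma contDiff_bilinear (c₀ c₁ c₂ c₃ l₀ l₁ : ℝ) : ContDiff ℝ 2 (fun v : Plane =>
    c₀ + c₁ * (v 0 - l₀) + c₂ * (v 1 - l₁) + c₃ * ((v 0 - l₀) * (v 1 - l₁))) := by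
  fun_prop

/-- A bilinear function is affine along each axis, so both second derivatives vanish. -/
lemma harmonicAt_bilinear (c₀ c₁ c₂ c₃ l₀ l₁ : ℝ) (x : Plane) : HarmonicAt (fun v : Plane =>
    c₀ + c₁ * (v 0 - l₀) + c₂ * (v 1 - l₁) + c₃ * ((v 0 - l₀) * (v 1 - l₁))) x := by
  have hcd := contDiff_bilinear c₀ c₁ c₂ c₃ l₀ l₁
  refine ⟨hcd.contDiffAt, Eventually.of_forall fun y => ?_⟩
  rw [laplacian_eq_sum_line (EuclideanSpace.basisFun (Fin 2) ℝ) hcd.contDiffAt, Fin.sum_univ_two]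
  have haff : ∀ p q : ℝ, deriv (deriv fun t : ℝ => p + t * q) 0 = 0 := by
    intro p q
    have : deriv (fun t : ℝ => p + t * q) = fun _ => q := by
      ext t
      simp
    rw [this]
    simp
  set p := c₀ + c₁ * (y 0 - l₀) + c₂ * (y 1 - l₁) + c₃ * ((y 0 - l₀) * (y 1 - l₁))
  have e0 := haff p (c₁ + c₃ * (y 1 - l₁))
  have e1 := haff p (c₂ + c₃ * (y 0 - l₀))
  refine (congrArg₂ (· + ·) (?_ : _ = (0 : ℝ)) (?_ : _ = (0 : ℝ))).trans (add_zero 0)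
  · rw [← e0]
    congr 2
    ext t
    simp [p]
    ring
  · rw [← e1]
    congr 2
    ext t
    simp [p]
    ring

namespace Rect

/-- Subtracting this interpolant makes the boundary data vanish at the corners, as the sine series
on each edge requires. -/
lemma exists_bilinear_interpolant (R : Rect) (g : Plane → ℝ) : ∃ B : Plane → ℝ,
    ContDiff ℝ 2 B ∧ (∀ x, HarmonicAt B x) ∧
      ∀ x : Plane, (∀ i, x i = R.lo i ∨ x i = R.hi i) → B x = g x := by
  have h0 := (sub_pos.2 (R.lo_lt_hi 0)).ne'
  have h1 := (sub_pos.2 (R.lo_lt_hi 1)).ne'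
  obtain ⟨g₀₀, e₀₀⟩ : ∃ c, g !₂[R.lo 0, R.lo 1] = c := ⟨_, rfl⟩
  obtain ⟨g₁₀, e₁₀⟩ : ∃ c, g !₂[R.hi 0, R.lo 1] = c := ⟨_, rfl⟩
  obtain ⟨g₀₁, e₀₁⟩ : ∃ c, g !₂[R.lo 0, R.hi 1] = c := ⟨_, rfl⟩
  obtain ⟨g₁₁, e₁₁⟩ : ∃ c, g !₂[R.hi 0, R.hi 1] = c := ⟨_, rfl⟩
  refine ⟨_, contDiff_bilinear g₀₀ ((g₁₀ - g₀₀) / (R.hi 0 - R.lo 0))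
    ((g₀₁ - g₀₀) / (R.hi 1 - R.lo 1))
    ((g₁₁ - g₁₀ - g₀₁ + g₀₀) / ((R.hi 0 - R.lo 0) * (R.hi 1 - R.lo 1))) (R.lo 0) (R.lo 1),
    harmonicAt_bilinear _ _ _ _ _ _, fun x hx => ?_⟩
  have hxe : x = !₂[x 0, x 1] := by
    ext i
    fin_cases i <;> simp
  rw [hxe]
  rcases hx 0 with hx0 | hx0 <;> rcases hx 1 with hx1 | hx1 <;> rw [hx0, hx1]
  · rw [e₀₀]; simp
  · rw [e₀₁]; simp [div_mul_cancel₀ _ h1]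
  · rw [e₁₀]; simp [div_mul_cancel₀ _ h0]
  · rw [e₁₁]; simp [div_mul_cancel₀ _ h1, div_mul_cancel₀ _ h0, h0, h1]; ring

lemma contDiff_edgePoint (R : Rect) (i : Fin 2) (b : ℝ) :
    ContDiff ℝ 2 fun t => R.edgePoint i b t := by
  rw [contDiff_euclidean]
  intro k
  by_cases hk : k = i
  · simpa [edgePoint, hk] using contDiff_const
  · simp only [edgePoint, hk, if_false]
    fun_prop

lemma edgePoint_corner (R : Rect) {i : Fin 2} {b t : ℝ} (hb : b = R.lo i ∨ b = R.hi i)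
    (ht : t = 0 ∨ t = 1) (k : Fin 2) :
    R.edgePoint i b t k = R.lo k ∨ R.edgePoint i b t k = R.hi k := by
  by_cases hk : k = i
  · subst hk
    simpa [edgePoint] using hb
  · rcases ht with rfl | rfl <;> simp [edgePoint, hk]

/-- The Dirichlet problem in a rectangle is solvable if the data are `C²` on each edge. -/
theorem exists_dirichlet (R : Rect) {g : Plane → ℝ}
    (hg : ∀ i b, (b = R.lo i ∨ b = R.hi i) →
      ContDiffOn ℝ 2 (fun t => g (R.edgePoint i b t)) (Set.Icc 0 1)) :
    ∃ u : Plane → ℝ, HarmonicOnNhd u R.openCell ∧ ContinuousOn u R.closedCell ∧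
      Set.EqOn u g R.boundary := by
  obtain ⟨B, hBc, hBh, hBg⟩ := R.exists_bilinear_interpolant g
  have hedge : ∀ i b, (b = R.lo i ∨ b = R.hi i) →
      ContDiffOn ℝ 2 (fun t => g (R.edgePoint i b t) - B (R.edgePoint i b t)) (Set.Icc 0 1) :=
    fun i b hb => (hg i b hb).sub (hBc.comp (R.contDiff_edgePoint i b)).contDiffOn
  have hzero : ∀ i b, (b = R.lo i ∨ b = R.hi i) → ∀ t, (t = 0 ∨ t = 1) →
      g (R.edgePoint i b t) - B (R.edgePoint i b t) = 0 := fun i b hb t ht => by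
    rw [hBg _ (R.edgePoint_corner hb ht), sub_self]
  choose u hu huc hu1 hu2 hu3 using fun i => R.exists_harmonic_edge i (σ := 1) (b := R.hi i)
    (b' := R.lo i) (Or.inl ⟨rfl, rfl, rfl⟩) (hedge i _ (Or.inr rfl))
    (hzero i _ (Or.inr rfl) 0 (Or.inl rfl)) (hzero i _ (Or.inr rfl) 1 (Or.inr rfl))
  choose w hw hwc hw1 hw2 hw3 using fun i => R.exists_harmonic_edge i (σ := -1) (b := R.lo i)
    (b' := R.hi i) (Or.inr ⟨rfl, rfl, rfl⟩) (hedge i _ (Or.inl rfl))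
    (hzero i _ (Or.inl rfl) 0 (Or.inl rfl)) (hzero i _ (Or.inl rfl) 1 (Or.inr rfl))
  -- Each of the four edge solutions carries `g - B` on its own edge and is zero on the other three.
  refine ⟨B + (u 0 + w 0) + (u 1 + w 1), fun x hx => ?_, ?_, fun x hx => ?_⟩
  · exact ((hBh x).add ((hu 0 x hx).add (hw 0 x hx))).add ((hu 1 x hx).add (hw 1 x hx))
  · exact (hBc.continuous.continuousOn.add ((huc 0).add (hwc 0))).add ((huc 1).add (hwc 1))
  · obtain ⟨hxc, hxo⟩ := hx
    have key : ∀ i, (x i = R.lo i ∨ x i = R.hi i) →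
        u i x + w i x = g x - B x ∧ u (1 - i) x + w (1 - i) x = 0 := by
      intro i hi
      have hii : (1 - (1 - i) : Fin 2) = i := by fin_cases i <;> rfl
      refine ⟨?_, ?_⟩
      · rcases hi with hi | hi
        · rw [hu2 i x hxc hi, hw1 i x hxc hi, R.edgePoint_eq hi, zero_add]
        · rw [hw2 i x hxc hi, hu1 i x hxc hi, R.edgePoint_eq hi, add_zero]
      · rw [hu3 (1 - i) x hxc (by rwa [hii]), hw3 (1 - i) x hxc (by rwa [hii]), add_zero]
    have hex : ∃ i, x i = R.lo i ∨ x i = R.hi i := by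
      by_contra! h
      exact hxo fun i => ⟨lt_of_le_of_ne (hxc i).1 (h i).1.symm, lt_of_le_of_ne (hxc i).2 (h i).2⟩
    obtain ⟨i, hi⟩ := hex
    obtain ⟨k1, k2⟩ := key i hi
    simp only [Pi.add_apply]
    fin_cases i
    · simp only [Fin.zero_eta, Fin.isValue, sub_zero] at k1 k2
      linarith
    · simp only [Fin.mk_one, Fin.isValue, sub_self] at k1 k2
      linarith

end Rect

end Dirichlet

/-! ### Topology of rectangles and existence of harmonic splines. -/

namespace Rect

lemma isOpen_openCell (R : Rect) : IsOpen R.openCell := by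
  have : R.openCell = ⋂ i, (fun x : Plane => x i) ⁻¹' Set.Ioo (R.lo i) (R.hi i) := by
    ext x
    simp [openCell]
  rw [this]
  exact isOpen_iInter_of_finite fun i => isOpen_Ioo.preimage (by fun_prop)

lemma isClosed_closedCell (R : Rect) : IsClosed R.closedCell := by
  have : R.closedCell = ⋂ i, (fun x : Plane => x i) ⁻¹' Set.Icc (R.lo i) (R.hi i) := by
    ext x
    simp [closedCell]
  rw [this]
  exact isClosed_iInter fun i => isClosed_Icc.preimage (by fun_prop)

lemma openCell_subset_closedCell (R : Rect) : R.openCell ⊆ R.closedCell :=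
  fun _ hx i => Set.Ioo_subset_Icc_self (hx i)

lemma isCompact_closedCell (R : Rect) : IsCompact R.closedCell := by
  have h : R.closedCell = (EuclideanSpace.equiv (Fin 2) ℝ).toHomeomorph ⁻¹'
      (Set.univ.pi fun i => Set.Icc (R.lo i) (R.hi i)) := by
    ext x
    simp only [closedCell, Set.mem_ofPred_eq, Set.mem_preimage, Set.mem_univ_pi]
    rfl
  rw [h, Homeomorph.isCompact_preimage]
  exact isCompact_univ_pi fun i => isCompact_Icc

lemma convex_closedCell (R : Rect) : Convex ℝ R.closedCell := by
  intro x hx y hy a b ha hb hab i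
  exact convex_Icc (R.lo i) (R.hi i) (hx i) (hy i) ha hb hab

/-- The center of the rectangle. -/
noncomputable def center (R : Rect) : Plane := WithLp.toLp 2 fun i => (R.lo i + R.hi i) / 2

lemma center_mem (R : Rect) : R.center ∈ R.openCell := fun i => by
  have := R.lo_lt_hi i
  constructor <;> simp only [center] <;> linarith

lemma openCell_subset_interior (R : Rect) : R.openCell ⊆ interior R.closedCell :=
  R.isOpen_openCell.subset_interior_iff.2 R.openCell_subset_closedCell

lemma uniqueDiffOn_closedCell (R : Rect) : UniqueDiffOn ℝ R.closedCell :=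
  uniqueDiffOn_convex R.convex_closedCell ⟨_, R.openCell_subset_interior R.center_mem⟩

lemma closedCell_subset_closure_openCell (R : Rect) : R.closedCell ⊆ closure R.openCell := by
  intro x hx
  have hcont : Tendsto (fun t : ℝ => x + t • (R.center - x)) (𝓝[>] 0) (𝓝 x) := by
    have : ContinuousAt (fun t : ℝ => x + t • (R.center - x)) 0 := by fun_prop
    simpa [ContinuousAt] using this.tendsto.mono_left nhdsWithin_le_nhds
  refine mem_closure_of_tendsto hcont ?_
  filter_upwards [Ioo_mem_nhdsGT (zero_lt_one (α := ℝ))] with t ht i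
  have h1 := R.center_mem i
  have h2 := hx i
  simp only [PiLp.add_apply, PiLp.smul_apply, PiLp.sub_apply, smul_eq_mul]
  constructor <;> nlinarith [h1.1, h1.2, h2.1, h2.2, ht.1, ht.2]

lemma closure_openCell (R : Rect) : closure R.openCell = R.closedCell :=
  (closure_minimal R.openCell_subset_closedCell R.isClosed_closedCell).antisymm
    R.closedCell_subset_closure_openCell

lemma frontier_openCell (R : Rect) : frontier R.openCell = R.boundary := by
  rw [R.isOpen_openCell.frontier_eq, closure_openCell]
  rfl

/-- The unit square as a rectangle. -/
noncomputable def unit : Rect := ⟨fun _ => 0, fun _ => 1, fun _ => zero_lt_one⟩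

lemma closedCell_unit : unit.closedCell = closedSquare := rfl

lemma edgePoint_mem (R : Rect) {i : Fin 2} {b t : ℝ} (hb : b = R.lo i ∨ b = R.hi i)
    (ht : t ∈ Set.Icc (0 : ℝ) 1) : R.edgePoint i b t ∈ R.closedCell := by
  intro k
  have h := R.lo_lt_hi k
  by_cases hk : k = i
  · subst hk
    rcases hb with rfl | rfl <;> simp [edgePoint, h.le]
  · simp only [edgePoint, hk, if_false]
    constructor <;> nlinarith [ht.1, ht.2]

lemma exists_dirichlet_of_contDiffOn (R : Rect) {g : Plane → ℝ} {S : Set Plane}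
    (hg : ContDiffOn ℝ 2 g S) (hS : R.closedCell ⊆ S) :
    ∃ u : Plane → ℝ, HarmonicOnNhd u R.openCell ∧ ContinuousOn u R.closedCell ∧
      Set.EqOn u g R.boundary :=
  R.exists_dirichlet fun i b hb => hg.comp (R.contDiff_edgePoint i b).contDiffOn
    fun _ ht => hS (R.edgePoint_mem hb ht)

end Rect

lemma isOpen_openSquare : IsOpen openSquare := Rect.unit.isOpen_openCell

lemma isCompact_closedSquare : IsCompact closedSquare := Rect.unit.isCompact_closedCell

lemma openSquare_subset_closedSquare : openSquare ⊆ closedSquare :=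
  Rect.unit.openCell_subset_closedCell

lemma closure_openSquare : closure openSquare = closedSquare := Rect.unit.closure_openCell

lemma IsPartition.closedCell_subset {P : Finset Rect} (hP : IsPartition P) {R : Rect}
    (hR : R ∈ P) : R.closedCell ⊆ closedSquare := by
  rw [← hP.iUnion_eq]
  exact Set.subset_biUnion_of_mem (u := fun R : Rect => R.closedCell) hR

lemma Rect.openCell_subset_openSquare {R : Rect} (hR : R.closedCell ⊆ closedSquare) :
    R.openCell ⊆ openSquare := by
  intro x hx i
  have h1 : R.lo i ∈ Set.Icc (0 : ℝ) 1 ∧ R.hi i ∈ Set.Icc (0 : ℝ) 1 := by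
    constructor
    · exact (hR (fun k => ⟨le_rfl, (R.lo_lt_hi k).le⟩ : WithLp.toLp 2 R.lo ∈ R.closedCell) :) i
    · exact (hR (fun k => ⟨(R.lo_lt_hi k).le, le_rfl⟩ : WithLp.toLp 2 R.hi ∈ R.closedCell) :) i
  exact ⟨h1.1.1.trans_lt (hx i).1, (hx i).2.trans_le h1.2.2⟩

/-- A `C²` function has a harmonic spline on every partition. -/
theorem IsPartition.exists_spline {P : Finset Rect} (hP : IsPartition P) {f : Plane → ℝ}
    (hf : ContDiffOn ℝ 2 f closedSquare) : ∃ s, IsInterlineatingSpline f P s := by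
  have hex : ∀ R : Rect, ∃ u : Plane → ℝ, R ∈ P → HarmonicOnNhd u R.openCell ∧
      ContinuousOn u R.closedCell ∧ Set.EqOn u f R.boundary := by
    intro R
    by_cases hR : R ∈ P
    · obtain ⟨u, hu⟩ := R.exists_dirichlet_of_contDiffOn hf (hP.closedCell_subset hR)
      exact ⟨u, fun _ => hu⟩
    · exact ⟨0, fun h => absurd h hR⟩
  choose u hu using hex
  -- Gluing: since `u R = f` on the boundary of `R`, extending `f - u R` by zero is continuous.
  -- Subtracting all these bumps from `f` replaces it by `u R` on each cell.
  set d : Rect → Plane → ℝ := fun R => R.openCell.indicator fun x => f x - u R x with hd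
  have hclosed : ∀ R ∈ P, Set.EqOn (d R) (fun x => f x - u R x) R.closedCell := by
    intro R hR x hx
    by_cases hxo : x ∈ R.openCell
    · exact Set.indicator_of_mem hxo _
    · rw [hd]
      simp only [Set.indicator_of_notMem hxo]
      rw [(hu R hR).2.2 ⟨hx, hxo⟩, sub_self]
  have hdc : ∀ R ∈ P, ContinuousOn (d R) closedSquare := by
    intro R hR
    have h1 : ContinuousOn (d R) R.closedCell :=
      ((hf.continuousOn.mono (hP.closedCell_subset hR)).sub (hu R hR).2.1).congr (hclosed R hR)
    have h2 : ContinuousOn (d R) R.openCellᶜ := by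
      refine continuousOn_const.congr (f := fun _ => (0 : ℝ)) fun x hx => ?_
      exact Set.indicator_of_notMem hx _
    have h3 := h1.union_of_isClosed h2 R.isClosed_closedCell R.isOpen_openCell.isClosed_compl
    exact h3.mono fun x _ => (em (x ∈ R.openCell)).imp (fun h => R.openCell_subset_closedCell h) id
  have hdisj : ∀ R ∈ P, ∀ R' ∈ P, R' ≠ R → ∀ x ∈ R.closedCell, d R' x = 0 := by
    intro R hR R' hR' hne x hx
    refine Set.indicator_of_notMem (fun hx' => ?_) _
    rw [← R.closure_openCell, mem_closure_iff] at hx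
    obtain ⟨y, hy, hy'⟩ := hx _ R'.isOpen_openCell hx'
    exact Set.disjoint_left.1 (hP.pairwise_disjoint R' hR' R hR hne) hy hy'
  have hval : ∀ R ∈ P, Set.EqOn (fun x => f x - ∑ R ∈ P, d R x) (u R) R.closedCell := by
    intro R hR x hx
    simp only
    rw [Finset.sum_eq_single_of_mem R hR fun R' hR' hne => hdisj R hR R' hR' hne x hx,
      hclosed R hR hx]
    ring
  refine ⟨fun x => f x - ∑ R ∈ P, d R x,
    ⟨⟨hf.continuousOn.sub (continuousOn_finsetSum P hdc), fun R hR x hx => ?_⟩,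
      fun R hR x hx => ?_⟩⟩
  · refine (harmonicAt_congr_nhds ?_).2 ((hu R hR).1 x hx)
    filter_upwards [R.isOpen_openCell.mem_nhds hx] with y hy
    exact hval R hR (R.openCell_subset_closedCell hy)
  · exact (hval R hR hx.1).trans ((hu R hR).2.2 hx)

/-- The Laplacian of a function of class `C²` on the closed square extends continuously. -/
lemma exists_continuousOn_eqOn_laplacian {f : Plane → ℝ} (hf : ContDiffOn ℝ 2 f closedSquare) :
    ∃ L : Plane → ℝ, ContinuousOn L closedSquare ∧ Set.EqOn (Δ f) L openSquare := by
  have hu : UniqueDiffOn ℝ closedSquare := Rect.unit.uniqueDiffOn_closedCell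
  have hc := hf.continuousOn_iteratedFDerivWithin (m := 2) le_rfl hu
  -- Derivatives within the closed square are continuous up to the boundary, whereas `Δ f` there
  -- depends on uncontrolled values of `f` outside.
  refine ⟨fun x => ∑ i, iteratedFDerivWithin ℝ 2 f closedSquare x
    ![EuclideanSpace.basisFun (Fin 2) ℝ i, EuclideanSpace.basisFun (Fin 2) ℝ i],
    continuousOn_finsetSum _ fun i _ => ?_, fun x hx => ?_⟩
  · exact (ContinuousMultilinearMap.apply ℝ (fun _ : Fin 2 => Plane) ℝ _).continuous.comp_continuousOn
      hc
  · have hxc := openSquare_subset_closedSquare hx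
    rw [laplacian_eq_iteratedFDeriv_orthonormalBasis f (EuclideanSpace.basisFun (Fin 2) ℝ)]
    simp only
    rw [iteratedFDerivWithin_eq_iteratedFDeriv hu (hf.contDiffAt ?_) hxc]
    exact Filter.mem_of_superset (isOpen_openSquare.mem_nhds hx) openSquare_subset_closedSquare

/-- The solution of `Δ W = -1` in the unit square with zero boundary values. -/
structure IsTorsionFunction (W : Plane → ℝ) : Prop where
  continuousOn : ContinuousOn W closedSquare
  contDiffAt : ∀ x ∈ openSquare, ContDiffAt ℝ 2 W x
  laplacian : ∀ x ∈ openSquare, Δ W x = -1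
  boundary : ∀ x ∈ closedSquare \ openSquare, W x = 0
  harmonic : HarmonicOnNhd (fun x => W x + 1 / 4 * ‖x‖ ^ 2) openSquare

/-- In the plane `‖x‖² / 4` has Laplacian `1`, so it suffices to subtract it from the harmonic
function with the same boundary values. -/
lemma exists_isTorsionFunction : ∃ W, IsTorsionFunction W := by
  have hq : ContDiff ℝ 2 fun x : Plane => (1 / 4 : ℝ) * ‖x‖ ^ 2 :=
    contDiff_const.mul (contDiff_id.norm_sq ℝ)
  obtain ⟨u, hu, huc, hub⟩ :=
    Rect.unit.exists_dirichlet_of_contDiffOn hq.contDiffOn (Set.subset_univ _)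
  have hcd : ∀ x ∈ openSquare, ContDiffAt ℝ 2 (u - fun x : Plane => (1 / 4 : ℝ) * ‖x‖ ^ 2) x :=
    fun x hx => (hu x hx).1.sub hq.contDiffAt
  refine ⟨u - fun x : Plane => (1 / 4 : ℝ) * ‖x‖ ^ 2, huc.sub hq.continuous.continuousOn,
    hcd, fun x hx => ?_, fun x hx => ?_, fun x hx => ?_⟩
  · have h := laplacian_add_smul_norm_sub_sq (hu x hx).1 (-(1 / 4)) 0
    rw [(hu x hx).2.eq_of_nhds] at h
    have e : (u - fun x : Plane => (1 / 4 : ℝ) * ‖x‖ ^ 2)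
        = u + (-(1 / 4 : ℝ)) • fun x : Plane => ‖x - 0‖ ^ 2 := by
      ext y
      simp
      ring
    rw [e, h]
    simp
    norm_num
  · simp only [Pi.sub_apply]
    rw [hub hx]
    simp
  · have : (fun x => (u - fun x : Plane => (1 / 4 : ℝ) * ‖x‖ ^ 2) x + 1 / 4 * ‖x‖ ^ 2) = u := by
      ext y
      simp
    rw [this]
    exact hu x hx

/-- The error of the harmonic spline on a square on which the Laplacian is almost constant. -/
lemma IsInterlineatingSpline.abs_sub_add_le {f s W : Plane → ℝ} {P : Finset Rect}
    (hs : IsInterlineatingSpline f P s) (hP : IsPartition P) (hf : ContDiffOn ℝ 2 f closedSquare)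
    (hW : IsTorsionFunction W) {R : Rect} (hR : R ∈ P) {h : ℝ} (hh : 0 < h)
    (hside : ∀ i, R.hi i = R.lo i + h) {c ω : ℝ} (hω : 0 ≤ ω)
    (hL : ∀ x ∈ R.openCell, |Δ f x - c| ≤ ω) :
    ∀ x ∈ R.closedCell,
      |f x - s x + c * h ^ 2 * W (h⁻¹ • (x - WithLp.toLp 2 R.lo))| ≤ ω * (2 * h) ^ 2 := by
  set lo : Plane := WithLp.toLp 2 R.lo
  set T : Plane → Plane := fun x => h⁻¹ • LinearIsometryEquiv.refl ℝ Plane x + -(h⁻¹ • lo) with hT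
  have hTe : ∀ x, h⁻¹ • (x - lo) = T x := fun x => by simp [hT, sub_eq_add_neg]
  have hTi : ∀ x i, T x i = (x i - R.lo i) / h := fun x i => by
    rw [← hTe]
    simp [lo]
    ring
  have hTc : ContDiff ℝ 2 T := by
    rw [show T = fun x => h⁻¹ • (x - lo) from funext fun x => (hTe x).symm]
    fun_prop
  have hTclosed : ∀ x, x ∈ R.closedCell ↔ T x ∈ closedSquare := fun x => forall_congr' fun i => by
    simp only [Set.mem_Icc, hTi, hside, le_div_iff₀ hh, div_le_iff₀ hh, zero_mul, one_mul,
      sub_nonneg, sub_le_iff_le_add']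
  have hTopen : ∀ x, x ∈ R.openCell ↔ T x ∈ openSquare := fun x => forall_congr' fun i => by
    simp only [Set.mem_Ioo, hTi, hside, lt_div_iff₀ hh, div_lt_iff₀ hh, zero_mul, one_mul,
      sub_pos, sub_lt_iff_lt_add']
  have hRc := hP.closedCell_subset hR
  have hfd : ∀ x ∈ R.openCell, ContDiffAt ℝ 2 f x := fun x hx => hf.contDiffAt
    (Filter.mem_of_superset (R.isOpen_openCell.mem_nhds hx)
      (R.openCell_subset_closedCell.trans hRc))
  have hWd : ∀ x ∈ R.openCell, ContDiffAt ℝ 2 (fun x => W (T x)) x := fun x hx =>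
    (hW.contDiffAt (T x) ((hTopen x).1 hx)).comp x hTc.contDiffAt
  -- The factor `h²` cancels the `h⁻²` from rescaling, so `c h² W(T x)` has Laplacian `-c` and the
  -- sum has Laplacian `Δ f - c`. The radius `2 h` is a convenient bound for the diagonal.
  have key := abs_le_of_abs_laplacian_le R.isCompact_closedCell R.isOpen_openCell
    R.openCell_subset_closedCell (u := (f - s) + (c * h ^ 2) • fun x => W (T x)) (M := ω)
    (((hf.continuousOn.mono hRc).sub (hs.continuousOn.mono hRc)).add
      ((hW.continuousOn.comp hTc.continuous.continuousOn
        fun x hx => (hTclosed x).1 hx).const_smul (c * h ^ 2)))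
    (fun x hx => ((hfd x hx).sub (hs.harmonic R hR x hx).1).add
      ((hWd x hx).const_smul (c * h ^ 2))) hω (fun x hx => ?_) (fun x hx => ?_) (c := lo)
      (r := 2 * h) (fun x hx => ?_)
  · intro x hx
    have := key x hx
    rw [hTe]
    simpa using this
  · have h1 : ContDiffAt ℝ 2 (f - s) x := (hfd x hx).sub (hs.harmonic R hR x hx).1
    have h2 : ContDiffAt ℝ 2 ((c * h ^ 2) • fun x => W (T x)) x :=
      (hWd x hx).const_smul (c * h ^ 2)
    have h3 : Δ (fun x => W (T x)) x = h⁻¹ ^ 2 * Δ W (T x) :=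
      laplacian_comp_similarity _ _ _ (hW.contDiffAt (T x) ((hTopen x).1 hx))
    rw [h1.laplacian_add h2, laplacian_smul _ (hWd x hx),
      (hfd x hx).laplacian_sub (hs.harmonic R hR x hx).1, (hs.harmonic R hR x hx).2.eq_of_nhds,
      h3, hW.laplacian _ ((hTopen x).1 hx)]
    have : Δ f x - (0 : Plane → ℝ) x + (c * h ^ 2) • (h⁻¹ ^ 2 * -1) = Δ f x - c := by
      simp
      field_simp
      ring
    rw [this]
    exact hL x hx
  · have hb : T x ∈ closedSquare \ openSquare :=
      ⟨(hTclosed x).1 hx.1, fun h' => hx.2 ((hTopen x).2 h')⟩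
    simp [hs.eqOn_boundary R hR hx, hW.boundary _ hb]
  · rw [EuclideanSpace.norm_eq, Fin.sum_univ_two]
    have hb : ∀ i, ‖(x - lo) i‖ ^ 2 ≤ h ^ 2 := fun i => by
      have := hx i
      rw [hside] at this
      rw [Real.norm_eq_abs, sq_abs]
      simp only [PiLp.sub_apply, lo]
      nlinarith [this.1, this.2]
    refine Real.sqrt_le_iff.2 ⟨by positivity, ?_⟩
    nlinarith [hb 0, hb 1]

/-! ### Circle means and uniqueness through the mean value property. -/

section CircleMean

/-- The plane as `ℂ`. -/
noncomputable def planeToComplex : Plane ≃ₗᵢ[ℝ] ℂ := toComplex 1 1 (by norm_num)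

/-- Parametrization of a circle in the plane. -/
noncomputable def circlePoint (x : Plane) (r θ : ℝ) : Plane :=
  planeToComplex.symm (circleMap (planeToComplex x) r θ)

lemma continuous_circlePoint (x : Plane) (r : ℝ) : Continuous (circlePoint x r) :=
  planeToComplex.symm.continuous.comp (continuous_circleMap _ _)

lemma norm_circlePoint_sub (x : Plane) (r θ : ℝ) : ‖circlePoint x r θ - x‖ = |r| := by
  rw [← planeToComplex.norm_map, map_sub, circlePoint, LinearIsometryEquiv.apply_symm_apply]
  simp [circleMap]

/-- The mean value over a circle. -/
noncomputable def circleMean (u : Plane → ℝ) (x : Plane) (r : ℝ) : ℝ :=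
  (2 * Real.pi)⁻¹ * ∫ θ in 0..2 * Real.pi, u (circlePoint x r θ)

lemma circleMean_eq_circleAverage (u : Plane → ℝ) (x : Plane) (r : ℝ) :
    circleMean u x r
      = Real.circleAverage (fun z => u (planeToComplex.symm z)) (planeToComplex x) r := rfl

lemma circleMean_of_harmonic {u : Plane → ℝ} {x : Plane} {r : ℝ} (hr : 0 ≤ r)
    (hu : HarmonicOnNhd u (Metric.closedBall x r)) : circleMean u x r = u x := by
  rw [circleMean_eq_circleAverage, InnerProductSpace.HarmonicOnNhd.circleAverage_eq]
  · simp
  · intro z hz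
    have h := harmonicAt_comp_similarity (u := u) (x := z) planeToComplex.symm 1 0
      (by
        refine hu _ ?_
        rw [abs_of_nonneg hr] at hz
        simpa [← planeToComplex.symm.dist_map] using hz)
    simpa using h

lemma circleMean_congr {u w : Plane → ℝ} {x : Plane} {r : ℝ} (hr : 0 ≤ r)
    (h : ∀ y ∈ Metric.closedBall x r, u y = w y) : circleMean u x r = circleMean w x r := by
  unfold circleMean
  congr 1
  refine intervalIntegral.integral_congr fun θ _ => h _ ?_
  rw [mem_closedBall_iff_norm, norm_circlePoint_sub, abs_of_nonneg hr]

lemma circleMean_const (c : ℝ) (x : Plane) (r : ℝ) : circleMean (fun _ => c) x r = c := by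
  rw [circleMean_eq_circleAverage, Real.circleAverage_const]

lemma circleMean_add {u w : Plane → ℝ} {x : Plane} {r : ℝ}
    (hu : IntervalIntegrable (fun θ => u (circlePoint x r θ)) volume 0 (2 * Real.pi))
    (hw : IntervalIntegrable (fun θ => w (circlePoint x r θ)) volume 0 (2 * Real.pi)) :
    circleMean (fun y => u y + w y) x r = circleMean u x r + circleMean w x r := by
  rw [circleMean, intervalIntegral.integral_add hu hw, mul_add]
  rfl

lemma circleMean_const_mul (c : ℝ) (u : Plane → ℝ) (x : Plane) (r : ℝ) :
    circleMean (fun y => c * u y) x r = c * circleMean u x r := by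
  rw [circleMean, intervalIntegral.integral_const_mul, circleMean]
  ring

lemma intervalIntegrable_circlePoint {u : Plane → ℝ} {x : Plane} {r : ℝ} (hr : 0 ≤ r)
    (hu : ContinuousOn u (Metric.closedBall x r)) :
    IntervalIntegrable (fun θ => u (circlePoint x r θ)) volume 0 (2 * Real.pi) := by
  refine (hu.comp_continuous (continuous_circlePoint x r) fun θ => ?_).intervalIntegrable _ _
  rw [mem_closedBall_iff_norm, norm_circlePoint_sub, abs_of_nonneg hr]

/-- On the circle `‖y‖² = -‖x‖² + 2⟨x, y⟩ + r²`, and the part that is affine in `y` is harmonic. -/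
lemma circleMean_norm_sq (x : Plane) {r : ℝ} (hr : 0 ≤ r) :
    circleMean (fun y => ‖y‖ ^ 2) x r = ‖x‖ ^ 2 + r ^ 2 := by
  have h1 : circleMean (fun y => (-‖x‖ ^ 2 + 2 * (x 0 * y 0 + x 1 * y 1))) x r
      = -‖x‖ ^ 2 + 2 * (x 0 * x 0 + x 1 * x 1) := by
    refine circleMean_of_harmonic (u := fun y => (-‖x‖ ^ 2 + 2 * (x 0 * y 0 + x 1 * y 1))) hr
      fun y _ => ?_
    have := harmonicAt_bilinear (-‖x‖ ^ 2) (2 * x 0) (2 * x 1) 0 0 0 y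
    refine (harmonicAt_congr_nhds (Eventually.of_forall fun v => ?_)).1 this
    ring
  have hx : ‖x‖ ^ 2 = x 0 * x 0 + x 1 * x 1 := by
    rw [EuclideanSpace.norm_sq_eq, Fin.sum_univ_two]
    simp [sq]
  have h2 : circleMean (fun y => ‖y‖ ^ 2) x r
      = circleMean (fun y => (-‖x‖ ^ 2 + 2 * (x 0 * y 0 + x 1 * y 1)) + r ^ 2) x r := by
    unfold circleMean
    congr 1
    refine intervalIntegral.integral_congr fun θ _ => ?_
    have h3 := norm_circlePoint_sub x r θ
    set y := circlePoint x r θ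
    have h4 : ‖y - x‖ ^ 2 = r ^ 2 := by rw [h3, sq_abs]
    simp only
    rw [← h4, EuclideanSpace.norm_sq_eq, EuclideanSpace.norm_sq_eq, EuclideanSpace.norm_sq_eq]
    simp only [Fin.sum_univ_two, Real.norm_eq_abs, sq_abs, PiLp.sub_apply]
    ring
  rw [h2, circleMean_add (intervalIntegrable_circlePoint hr (by fun_prop)) (by simp),
    h1, circleMean_const, hx]
  ring

/-- A continuous function on the closed square with the mean value property and zero boundary
values vanishes. -/
lemma eq_zero_of_circleMean_eq {D : Plane → ℝ} (hc : ContinuousOn D closedSquare)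
    (hb : ∀ x ∈ closedSquare \ openSquare, D x = 0)
    (hm : ∀ x ∈ openSquare, ∃ r > 0, Metric.closedBall x r ⊆ openSquare ∧ circleMean D x r = D x) :
    ∀ x ∈ closedSquare, D x = 0 := by
  have key : ∀ {D : Plane → ℝ}, ContinuousOn D closedSquare →
      (∀ x ∈ closedSquare \ openSquare, D x = 0) →
      (∀ x ∈ openSquare, ∃ r > 0, Metric.closedBall x r ⊆ openSquare ∧
        circleMean D x r = D x) → ∀ x ∈ closedSquare, D x ≤ 0 := by
    intro D hc hb hm x hx
    obtain ⟨B, hB⟩ := isCompact_closedSquare.isBounded.exists_norm_le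
    refine le_of_forall_pos_le_add fun ε hε => ?_
    set δ := ε / (B ^ 2 + 1) with hδ
    have hδ0 : 0 < δ := by positivity
    have hcont : ContinuousOn (fun y => D y + δ * ‖y‖ ^ 2) closedSquare :=
      hc.add (by fun_prop)
    obtain ⟨y, hy, hmax⟩ := isCompact_closedSquare.exists_isMaxOn ⟨x, hx⟩ hcont
    -- After adding `δ ‖y‖²` the circle mean exceeds the value at the center by `δ r²`, which is
    -- impossible at a maximum. One radius per point is enough.
    have hyb : y ∉ openSquare := by
      intro hyo
      obtain ⟨r, hr, hball, hmean⟩ := hm y hyo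
      have hsub : Metric.closedBall y r ⊆ closedSquare :=
        hball.trans openSquare_subset_closedSquare
      have h1 : circleMean (fun y => D y + δ * ‖y‖ ^ 2) y r = D y + δ * (‖y‖ ^ 2 + r ^ 2) := by
        rw [circleMean_add (intervalIntegrable_circlePoint hr.le (hc.mono hsub))
          (intervalIntegrable_circlePoint (u := fun y => δ * ‖y‖ ^ 2) hr.le (by fun_prop)),
          circleMean_const_mul, hmean, circleMean_norm_sq y hr.le]
      have h2 : circleMean (fun y => D y + δ * ‖y‖ ^ 2) y r ≤ D y + δ * ‖y‖ ^ 2 := by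
        rw [← circleMean_const (D y + δ * ‖y‖ ^ 2) y r, circleMean, circleMean]
        refine mul_le_mul_of_nonneg_left ?_ (by positivity)
        refine intervalIntegral.integral_mono_on (by positivity)
          (intervalIntegrable_circlePoint (u := fun y => D y + δ * ‖y‖ ^ 2) hr.le
            (hcont.mono hsub)) (by simp) fun θ _ => ?_
        refine hmax (hsub ?_)
        rw [mem_closedBall_iff_norm, norm_circlePoint_sub, abs_of_pos hr]
      have : 0 < δ * r ^ 2 := by positivity
      linarith
    have h1 := hmax hx
    simp only [Set.mem_ofPred_eq, hb y ⟨hy, hyb⟩] at h1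
    have h2 : ‖y‖ ^ 2 ≤ B ^ 2 := pow_le_pow_left₀ (norm_nonneg _) (hB y hy) 2
    have h3 : δ * ‖y‖ ^ 2 ≤ ε := by
      rw [hδ, div_mul_eq_mul_div, div_le_iff₀ (by positivity)]
      nlinarith
    have h4 : 0 ≤ δ * ‖x‖ ^ 2 := by positivity
    linarith
  intro x hx
  refine le_antisymm (key hc hb hm x hx) ?_
  have := key (D := fun y => -1 * D y) (continuousOn_const.mul hc) (fun y hy => by simp [hb y hy])
    (fun y hy => by
      obtain ⟨r, hr, h1, h2⟩ := hm y hy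
      exact ⟨r, hr, h1, by rw [circleMean_const_mul, h2]⟩) x hx
  linarith

end CircleMean

/-! ### The logarithmic kernel and its truncation. -/

section LogKernel

lemma logKernel_eq (x v : Plane) : logKernel x v = -(1 / (2 * Real.pi)) * Real.log ‖x - v‖ := by
  rw [logKernel, one_div ‖x - v‖, Real.log_inv]
  ring

lemma harmonicAt_logKernel {x v : Plane} (h : v ≠ x) : HarmonicAt (logKernel x) v := by
  have hz : planeToComplex v - planeToComplex x ≠ 0 := by
    rw [sub_ne_zero]
    exact fun h' => h (planeToComplex.injective h')
  have h1 : HarmonicAt (fun z : ℂ => Real.log ‖z - planeToComplex x‖)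
      ((1 : ℝ) • planeToComplex v + 0) :=
    AnalyticAt.harmonicAt_log_norm (f := fun z => z - planeToComplex x) (by fun_prop) (by simpa)
  have h2 := (harmonicAt_comp_similarity planeToComplex 1 0 h1).const_smul
    (c := -(1 / (2 * Real.pi)))
  refine (harmonicAt_congr_nhds (Eventually.of_forall fun y => ?_)).1 h2
  rw [logKernel_eq, norm_sub_rev x y, ← planeToComplex.norm_map, map_sub]
  simp

lemma contDiffAt_logKernel {x v : Plane} (h : v ≠ x) : ContDiffAt ℝ 2 (logKernel x) v :=
  (harmonicAt_logKernel h).1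

/-- The logarithmic kernel, truncated at distance `r` from the pole. -/
noncomputable def truncatedLogKernel (r : ℝ) (x v : Plane) : ℝ :=
  -(1 / (2 * Real.pi)) * Real.log (max r ‖x - v‖)

/-- The difference between the logarithmic kernel and the truncated one. -/
noncomputable def logExcess (r t : ℝ) : ℝ :=
  1 / (2 * Real.pi) * (Real.log (max r t) - Real.log t)

lemma logKernel_eq_add (r : ℝ) (x v : Plane) :
    logKernel x v = truncatedLogKernel r x v + logExcess r ‖x - v‖ := by
  rw [logKernel_eq, truncatedLogKernel, logExcess]
  ring

lemma continuous_truncatedLogKernel {r : ℝ} (hr : 0 < r) :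
    Continuous fun p : Plane × Plane => truncatedLogKernel r p.1 p.2 := by
  refine continuous_const.mul (Continuous.log (by fun_prop) fun p => ?_)
  exact (lt_max_of_lt_left hr).ne'

/-- The circle average of `log ‖· - v‖` is `log r + log⁺ (‖x - v‖ / r)`, that is, `log (max r ‖x -
v‖)`: averaging over a circle is the same as truncating. -/
lemma circleMean_logKernel (x v : Plane) {r : ℝ} (hr : 0 < r) :
    circleMean (fun y => logKernel y v) x r = truncatedLogKernel r x v := by
  simp only [logKernel_eq]
  rw [circleMean_const_mul, truncatedLogKernel, circleMean_eq_circleAverage]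
  congr 1
  have h := circleAverage_log_norm_sub_const_eq_log_radius_add_posLog (c := planeToComplex x)
    (a := planeToComplex v) hr.ne'
  have e : (fun z : ℂ => Real.log ‖planeToComplex.symm z - v‖)
      = fun z => Real.log ‖z - planeToComplex v‖ := by
    ext z
    rw [← planeToComplex.norm_map (planeToComplex.symm z - v), map_sub,
      LinearIsometryEquiv.apply_symm_apply]
  rw [e, h, ← map_sub, planeToComplex.norm_map, Real.posLog_eq_log_max_one (by positivity),
    ← Real.log_mul hr.ne' (lt_max_of_lt_left one_pos).ne', mul_max_of_nonneg _ _ hr.le, mul_one,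
    mul_inv_cancel_left₀ hr.ne']

lemma logExcess_of_le {r t : ℝ} (h : r ≤ t) : logExcess r t = 0 := by
  rw [logExcess, max_eq_right h, sub_self, mul_zero]

lemma logExcess_nonneg {r t : ℝ} (ht : 0 < t) : 0 ≤ logExcess r t :=
  mul_nonneg (by positivity) (sub_nonneg.2 (Real.log_le_log ht (le_max_right _ _)))

lemma continuousOn_mul_logExcess (r : ℝ) : ContinuousOn
    (fun t => t * (1 / (2 * Real.pi) * (Real.log r - Real.log t))) (Set.Icc 0 r) := by
  have e : (fun t => t * (1 / (2 * Real.pi) * (Real.log r - Real.log t)))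
      = fun t => 1 / (2 * Real.pi) * (t * Real.log r - t * Real.log t) := by
    ext t
    ring
  rw [e]
  exact (continuous_const.mul ((continuous_id.mul continuous_const).sub
    Real.continuous_mul_log)).continuousOn

lemma mul_logExcess_eq_indicator (r : ℝ) : Set.EqOn (fun t => t * logExcess r t)
    ((Set.Ioc 0 r).indicator fun t => t * (1 / (2 * Real.pi) * (Real.log r - Real.log t)))
    (Set.Ioi 0) := by
  intro t ht
  by_cases h : t ≤ r
  · rw [Set.indicator_of_mem (show t ∈ Set.Ioc 0 r from ⟨ht, h⟩)]
    simp only [logExcess]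
    rw [max_eq_left h]
  · rw [Set.indicator_of_notMem (fun h' => h h'.2)]
    simp only
    rw [logExcess_of_le (not_le.1 h).le, mul_zero]

lemma integral_mul_logExcess {r : ℝ} (hr : 0 < r) :
    ∫ t in Set.Ioi (0 : ℝ), t * logExcess r t = 1 / (2 * Real.pi) * (r ^ 2 / 4) := by
  rw [setIntegral_congr_fun measurableSet_Ioi (mul_logExcess_eq_indicator r),
    setIntegral_indicator measurableSet_Ioc, Set.inter_eq_right.2 Set.Ioc_subset_Ioi_self,
    ← intervalIntegral.integral_of_le hr.le]
  -- An antiderivative of `t (log r - log t) / (2π)`, arranged around `t log t` so that it is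
  -- continuous at `0`.
  have hF : Continuous fun t : ℝ => 1 / (2 * Real.pi) *
      (t ^ 2 / 2 * Real.log r - t / 2 * (t * Real.log t) + t ^ 2 / 4) := by
    have := Real.continuous_mul_log
    fun_prop
  rw [intervalIntegral.integral_eq_sub_of_hasDerivAt_of_le hr.le hF.continuousOn (fun t ht => ?_)
    ((continuousOn_mul_logExcess r).intervalIntegrable_of_Icc hr.le)]
  · simp
    ring_nf
  · have h1 := ((hasDerivAt_pow 2 t).div_const 2).mul_const (Real.log r)
    have h2 := ((hasDerivAt_id t).div_const 2).mul (Real.hasDerivAt_mul_log ht.1.ne')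
    have h3 := (hasDerivAt_pow 2 t).div_const 4
    refine (((h1.sub h2).add h3).const_mul (1 / (2 * Real.pi))).congr_deriv ?_
    simp
    ring

lemma finrank_plane : Module.finrank ℝ Plane = 2 := by simp

lemma integrable_logExcess_norm (r : ℝ) :
    Integrable fun w : Plane => logExcess r ‖w‖ := by
  rw [integrable_fun_norm_addHaar volume (f := logExcess r), finrank_plane]
  refine IntegrableOn.congr_fun (f := fun t => t * logExcess r t) ?_
    (fun t _ => by simp) measurableSet_Ioi
  refine IntegrableOn.congr_fun ?_ (mul_logExcess_eq_indicator r).symm measurableSet_Ioi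
  refine Integrable.integrableOn ?_
  rw [integrable_indicator_iff measurableSet_Ioc]
  exact ((continuousOn_mul_logExcess r).integrableOn_Icc).mono_set Set.Ioc_subset_Icc_self

/-- In polar coordinates. This `r² / 4` is the amount by which circle averaging lowers the potential
of a unit density, the integrated form of `Δ = -1`. -/
lemma integral_logExcess_norm {r : ℝ} (hr : 0 < r) :
    ∫ w : Plane, logExcess r ‖w‖ = r ^ 2 / 4 := by
  rw [integral_fun_norm_addHaar volume (logExcess r), finrank_plane]
  have hv : (volume : Measure Plane).real (Metric.ball 0 1) = Real.pi := by
    rw [Measure.real, EuclideanSpace.volume_ball]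
    simp [Real.pi_pos.le, one_add_one_eq_two]
  have : ∫ t in Set.Ioi (0 : ℝ), t ^ (2 - 1) • logExcess r t
      = ∫ t in Set.Ioi (0 : ℝ), t * logExcess r t := by simp
  rw [this, integral_mul_logExcess hr, hv]
  have := Real.pi_pos.ne'
  simp
  field_simp

end LogKernel

/-! ### Negligible boundaries of rectangles. -/

namespace Rect

lemma convex_openCell (R : Rect) : Convex ℝ R.openCell := by
  intro x hx y hy a b ha hb hab i
  exact convex_Ioo (R.lo i) (R.hi i) (hx i) (hy i) ha hb hab

lemma volume_boundary (R : Rect) : volume R.boundary = 0 := by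
  rw [← R.frontier_openCell]
  exact R.convex_openCell.addHaar_frontier volume

lemma openCell_ae_eq_closedCell (R : Rect) : R.openCell =ᵐ[volume] R.closedCell := by
  refine (LE.le.eventuallyLE R.openCell_subset_closedCell).antisymm ?_
  rw [ae_le_set]
  exact R.volume_boundary

end Rect

lemma openSquare_ae_eq : openSquare =ᵐ[volume] closedSquare := Rect.unit.openCell_ae_eq_closedCell

lemma measurableSet_openSquare : MeasurableSet openSquare := isOpen_openSquare.measurableSet

instance : IsFiniteMeasure (volume.restrict openSquare) :=
  ⟨by
    rw [Measure.restrict_apply_univ]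
    exact (measure_mono openSquare_subset_closedSquare).trans_lt
      isCompact_closedSquare.measure_lt_top⟩

local notation "γ" => greenRegularPart openSquare

/-! ### The regular part of the Green's function as a function of both variables. -/

section GreenFunction

lemma frontier_openSquare : frontier openSquare = closedSquare \ openSquare :=
  Rect.unit.frontier_openCell

/-- The Green's function of the square exists. -/
lemma isGreenRegularPart_greenRegularPart {x : Plane} (hx : x ∈ openSquare) :
    IsGreenRegularPart openSquare x (greenRegularPart openSquare x) := by
  have hex : ∃ g, IsGreenRegularPart openSquare x g := by
    have hedge : ∀ i b, (b = Rect.unit.lo i ∨ b = Rect.unit.hi i) →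
        ContDiffOn ℝ 2 (fun t => -logKernel x (Rect.unit.edgePoint i b t)) (Set.Icc 0 1) := by
      intro i b hb t ht
      refine (ContDiffAt.comp (g := fun v => -logKernel x v) t (contDiffAt_logKernel ?_).neg
        (Rect.unit.contDiff_edgePoint i b).contDiffAt).contDiffWithinAt
      rintro rfl
      have := hx i
      simp only [Rect.edgePoint, if_true] at this
      rcases hb with rfl | rfl
      · exact lt_irrefl _ this.1
      · exact lt_irrefl _ this.2
    obtain ⟨u, hu, huc, hub⟩ := Rect.unit.exists_dirichlet (g := fun v => -logKernel x v) hedge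
    refine ⟨u, hu, ?_, fun v hv => ?_⟩
    · rw [closure_openSquare]
      exact huc
    · rw [frontier_openSquare] at hv
      rw [hub hv]
      ring
  rw [greenRegularPart, dif_pos hex]
  exact hex.choose_spec

lemma continuousOn_greenRegularPart {x : Plane} (hx : x ∈ openSquare) :
    ContinuousOn (γ x) closedSquare :=
  closure_openSquare ▸ (isGreenRegularPart_greenRegularPart hx).continuousOn

lemma harmonicOnNhd_greenRegularPart {x : Plane} (hx : x ∈ openSquare) :
    HarmonicOnNhd (γ x) openSquare :=
  (isGreenRegularPart_greenRegularPart hx).harmonic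

lemma greenRegularPart_boundary {x v : Plane} (hx : x ∈ openSquare)
    (hv : v ∈ closedSquare \ openSquare) : γ x v = -logKernel x v := by
  have := (isGreenRegularPart_greenRegularPart hx).boundary v (frontier_openSquare ▸ hv)
  linarith

/-- The maximum principle in the unit square. -/
lemma le_of_harmonic {u w : Plane → ℝ} (hu : ContinuousOn u closedSquare)
    (hw : ContinuousOn w closedSquare) (hu' : HarmonicOnNhd u openSquare)
    (hw' : HarmonicOnNhd w openSquare) (hb : ∀ v ∈ closedSquare \ openSquare, u v ≤ w v) :
    ∀ v ∈ closedSquare, u v ≤ w v := by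
  intro v hv
  have := nonpos_of_laplacian_nonneg isCompact_closedSquare isOpen_openSquare
    openSquare_subset_closedSquare (u := u - w) (hu.sub hw)
    (fun y hy => (hu' y hy).1.sub (hw' y hy).1)
    (fun y hy => by rw [((hu'.sub hw') y hy).2.eq_of_nhds]; simp)
    (fun y hy => by simpa using hb y hy) v hv
  simpa using this

lemma logKernel_sub_le {ρ : ℝ} (hρ : 0 < ρ) {x y v : Plane} (hx : ρ ≤ ‖x - v‖)
    (hy : ρ ≤ ‖y - v‖) : logKernel x v - logKernel y v ≤ ‖x - y‖ / ρ := by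
  have hx0 := hρ.trans_le hx
  have hy0 := hρ.trans_le hy
  rw [logKernel_eq, logKernel_eq]
  have h1 : Real.log ‖y - v‖ - Real.log ‖x - v‖ ≤ ‖x - y‖ / ρ := by
    rw [← Real.log_div hy0.ne' hx0.ne']
    refine (Real.log_le_sub_one_of_pos (div_pos hy0 hx0)).trans ?_
    have h2 : ‖y - v‖ - ‖x - v‖ ≤ ‖x - y‖ := by
      have := norm_sub_norm_le (y - v) (x - v)
      rwa [sub_sub_sub_cancel_right, norm_sub_rev y x] at this
    calc ‖y - v‖ / ‖x - v‖ - 1 = (‖y - v‖ - ‖x - v‖) / ‖x - v‖ := by field_simp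
      _ ≤ ‖x - y‖ / ‖x - v‖ := by gcongr
      _ ≤ ‖x - y‖ / ρ := by gcongr
  have h3 : 0 ≤ ‖x - y‖ / ρ := by positivity
  have h4 : 1 / (2 * Real.pi) ≤ 1 := by
    rw [div_le_one (by positivity)]
    linarith [Real.pi_gt_three]
  have h5 : 0 < 1 / (2 * Real.pi) := by positivity
  nlinarith

/-- The boundary data `-logKernel` are Lipschitz in the pole as long as it stays at distance `ρ`
from the boundary; the maximum principle carries the bound inside, uniformly in `v`. -/
lemma abs_greenRegularPart_sub_le {ρ : ℝ} (hρ : 0 < ρ) {x y : Plane}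
    (hx : Metric.ball x ρ ⊆ openSquare) (hy : Metric.ball y ρ ⊆ openSquare) :
    ∀ v ∈ closedSquare, |γ x v - γ y v| ≤ ‖x - y‖ / ρ := by
  have key : ∀ {x y : Plane}, Metric.ball x ρ ⊆ openSquare → Metric.ball y ρ ⊆ openSquare →
      ∀ v ∈ closedSquare, γ x v ≤ γ y v + ‖x - y‖ / ρ := by
    intro x y hx hy
    have hx' := hx (Metric.mem_ball_self hρ)
    have hy' := hy (Metric.mem_ball_self hρ)
    have hfar : ∀ {x v : Plane}, Metric.ball x ρ ⊆ openSquare → v ∈ closedSquare \ openSquare →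
        ρ ≤ ‖x - v‖ := by
      intro x v hx hv
      by_contra! h
      refine hv.2 (hx ?_)
      rwa [mem_ball_iff_norm, norm_sub_rev]
    refine le_of_harmonic (w := γ y + fun _ => ‖x - y‖ / ρ) (continuousOn_greenRegularPart hx')
      ((continuousOn_greenRegularPart hy').add continuousOn_const)
      (harmonicOnNhd_greenRegularPart hx')
      ((harmonicOnNhd_greenRegularPart hy').add (harmonicOnNhd_const _)) fun v hv => ?_
    have := logKernel_sub_le hρ (hfar hy hv) (hfar hx hv)
    rw [norm_sub_rev] at this
    simp only [Pi.add_apply]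
    rw [greenRegularPart_boundary hx' hv, greenRegularPart_boundary hy' hv]
    linarith
  intro v hv
  have h1 := key hx hy v hv
  have h2 := key hy hx v hv
  rw [norm_sub_rev] at h2
  exact abs_sub_le_iff.2 ⟨by linarith, by linarith⟩

lemma exists_ball_subset {x : Plane} (hx : x ∈ openSquare) :
    ∃ ρ > 0, ∀ y ∈ Metric.ball x ρ, Metric.ball y ρ ⊆ openSquare := by
  obtain ⟨ε, hε, h⟩ := Metric.isOpen_iff.1 isOpen_openSquare x hx
  refine ⟨ε / 2, half_pos hε, fun y hy z hz => h ?_⟩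
  have := dist_triangle z y x
  rw [Metric.mem_ball] at *
  linarith

lemma continuousOn_greenRegularPart_uncurry :
    ContinuousOn (fun p : Plane × Plane => γ p.1 p.2) (openSquare ×ˢ closedSquare) := by
  rintro ⟨x, v⟩ ⟨hx, hv⟩
  obtain ⟨ρ, hρ, hball⟩ := exists_ball_subset hx
  have h1 : Tendsto (fun p : Plane × Plane => γ x p.2) (𝓝[openSquare ×ˢ closedSquare] (x, v))
      (𝓝 (γ x v)) :=
    (continuousOn_greenRegularPart hx v hv).tendsto.comp
      (tendsto_nhdsWithin_iff.2 ⟨(continuous_snd.tendsto (x, v)).mono_left nhdsWithin_le_nhds,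
        eventually_mem_nhdsWithin.mono fun p hp => hp.2⟩)
  have h2 : Tendsto (fun p : Plane × Plane => ‖p.1 - x‖ / ρ)
      (𝓝[openSquare ×ˢ closedSquare] (x, v)) (𝓝 0) := by
    have : Continuous fun p : Plane × Plane => ‖p.1 - x‖ / ρ := by fun_prop
    simpa using (this.tendsto (x, v)).mono_left nhdsWithin_le_nhds
  have h3 : Tendsto (fun p : Plane × Plane => γ p.1 p.2 - γ x p.2)
      (𝓝[openSquare ×ˢ closedSquare] (x, v)) (𝓝 0) := by
    refine squeeze_zero_norm' ?_ h2
    have hm : ∀ᶠ p : Plane × Plane in 𝓝[openSquare ×ˢ closedSquare] (x, v),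
        p.1 ∈ Metric.ball x ρ :=
      ((continuous_fst.tendsto (x, v)).mono_left nhdsWithin_le_nhds).eventually
        (Metric.ball_mem_nhds x hρ)
    filter_upwards [hm, eventually_mem_nhdsWithin] with p hp hp'
    exact abs_greenRegularPart_sub_le hρ (hball _ hp) (hball x (Metric.mem_ball_self hρ)) _ hp'.2
  simpa [ContinuousWithinAt] using h3.add h1

lemma circlePoint_mem {x : Plane} {r : ℝ} (hr : 0 ≤ r)
    (h : Metric.closedBall x r ⊆ openSquare) (θ : ℝ) : circlePoint x r θ ∈ openSquare := by
  refine h ?_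
  rw [mem_closedBall_iff_norm, norm_circlePoint_sub, abs_of_nonneg hr]

/-- The mean value property of the regular part with respect to the pole. -/
lemma circleMean_greenRegularPart {x : Plane} {r : ℝ} (hr : 0 < r)
    (h : Metric.closedBall x r ⊆ openSquare) {v : Plane} (hv : v ∈ closedSquare) :
    circleMean (fun y => γ y v) x r = γ x v := by
  have hx : x ∈ openSquare := h (Metric.mem_closedBall_self hr.le)
  have hcont : ContinuousOn (fun v => circleMean (fun y => γ y v) x r) closedSquare := by
    rw [continuousOn_iff_continuous_domRestrict]
    refine continuous_const.mul
      (intervalIntegral.continuous_parametric_intervalIntegral_of_continuous' ?_ _ _)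
    exact continuousOn_greenRegularPart_uncurry.comp_continuous
      (f := fun p : closedSquare × ℝ => (circlePoint x r p.2, (p.1 : Plane)))
      (((continuous_circlePoint x r).comp continuous_snd).prodMk
        (continuous_subtype_val.comp continuous_fst))
      fun p => ⟨circlePoint_mem hr.le h p.2, p.1.2⟩
  -- The difference is studied as a function of `v`. It vanishes for `v` on the boundary, where
  -- truncation at `r ≤ ‖x - v‖` changes nothing, and it inherits the mean value property in `v` by
  -- Fubini. Symmetry of the Green's function is not needed.
  have hzero := eq_zero_of_circleMean_eq (D := fun v => circleMean (fun y => γ y v) x r - γ x v)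
    (hcont.sub (continuousOn_greenRegularPart hx)) (fun v hv => ?_) (fun v hv => ?_) v hv
  · linarith
  · have h1 : circleMean (fun y => γ y v) x r = circleMean (fun y => -1 * logKernel y v) x r := by
      refine circleMean_congr hr.le fun y hy => ?_
      rw [greenRegularPart_boundary (h hy) hv]
      ring
    have h2 : r ≤ ‖x - v‖ := by
      by_contra! hlt
      refine hv.2 (h ?_)
      rw [mem_closedBall_iff_norm, norm_sub_rev]
      exact hlt.le
    rw [h1, circleMean_const_mul, circleMean_logKernel x v hr, greenRegularPart_boundary hx hv,
      truncatedLogKernel, max_eq_right h2, logKernel_eq]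
    ring
  · obtain ⟨ε, hε, hball⟩ := Metric.isOpen_iff.1 isOpen_openSquare v hv
    have hε2 : 0 ≤ ε / 2 := by positivity
    have hs : Metric.closedBall v (ε / 2) ⊆ openSquare :=
      (Metric.closedBall_subset_ball (by linarith)).trans hball
    refine ⟨ε / 2, by positivity, hs, ?_⟩
    have hsc := hs.trans openSquare_subset_closedSquare
    have e1 : circleMean (fun v => circleMean (fun y => γ y v) x r + -1 * γ x v) v (ε / 2)
        = circleMean (fun v => circleMean (fun y => γ y v) x r) v (ε / 2) + -1 * γ x v := by
      rw [circleMean_add (intervalIntegrable_circlePoint hε2 (hcont.mono hsc))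
        (intervalIntegrable_circlePoint (u := fun v => -1 * γ x v) hε2
          (continuousOn_const.mul ((continuousOn_greenRegularPart hx).mono hsc))),
        circleMean_const_mul, circleMean_of_harmonic hε2
          ((harmonicOnNhd_greenRegularPart hx).mono hs)]
    have e2 : circleMean (fun v => circleMean (fun y => γ y v) x r) v (ε / 2)
        = circleMean (fun y => circleMean (fun v => γ y v) v (ε / 2)) x r := by
      have hcc : Continuous (Function.uncurry fun θ φ : ℝ =>
          γ (circlePoint x r φ) (circlePoint v (ε / 2) θ)) := by
        exact continuousOn_greenRegularPart_uncurry.comp_continuous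
          (f := fun p : ℝ × ℝ => (circlePoint x r p.2, circlePoint v (ε / 2) p.1))
          (((continuous_circlePoint x r).comp continuous_snd).prodMk
            ((continuous_circlePoint v _).comp continuous_fst))
          fun p => ⟨circlePoint_mem hr.le h p.2,
            openSquare_subset_closedSquare (circlePoint_mem hε2 hs p.1)⟩
      simp only [circleMean]
      rw [intervalIntegral.integral_const_mul, intervalIntegral.integral_const_mul,
        intervalIntegral_intervalIntegral_swap]
      exact (hcc.continuousOn.integrableOn_compact
        (isCompact_uIcc.prod isCompact_uIcc)).mono_set
          (Set.prod_mono Set.uIoc_subset_uIcc Set.uIoc_subset_uIcc)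
    have e3 : circleMean (fun y => circleMean (fun v => γ y v) v (ε / 2)) x r
        = circleMean (fun y => γ y v) x r :=
      circleMean_congr hr.le fun y hy =>
        circleMean_of_harmonic hε2 ((harmonicOnNhd_greenRegularPart (h hy)).mono hs)
    simp only [sub_eq_add_neg, ← neg_one_mul (γ x _)]
    rw [e1, e2, e3]

end GreenFunction

/-! ### The logarithmic potential of the square. -/

section Potential

lemma integrable_logExcess_sub (r : ℝ) (x : Plane) :
    Integrable fun v : Plane => logExcess r ‖x - v‖ :=
  (integrable_logExcess_norm r).comp_sub_left x

lemma logExcess_sub_nonneg_ae (r : ℝ) (x : Plane) :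
    ∀ᵐ v : Plane, 0 ≤ logExcess r ‖x - v‖ := by
  have : ∀ᵐ v : Plane, v ≠ x := by simp [ae_iff]
  filter_upwards [this] with v hv
  exact logExcess_nonneg (norm_pos_iff.2 (sub_ne_zero.2 hv.symm))

lemma integral_logExcess_sub {r : ℝ} (hr : 0 < r) (x : Plane) :
    ∫ v : Plane, logExcess r ‖x - v‖ = r ^ 2 / 4 := by
  rw [integral_sub_left_eq_self (fun w : Plane => logExcess r ‖w‖), integral_logExcess_norm hr]

lemma setIntegral_logExcess_le {r : ℝ} (hr : 0 < r) (x : Plane) :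
    ∫ v in openSquare, logExcess r ‖x - v‖ ≤ r ^ 2 / 4 := by
  rw [← integral_logExcess_sub hr x]
  exact setIntegral_le_integral (integrable_logExcess_sub r x) (logExcess_sub_nonneg_ae r x)

lemma setIntegral_logExcess_nonneg (r : ℝ) (x : Plane) :
    0 ≤ ∫ v in openSquare, logExcess r ‖x - v‖ :=
  integral_nonneg_of_ae (ae_restrict_of_ae (logExcess_sub_nonneg_ae r x))

lemma setIntegral_logExcess_eq {r : ℝ} (hr : 0 < r) {x : Plane}
    (h : Metric.closedBall x r ⊆ openSquare) :
    ∫ v in openSquare, logExcess r ‖x - v‖ = r ^ 2 / 4 := by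
  rw [← integral_logExcess_sub hr x]
  refine setIntegral_eq_integral_of_forall_compl_eq_zero fun v hv => logExcess_of_le ?_
  by_contra! hlt
  refine hv (h ?_)
  rw [mem_closedBall_iff_norm, norm_sub_rev]
  exact hlt.le

lemma integrableOn_openSquare {u : Plane → ℝ} (hu : ContinuousOn u closedSquare) :
    IntegrableOn u openSquare :=
  (hu.integrableOn_compact isCompact_closedSquare).mono_set openSquare_subset_closedSquare

lemma integrableOn_truncatedLogKernel {r : ℝ} (hr : 0 < r) (x : Plane) :
    IntegrableOn (truncatedLogKernel r x) openSquare :=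
  integrableOn_openSquare
    ((continuous_truncatedLogKernel hr).comp (by fun_prop : Continuous fun v => (x, v))).continuousOn

lemma integrableOn_logKernel (x : Plane) : IntegrableOn (logKernel x) openSquare := by
  have h := (integrableOn_truncatedLogKernel one_pos x).add
    (integrable_logExcess_sub 1 x).integrableOn
  exact h.congr (Eventually.of_forall fun v => (logKernel_eq_add 1 x v).symm)

/-- The logarithmic potential of the unit square. -/
noncomputable def logPotential (x : Plane) : ℝ := ∫ v in openSquare, logKernel x v

lemma logPotential_eq {r : ℝ} (hr : 0 < r) (x : Plane) :
    logPotential x = (∫ v in openSquare, truncatedLogKernel r x v)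
      + ∫ v in openSquare, logExcess r ‖x - v‖ := by
  rw [logPotential, ← integral_add (integrableOn_truncatedLogKernel hr x)
    (integrable_logExcess_sub r x).integrableOn]
  simp only [← logKernel_eq_add]

lemma continuous_integral_openSquare {u : Plane → Plane → ℝ} (hu : Continuous u.uncurry) :
    Continuous fun x => ∫ v in openSquare, u x v := by
  simp only [setIntegral_congr_set openSquare_ae_eq]
  exact continuous_parametric_integral_of_continuous hu isCompact_closedSquare

/-- The potentials of the truncated kernels are continuous and differ from `logPotential` by at most
`r² / 4`, uniformly in `x`. -/
lemma continuous_logPotential : Continuous logPotential := by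
  have hu : TendstoUniformly (fun (n : ℕ) x => ∫ v in openSquare,
      truncatedLogKernel (1 / (n + 1 : ℝ)) x v) logPotential atTop := by
    rw [Metric.tendstoUniformly_iff]
    intro ε hε
    have h0 : Tendsto (fun n : ℕ => (1 / (n + 1 : ℝ)) ^ 2 / 4) atTop (𝓝 0) := by
      simpa using (tendsto_one_div_add_atTop_nhds_zero_nat (𝕜 := ℝ)).pow 2 |>.div_const 4
    filter_upwards [h0.eventually (gt_mem_nhds hε)] with n hn x
    have hr : (0 : ℝ) < 1 / (n + 1 : ℝ) := by positivity
    rw [logPotential_eq hr, Real.dist_eq, add_sub_cancel_left,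
      abs_of_nonneg (setIntegral_logExcess_nonneg _ _)]
    exact (setIntegral_logExcess_le hr x).trans_lt hn
  refine hu.continuous (Frequently.of_forall fun n => ?_)
  exact continuous_integral_openSquare (continuous_truncatedLogKernel (by positivity))

lemma circleMean_setIntegral {u : Plane → Plane → ℝ} {x : Plane} {r : ℝ}
    (h : Integrable (fun p : ℝ × Plane => u (circlePoint x r p.1) p.2)
      ((volume.restrict (Set.uIoc 0 (2 * Real.pi))).prod (volume.restrict openSquare))) :
    circleMean (fun y => ∫ v in openSquare, u y v) x r
      = ∫ v in openSquare, circleMean (fun y => u y v) x r := by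
  unfold circleMean
  rw [intervalIntegral_integral_swap (f := fun θ v => u (circlePoint x r θ) v) h,
    integral_const_mul]

/-- By Fubini averaging truncates the kernel, and what is lost is the integral of `logExcess`. It
has its full value `r² / 4` because the disc lies in the square. -/
lemma circleMean_logPotential {x : Plane} {r : ℝ} (hr : 0 < r)
    (h : Metric.closedBall x r ⊆ openSquare) :
    circleMean logPotential x r = logPotential x - r ^ 2 / 4 := by
  have hmeas : Measurable fun p : ℝ × Plane => logKernel (circlePoint x r p.1) p.2 := by
    simp only [logKernel_eq]
    refine (Real.measurable_log.comp (Continuous.measurable ?_)).const_mul _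
    exact (((continuous_circlePoint x r).comp continuous_fst).sub continuous_snd).norm
  have hint : Integrable (fun p : ℝ × Plane => logKernel (circlePoint x r p.1) p.2)
      ((volume.restrict (Set.uIoc 0 (2 * Real.pi))).prod (volume.restrict openSquare)) := by
    have hθ : ∀ θ, Integrable (fun v => logKernel (circlePoint x r θ) v)
        (volume.restrict openSquare) := fun θ => integrableOn_logKernel (circlePoint x r θ)
    refine (integrable_prod_iff hmeas.aestronglyMeasurable).2 ⟨Eventually.of_forall hθ, ?_⟩
    have hc : Continuous fun θ => (∫ v in openSquare,
        ‖truncatedLogKernel 1 (circlePoint x r θ) v‖) + 1 ^ 2 / 4 :=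
      ((continuous_integral_openSquare (u := fun x v => ‖truncatedLogKernel 1 x v‖)
        (continuous_truncatedLogKernel one_pos).norm).comp
        (continuous_circlePoint x r)).add continuous_const
    refine Integrable.mono' (hc.continuousOn.integrableOn_compact isCompact_uIcc |>.mono_set
      Set.uIoc_subset_uIcc) hmeas.aestronglyMeasurable.norm.integral_prod_right'
      (Eventually.of_forall fun θ => ?_)
    rw [Real.norm_of_nonneg (integral_nonneg fun _ => norm_nonneg _)]
    set y := circlePoint x r θ
    calc ∫ v in openSquare, ‖logKernel y v‖
        ≤ ∫ v in openSquare, (‖truncatedLogKernel 1 y v‖ + logExcess 1 ‖y - v‖) := by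
          refine integral_mono_ae (integrableOn_logKernel y).norm
            ((integrableOn_truncatedLogKernel one_pos y).norm.add
              (integrable_logExcess_sub 1 y).integrableOn) ?_
          filter_upwards [ae_restrict_of_ae (logExcess_sub_nonneg_ae 1 y)] with v hv
          rw [logKernel_eq_add 1]
          refine (norm_add_le _ _).trans (add_le_add le_rfl ?_)
          rw [Real.norm_of_nonneg hv]
      _ ≤ _ := by
          rw [integral_add (integrableOn_truncatedLogKernel one_pos y).norm
            (integrable_logExcess_sub 1 y).integrableOn]
          exact add_le_add le_rfl (setIntegral_logExcess_le one_pos y)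
  have h1 := circleMean_setIntegral hint
  simp only [circleMean_logKernel x _ hr] at h1
  have h2 := logPotential_eq hr x
  rw [setIntegral_logExcess_eq hr h] at h2
  change circleMean (fun y => ∫ v in openSquare, logKernel y v) x r = _
  rw [h1, h2]
  ring

end Potential

/-! ### The integral of the Green's function is the torsion function. -/

section GreenIntegral

lemma integrableOn_greenRegularPart {x : Plane} (hx : x ∈ openSquare) :
    IntegrableOn (γ x) openSquare :=
  integrableOn_openSquare (continuousOn_greenRegularPart hx)

lemma integrableOn_greenFunction {x : Plane} (hx : x ∈ openSquare) :
    IntegrableOn (greenFunction openSquare x) openSquare :=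
  (integrableOn_logKernel x).add (integrableOn_greenRegularPart hx)

lemma greenIntegral_eq {x : Plane} (hx : x ∈ openSquare) :
    greenIntegral x = logPotential x + ∫ v in openSquare, γ x v :=
  integral_add (integrableOn_logKernel x) (integrableOn_greenRegularPart hx)

lemma continuousOn_integral_greenRegularPart :
    ContinuousOn (fun x => ∫ v in openSquare, γ x v) openSquare := by
  intro x hx
  obtain ⟨ρ, hρ, hball⟩ := exists_ball_subset hx
  refine ContinuousAt.continuousWithinAt ?_
  rw [ContinuousAt, tendsto_iff_norm_sub_tendsto_zero]
  have h2 : Tendsto (fun y : Plane => ‖y - x‖ / ρ * volume.real openSquare) (𝓝 x) (𝓝 0) := by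
    have : Continuous fun y : Plane => ‖y - x‖ / ρ * volume.real openSquare := by fun_prop
    simpa using this.tendsto x
  refine squeeze_zero' (Eventually.of_forall fun _ => norm_nonneg _) ?_ h2
  filter_upwards [Metric.ball_mem_nhds x hρ] with y hy
  have hx' := hball x (Metric.mem_ball_self hρ)
  have hy' := hball y hy
  rw [← integral_sub (integrableOn_greenRegularPart (hy' (Metric.mem_ball_self hρ)))
    (integrableOn_greenRegularPart hx)]
  refine norm_setIntegral_le_of_norm_le_const ?_ fun v hv =>
    abs_greenRegularPart_sub_le hρ hy' hx' v (openSquare_subset_closedSquare hv)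
  exact (measure_mono openSquare_subset_closedSquare).trans_lt
    isCompact_closedSquare.measure_lt_top

lemma circleMean_integral_greenRegularPart {x : Plane} {r : ℝ} (hr : 0 < r)
    (h : Metric.closedBall x r ⊆ openSquare) :
    circleMean (fun y => ∫ v in openSquare, γ y v) x r = ∫ v in openSquare, γ x v := by
  rw [circleMean_setIntegral]
  · refine setIntegral_congr_fun measurableSet_openSquare fun v hv => ?_
    exact circleMean_greenRegularPart hr h (openSquare_subset_closedSquare hv)
  · rw [Measure.prod_restrict]
    have hc : ContinuousOn (fun p : ℝ × Plane => γ (circlePoint x r p.1) p.2)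
        (Set.uIcc 0 (2 * Real.pi) ×ˢ closedSquare) :=
      continuousOn_greenRegularPart_uncurry.comp
        (f := fun p : ℝ × Plane => (circlePoint x r p.1, p.2))
        (((continuous_circlePoint x r).comp continuous_fst).prodMk continuous_snd).continuousOn
        fun p hp => ⟨circlePoint_mem hr.le h p.1, hp.2⟩
    exact (hc.integrableOn_compact (μ := volume.prod volume)
      (isCompact_uIcc.prod isCompact_closedSquare)).mono_set
      (Set.prod_mono Set.uIoc_subset_uIcc openSquare_subset_closedSquare)

lemma greenFunction_nonneg {x v : Plane} (hx : x ∈ openSquare) (hv : v ∈ closedSquare)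
    (hvx : v ≠ x) : 0 ≤ greenFunction openSquare x v := by
  obtain ⟨C, hC⟩ := isCompact_closedSquare.exists_bound_of_continuousOn
    (continuousOn_greenRegularPart hx)
  -- On the circle of radius `ρ` the kernel is at least `C` and so dominates the regular part. The
  -- second bound keeps `v` outside the removed disc, where the maximum principle applies.
  set ρ := min (Real.exp (-(2 * Real.pi * C))) ‖v - x‖ with hρ
  have hρ0 : 0 < ρ := lt_min (Real.exp_pos _) (norm_pos_iff.2 (sub_ne_zero.2 hvx))
  have hne : ∀ y ∈ closedSquare \ Metric.ball x ρ, y ≠ x := by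
    rintro y hy rfl
    exact hy.2 (Metric.mem_ball_self hρ0)
  have h := nonpos_of_laplacian_nonneg
    (K := closedSquare \ Metric.ball x ρ) (U := openSquare \ Metric.closedBall x ρ)
    (u := -(logKernel x) - γ x) (isCompact_closedSquare.diff Metric.isOpen_ball)
    (isOpen_openSquare.sdiff Metric.isClosed_closedBall)
    (Set.sdiff_subset_sdiff openSquare_subset_closedSquare Metric.ball_subset_closedBall)
    (ContinuousOn.sub (fun y hy => (contDiffAt_logKernel (hne y hy)).neg.continuousAt.continuousWithinAt)
      ((continuousOn_greenRegularPart hx).mono Set.sdiff_subset))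
    (fun y hy => ?_) (fun y hy => ?_) (fun y hy => ?_) v ⟨hv, ?_⟩
  · simp only [Pi.sub_apply, Pi.neg_apply] at h
    rw [greenFunction]
    linarith
  · have hy' := hne y ⟨openSquare_subset_closedSquare hy.1, fun h' => hy.2
      (Metric.ball_subset_closedBall h')⟩
    exact (contDiffAt_logKernel hy').neg.sub (harmonicOnNhd_greenRegularPart hx y hy.1).1
  · have hy' := hne y ⟨openSquare_subset_closedSquare hy.1, fun h' => hy.2
      (Metric.ball_subset_closedBall h')⟩
    rw [((harmonicAt_logKernel hy').neg.sub
      (harmonicOnNhd_greenRegularPart hx y hy.1)).2.eq_of_nhds]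
    simp
  · simp only [Pi.sub_apply, Pi.neg_apply]
    by_cases hyo : y ∈ openSquare
    · have h1 : y ∈ Metric.closedBall x ρ := by
        by_contra h'
        exact hy.2 ⟨hyo, h'⟩
      have h2 : ‖x - y‖ = ρ := by
        rw [norm_sub_rev]
        refine le_antisymm (mem_closedBall_iff_norm.1 h1) ?_
        have := hy.1.2
        rwa [mem_ball_iff_norm, not_lt] at this
      have h3 := hC y hy.1.1
      rw [Real.norm_eq_abs, abs_le] at h3
      have h4 : Real.log ρ ≤ -(2 * Real.pi * C) := by
        rw [Real.log_le_iff_le_exp hρ0]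
        exact min_le_left _ _
      have h5 : 1 / (2 * Real.pi) * Real.log ρ ≤ -C := by
        rw [div_mul_eq_mul_div, one_mul, div_le_iff₀ (by positivity)]
        linarith
      rw [logKernel_eq, h2]
      linarith
    · rw [greenRegularPart_boundary hx ⟨hy.1.1, hyo⟩]
      linarith
  · rw [mem_ball_iff_norm, not_lt]
    exact min_le_right _ _

/-- An image charge at `x'`: `-logKernel x'` is harmonic in the square and dominates the regular
part on the boundary, hence everywhere. -/
lemma greenFunction_le {x x' v : Plane} (hx : x ∈ openSquare) (hx' : x' ∉ closedSquare)
    (hle : ∀ v ∈ closedSquare, ‖x - v‖ ≤ ‖x' - v‖) (hv : v ∈ closedSquare) :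
    greenFunction openSquare x v ≤ logKernel x v - logKernel x' v := by
  have hne : ∀ y ∈ closedSquare, y ≠ x' := fun y hy h => hx' (h ▸ hy)
  have := le_of_harmonic (u := γ x) (w := -(logKernel x')) (continuousOn_greenRegularPart hx)
    (fun y hy => (contDiffAt_logKernel (hne y hy)).neg.continuousAt.continuousWithinAt)
    (harmonicOnNhd_greenRegularPart hx)
    (fun y hy => (harmonicAt_logKernel (hne y (openSquare_subset_closedSquare hy))).neg)
    (fun y hy => ?_) v hv
  · simp only [Pi.neg_apply] at this
    rw [greenFunction]
    linarith
  · rw [greenRegularPart_boundary hx hy, Pi.neg_apply, logKernel_eq, logKernel_eq]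
    have h0 : 0 < ‖x - y‖ := norm_pos_iff.2 (sub_ne_zero.2 fun h => hy.2 (h ▸ hx))
    have h1 := Real.log_le_log h0 (hle y hy.1)
    have h2 : 0 < 1 / (2 * Real.pi) := by positivity
    nlinarith

/-- The reflection in the line `x i = β`. -/
noncomputable def reflect (i : Fin 2) (β : ℝ) (x : Plane) : Plane :=
  x + (2 * (β - x i)) • EuclideanSpace.single i 1

lemma continuous_reflect (i : Fin 2) (β : ℝ) : Continuous (reflect i β) := by
  unfold reflect
  fun_prop

lemma reflect_apply_self (i : Fin 2) (β : ℝ) (x : Plane) : reflect i β x i = 2 * β - x i := by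
  simp [reflect]
  ring

lemma norm_reflect_sub (i : Fin 2) (β : ℝ) (x v : Plane) :
    ‖reflect i β x - v‖ ^ 2 = ‖x - v‖ ^ 2 + 4 * ((β - x i) * (β - v i)) := by
  rw [EuclideanSpace.norm_sq_eq, EuclideanSpace.norm_sq_eq]
  fin_cases i <;> simp [reflect, Fin.sum_univ_two] <;> ring

lemma greenIntegral_nonneg {x : Plane} (hx : x ∈ openSquare) : 0 ≤ greenIntegral x := by
  refine integral_nonneg_of_ae ?_
  have : ∀ᵐ v : Plane, v ≠ x := by simp [ae_iff]
  filter_upwards [ae_restrict_of_ae this, ae_restrict_mem measurableSet_openSquare] with v hv hv'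
  exact greenFunction_nonneg hx (openSquare_subset_closedSquare hv') hv

lemma greenIntegral_le {x : Plane} (hx : x ∈ openSquare) {i : Fin 2} {β : ℝ}
    (hβ : β = 0 ∨ β = 1) :
    greenIntegral x ≤ logPotential x - logPotential (reflect i β x) := by
  rw [logPotential, logPotential, ← integral_sub (integrableOn_logKernel x)
    (integrableOn_logKernel _)]
  refine setIntegral_mono_on (integrableOn_greenFunction hx)
    ((integrableOn_logKernel x).sub (integrableOn_logKernel _)) measurableSet_openSquare
    fun v hv => greenFunction_le hx (fun h => ?_) (fun w hw => ?_)
      (openSquare_subset_closedSquare hv)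
  · have h1 := h i
    rw [reflect_apply_self] at h1
    have h2 := hx i
    rcases hβ with rfl | rfl
    · linarith [h1.1, h2.1]
    · linarith [h1.2, h2.2]
  · refine le_of_sq_le_sq ?_ (norm_nonneg _)
    rw [norm_reflect_sub]
    have h1 := hx i
    have h2 := hw i
    have : 0 ≤ (β - x i) * (β - w i) := by
      rcases hβ with rfl | rfl
      · exact mul_nonneg_of_nonpos_of_nonpos (by linarith [h1.1]) (by linarith [h2.1])
      · exact mul_nonneg (by linarith [h1.2]) (by linarith [h2.2])
    linarith

/-- Near a point of the side `x i = β` the integral lies between `0` and `logPotential y -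
logPotential (reflect i β y)`, which tends to `0` because `reflect` fixes that side and
`logPotential` is continuous. -/
lemma continuousOn_indicator_greenIntegral :
    ContinuousOn (openSquare.indicator greenIntegral) closedSquare := by
  intro x hx
  by_cases hxo : x ∈ openSquare
  · refine ContinuousAt.continuousWithinAt ?_
    have h1 : ContinuousOn greenIntegral openSquare :=
      (continuous_logPotential.continuousOn.add continuousOn_integral_greenRegularPart).congr
        fun y hy => greenIntegral_eq hy
    refine (h1.continuousAt (isOpen_openSquare.mem_nhds hxo)).congr ?_
    filter_upwards [isOpen_openSquare.mem_nhds hxo] with y hy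
    exact (Set.indicator_of_mem hy _).symm
  · obtain ⟨i, β, hβ, hxi⟩ : ∃ i, ∃ β : ℝ, (β = 0 ∨ β = 1) ∧ x i = β := by
      by_contra! h
      exact hxo fun i => ⟨lt_of_le_of_ne (hx i).1 (h i 0 (Or.inl rfl)).symm,
        lt_of_le_of_ne (hx i).2 (h i 1 (Or.inr rfl))⟩
    rw [ContinuousWithinAt, Set.indicator_of_notMem hxo]
    have hlim : Tendsto (fun y => |logPotential y - logPotential (reflect i β y)|)
        (𝓝[closedSquare] x) (𝓝 0) := by
      have hc : Continuous fun y => |logPotential y - logPotential (reflect i β y)| :=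
        (continuous_logPotential.sub
          (continuous_logPotential.comp (continuous_reflect i β))).abs
      have hfix : reflect i β x = x := by simp [reflect, hxi]
      simpa [hfix] using (hc.tendsto x).mono_left nhdsWithin_le_nhds
    refine squeeze_zero (fun y => Set.indicator_nonneg (fun z hz => greenIntegral_nonneg hz) y)
      (fun y => ?_) hlim
    by_cases hy : y ∈ openSquare
    · rw [Set.indicator_of_mem hy]
      exact (greenIntegral_le hy hβ).trans (le_abs_self _)
    · rw [Set.indicator_of_notMem hy]
      exact abs_nonneg _

lemma circleMean_greenIntegral {x : Plane} {r : ℝ} (hr : 0 < r)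
    (h : Metric.closedBall x r ⊆ openSquare) :
    circleMean greenIntegral x r = greenIntegral x - r ^ 2 / 4 := by
  rw [circleMean_congr hr.le fun y hy => greenIntegral_eq (h hy),
    circleMean_add (intervalIntegrable_circlePoint hr.le continuous_logPotential.continuousOn)
      (intervalIntegrable_circlePoint (u := fun x => ∫ v in openSquare, γ x v) hr.le
        (continuousOn_integral_greenRegularPart.mono h)),
    circleMean_logPotential hr h, circleMean_integral_greenRegularPart hr h,
    greenIntegral_eq (h (Metric.mem_closedBall_self hr.le))]
  ring

/-- The integral of the Green's function solves `Δ I = -1` with zero boundary values. -/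
theorem IsTorsionFunction.eqOn_greenIntegral {W : Plane → ℝ} (hW : IsTorsionFunction W) :
    Set.EqOn greenIntegral W openSquare := by
  have key := eq_zero_of_circleMean_eq
    (D := fun x => openSquare.indicator greenIntegral x + -1 * W x)
    (continuousOn_indicator_greenIntegral.add (continuousOn_const.mul hW.continuousOn))
    (fun x hx => by rw [Set.indicator_of_notMem hx.2, hW.boundary x hx]; simp) (fun x hx => ?_)
  · intro x hx
    have := key x (openSquare_subset_closedSquare hx)
    rw [Set.indicator_of_mem hx] at this
    linarith
  · obtain ⟨ε, hε, hball⟩ := Metric.isOpen_iff.1 isOpen_openSquare x hx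
    have hr : 0 < ε / 2 := by positivity
    have hs : Metric.closedBall x (ε / 2) ⊆ openSquare :=
      (Metric.closedBall_subset_ball (by linarith)).trans hball
    have hsc := hs.trans openSquare_subset_closedSquare
    refine ⟨ε / 2, hr, hs, ?_⟩
    -- The same deficit as for `greenIntegral`, so the difference of the two has the mean value
    -- property.
    have hWm : circleMean W x (ε / 2) = W x - (ε / 2) ^ 2 / 4 := by
      have h1 := circleMean_of_harmonic hr.le (hW.harmonic.mono hs)
      rw [circleMean_add (intervalIntegrable_circlePoint hr.le (hW.continuousOn.mono hsc))
        (intervalIntegrable_circlePoint (u := fun y => 1 / 4 * ‖y‖ ^ 2) hr.le (by fun_prop)),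
        circleMean_const_mul, circleMean_norm_sq x hr.le] at h1
      linarith
    rw [circleMean_add (intervalIntegrable_circlePoint hr.le
        (continuousOn_indicator_greenIntegral.mono hsc))
      (intervalIntegrable_circlePoint (u := fun y => -1 * W y) hr.le
        (continuousOn_const.mul (hW.continuousOn.mono hsc))), circleMean_const_mul, hWm,
      circleMean_congr hr.le fun y hy => Set.indicator_of_mem (hs hy) greenIntegral,
      circleMean_greenIntegral hr hs, Set.indicator_of_mem hx]
    ring

end GreenIntegral

/-! ### Subdivision of rectangles and partitions. -/

namespace Rect

/-- The cell with index `a` of the subdivision of a rectangle into `n × n` congruent ones. -/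
@[simps]
noncomputable def sub (R : Rect) (n : ℕ) (a : Fin 2 → Fin n) : Rect where
  lo i := R.lo i + (a i : ℝ) * ((R.hi i - R.lo i) / n)
  hi i := R.lo i + ((a i : ℝ) + 1) * ((R.hi i - R.lo i) / n)
  lo_lt_hi i := by
    have hn : (0 : ℝ) < n := by exact_mod_cast (a i).pos
    have := div_pos (sub_pos.2 (R.lo_lt_hi i)) hn
    nlinarith

open Classical in
/-- The subdivision of a rectangle into `n × n` congruent ones. -/
noncomputable def grid (R : Rect) (n : ℕ) : Finset Rect := Finset.univ.image (R.sub n)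

lemma mem_grid {R R' : Rect} {n : ℕ} : R' ∈ R.grid n ↔ ∃ a, R.sub n a = R' := by
  simp [grid]

lemma openCell_sub_subset (R : Rect) (n : ℕ) (a : Fin 2 → Fin n) :
    (R.sub n a).openCell ⊆ R.openCell := by
  intro x hx i
  have hn : (0 : ℝ) < n := by exact_mod_cast (a i).pos
  have ha : (a i : ℝ) + 1 ≤ n := by exact_mod_cast (a i).2
  set d := (R.hi i - R.lo i) / n with hd
  have hdn : n * d = R.hi i - R.lo i := by
    rw [hd]
    field_simp
  have hd0 : 0 < d := div_pos (sub_pos.2 (R.lo_lt_hi i)) hn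
  obtain ⟨h1, h2⟩ := hx i
  simp only [sub_lo, sub_hi, ← hd] at h1 h2
  have h3 : 0 ≤ (a i : ℝ) * d := by positivity
  have h4 := mul_le_mul_of_nonneg_right ha hd0.le
  exact ⟨by linarith, by linarith⟩

lemma closedCell_sub_subset (R : Rect) (n : ℕ) (a : Fin 2 → Fin n) :
    (R.sub n a).closedCell ⊆ R.closedCell := by
  rw [← closure_openCell, ← closure_openCell]
  exact closure_mono (R.openCell_sub_subset n a)

lemma iUnion_closedCell_sub (R : Rect) {n : ℕ} (hn : 0 < n) :
    ⋃ a, (R.sub n a).closedCell = R.closedCell := by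
  refine (Set.iUnion_subset fun a => R.closedCell_sub_subset n a).antisymm fun x hx => ?_
  have hn' : (0 : ℝ) < n := by exact_mod_cast hn
  have key : ∀ i, ∃ a : Fin n, R.lo i + (a : ℝ) * ((R.hi i - R.lo i) / n) ≤ x i ∧
      x i ≤ R.lo i + ((a : ℝ) + 1) * ((R.hi i - R.lo i) / n) := by
    intro i
    set d := (R.hi i - R.lo i) / n with hd
    have hd0 : 0 < d := div_pos (sub_pos.2 (R.lo_lt_hi i)) hn'
    have hdn : n * d = R.hi i - R.lo i := by
      rw [hd]
      field_simp
    set t := (x i - R.lo i) / d with ht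
    have htd : t * d = x i - R.lo i := by
      rw [ht]
      field_simp
    have ht0 : 0 ≤ t := div_nonneg (by linarith [(hx i).1]) hd0.le
    by_cases h : ⌊t⌋₊ < n
    · refine ⟨⟨⌊t⌋₊, h⟩, ?_, ?_⟩
      · have := mul_le_mul_of_nonneg_right (Nat.floor_le ht0) hd0.le
        simp only
        linarith
      · have := mul_le_mul_of_nonneg_right (Nat.lt_floor_add_one t).le hd0.le
        simp only
        linarith
    -- The far end point has floor `n`, which is not an index; it belongs to the last cell.
    · refine ⟨⟨n - 1, by omega⟩, ?_, ?_⟩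
      · have h1 : (n : ℝ) ≤ t := (Nat.le_floor_iff ht0).1 (not_lt.1 h)
        have h2 : ((n - 1 : ℕ) : ℝ) ≤ t := (Nat.cast_le.2 (Nat.sub_le n 1)).trans h1
        have := mul_le_mul_of_nonneg_right h2 hd0.le
        simp only
        linarith
      · have h1 : ((n - 1 : ℕ) : ℝ) + 1 = n := by
          rw [Nat.cast_sub hn]
          simp
        simp only
        rw [h1, hdn]
        linarith [(hx i).2]
  choose a ha using key
  exact Set.mem_iUnion.2 ⟨a, fun i => ha i⟩

lemma disjoint_openCell_sub (R : Rect) {n : ℕ} {a b : Fin 2 → Fin n} (hab : a ≠ b) :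
    Disjoint (R.sub n a).openCell (R.sub n b).openCell := by
  rw [Set.disjoint_left]
  intro x hx hy
  refine hab (funext fun i => ?_)
  have hn : (0 : ℝ) < n := by exact_mod_cast (a i).pos
  have hd0 : 0 < (R.hi i - R.lo i) / n := div_pos (sub_pos.2 (R.lo_lt_hi i)) hn
  have key : ∀ {c d : Fin n},
      R.lo i + (c : ℝ) * ((R.hi i - R.lo i) / n) < x i →
      x i < R.lo i + ((d : ℝ) + 1) * ((R.hi i - R.lo i) / n) → (c : ℕ) ≤ d := by
    intro c d h1 h2
    have h3 : (c : ℝ) < d + 1 := lt_of_mul_lt_mul_right (by linarith) hd0.le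
    have : (c : ℕ) < d + 1 := by exact_mod_cast h3
    omega
  exact Fin.ext (le_antisymm (key (hx i).1 (hy i).2) (key (hy i).1 (hx i).2))

lemma sub_injective (R : Rect) (n : ℕ) : Function.Injective (R.sub n) := by
  intro a b hab
  by_contra hne
  have h := R.disjoint_openCell_sub hne
  rw [hab] at h
  exact Set.disjoint_left.1 h (R.sub n b).center_mem (R.sub n b).center_mem

lemma card_grid (R : Rect) (n : ℕ) : (R.grid n).card = n ^ 2 := by
  classical
  rw [grid, Finset.card_image_of_injective _ (R.sub_injective n)]
  simp

end Rect

lemma isPartition_singleton_unit : IsPartition {Rect.unit} where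
  iUnion_eq := by simp [Rect.closedCell_unit]
  pairwise_disjoint := by simp

open Classical in
/-- The refinement of a family of rectangles by subdivision of its elements. -/
noncomputable def subdivide (P : Finset Rect) (n : Rect → ℕ) : Finset Rect :=
  P.biUnion fun R => R.grid (n R)

lemma mem_subdivide {P : Finset Rect} {n : Rect → ℕ} {R' : Rect} :
    R' ∈ subdivide P n ↔ ∃ R ∈ P, ∃ a, R.sub (n R) a = R' := by
  simp [subdivide, Rect.mem_grid]

lemma isPartition_subdivide {P : Finset Rect} (hP : IsPartition P) {n : Rect → ℕ}
    (hn : ∀ R ∈ P, 0 < n R) : IsPartition (subdivide P n) where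
  iUnion_eq := by
    rw [← hP.iUnion_eq]
    ext x
    simp only [Set.mem_iUnion, mem_subdivide, exists_prop]
    constructor
    · rintro ⟨_, ⟨R, hR, a, rfl⟩, hx⟩
      exact ⟨R, hR, R.closedCell_sub_subset _ a hx⟩
    · rintro ⟨R, hR, hx⟩
      rw [← R.iUnion_closedCell_sub (hn R hR), Set.mem_iUnion] at hx
      obtain ⟨a, ha⟩ := hx
      exact ⟨_, ⟨R, hR, a, rfl⟩, ha⟩
  pairwise_disjoint := by
    intro R₁ h₁ R₂ h₂ hne
    obtain ⟨R, hR, a, rfl⟩ := mem_subdivide.1 h₁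
    obtain ⟨R', hR', b, rfl⟩ := mem_subdivide.1 h₂
    by_cases hRR : R = R'
    · subst hRR
      exact R.disjoint_openCell_sub fun hab => hne (by rw [hab])
    · exact (hP.pairwise_disjoint R hR R' hR' hRR).mono (R.openCell_sub_subset _ a)
        (R'.openCell_sub_subset _ b)

lemma IsPartition.pairwiseDisjoint_grid {P : Finset Rect} (hP : IsPartition P) (n : Rect → ℕ) :
    (P : Set Rect).PairwiseDisjoint fun R => R.grid (n R) := by
  intro R hR R' hR' hne
  rw [Function.onFun, Finset.disjoint_left]
  intro S hS hS'
  obtain ⟨a, rfl⟩ := Rect.mem_grid.1 hS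
  obtain ⟨b, hb⟩ := Rect.mem_grid.1 hS'
  refine Set.disjoint_left.1 (hP.pairwise_disjoint R hR R' hR' hne)
    (R.openCell_sub_subset _ a (Rect.center_mem _)) (R'.openCell_sub_subset _ b ?_)
  rw [hb]
  exact Rect.center_mem _

lemma IsPartition.sum_subdivide {P : Finset Rect} (hP : IsPartition P) (n : Rect → ℕ)
    (F : Rect → ℝ) : ∑ R ∈ subdivide P n, F R = ∑ R ∈ P, ∑ R' ∈ R.grid (n R), F R' := by
  classical
  exact Finset.sum_biUnion (hP.pairwiseDisjoint_grid n)

lemma IsPartition.card_subdivide {P : Finset Rect} (hP : IsPartition P) (n : Rect → ℕ) :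
    (subdivide P n).card = ∑ R ∈ P, n R ^ 2 := by
  classical
  rw [subdivide, Finset.card_biUnion (hP.pairwiseDisjoint_grid n)]
  simp only [Rect.card_grid]

/-- Every element of a refinement has a unique parent. -/
lemma IsPartition.exists_parent {P : Finset Rect} (hP : IsPartition P) (n : Rect → ℕ) :
    ∃ π : Rect → Rect, ∀ R ∈ P, ∀ R' ∈ R.grid (n R), π R' = R := by
  classical
  refine ⟨fun R' => if h : ∃ R ∈ P, R' ∈ R.grid (n R) then h.choose else R', fun R hR R' hR' => ?_⟩
  have h : ∃ R ∈ P, R' ∈ R.grid (n R) := ⟨R, hR, hR'⟩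
  simp only [dif_pos h]
  by_contra hne
  exact Finset.disjoint_left.1 (hP.pairwiseDisjoint_grid n h.choose_spec.1 hR hne)
    h.choose_spec.2 hR'

lemma Rect.side_sub {R : Rect} {h : ℝ} (hR : ∀ i, R.hi i = R.lo i + h) (n : ℕ)
    (a : Fin 2 → Fin n) (i : Fin 2) :
    (R.sub n a).hi i = (R.sub n a).lo i + h / n := by
  simp only [Rect.sub_hi, Rect.sub_lo, hR]
  ring

/-! ### Norms of piecewise rescaled functions and of the spline error. -/

section Integral

lemma IsPartition.lintegral_eq_sum {P : Finset Rect} (hP : IsPartition P) (F : Plane → ℝ≥0∞) :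
    ∫⁻ x in openSquare, F x = ∑ R ∈ P, ∫⁻ x in R.openCell, F x := by
  have h : openSquare =ᵐ[volume] ⋃ R ∈ P, R.openCell := by
    refine openSquare_ae_eq.trans ?_
    rw [← hP.iUnion_eq]
    exact Filter.EventuallyEq.countable_bUnion P.countable_toSet
      fun R _ => R.openCell_ae_eq_closedCell.symm
  rw [setLIntegral_congr h, lintegral_biUnion_finset
    (fun R hR R' hR' hne => hP.pairwise_disjoint R hR R' hR' hne)
    fun R _ => R.isOpen_openCell.measurableSet]

lemma lintegral_comp_smul_sub {h : ℝ} (hh : 0 < h) (a : Plane) {F : Plane → ℝ≥0∞}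
    (hF : Measurable F) :
    ∫⁻ x, F (h⁻¹ • (x - a)) = ENNReal.ofReal (h ^ 2) * ∫⁻ x, F x := by
  rw [lintegral_sub_right_eq_self (fun x => F (h⁻¹ • x)) a]
  have h1 := lintegral_map (μ := (volume : Measure Plane)) hF (measurable_const_smul h⁻¹)
  rw [← h1, Measure.map_addHaar_smul volume (inv_ne_zero hh.ne'), lintegral_smul_measure,
    finrank_plane]
  congr 2
  rw [inv_pow, inv_inv, abs_of_nonneg (by positivity)]

lemma Rect.mem_openCell_iff {R : Rect} {h : ℝ} (hh : 0 < h) (hside : ∀ i, R.hi i = R.lo i + h)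
    (x : Plane) : x ∈ R.openCell ↔ h⁻¹ • (x - WithLp.toLp 2 R.lo) ∈ openSquare :=
  forall_congr' fun i => by
    have : (h⁻¹ • (x - WithLp.toLp 2 R.lo)) i = (x i - R.lo i) / h := by
      simp
      ring
    simp only [Set.mem_Ioo, this, hside, lt_div_iff₀ hh, div_lt_iff₀ hh, zero_mul, one_mul,
      sub_pos, sub_lt_iff_lt_add']

lemma Rect.lintegral_comp {R : Rect} {h : ℝ} (hh : 0 < h) (hside : ∀ i, R.hi i = R.lo i + h)
    {F : Plane → ℝ≥0∞} (hF : Measurable (openSquare.indicator F)) :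
    ∫⁻ x in R.openCell, F (h⁻¹ • (x - WithLp.toLp 2 R.lo))
      = ENNReal.ofReal (h ^ 2) * ∫⁻ x in openSquare, F x := by
  have hT := Rect.mem_openCell_iff hh hside
  rw [← lintegral_indicator measurableSet_openSquare, ← lintegral_comp_smul_sub hh _ hF,
    ← lintegral_indicator R.isOpen_openCell.measurableSet]
  congr 1
  ext x
  by_cases hx : x ∈ R.openCell
  · rw [Set.indicator_of_mem hx, Set.indicator_of_mem ((hT x).1 hx)]
  · rw [Set.indicator_of_notMem hx, Set.indicator_of_notMem fun h' => hx ((hT x).2 h')]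

/-- The piecewise defined principal part of the error of a harmonic spline. -/
noncomputable def principalError (P : Finset Rect) (W : Plane → ℝ) (c h : Rect → ℝ) : Plane → ℝ :=
  fun x => ∑ R ∈ P, R.openCell.indicator
    (fun x => -(c R * h R ^ 2 * W ((h R)⁻¹ • (x - WithLp.toLp 2 R.lo)))) x

lemma IsPartition.principalError_eq {P : Finset Rect} (hP : IsPartition P) (W : Plane → ℝ)
    (c h : Rect → ℝ) {R : Rect} (hR : R ∈ P) {x : Plane} (hx : x ∈ R.openCell) :
    principalError P W c h x = -(c R * h R ^ 2 * W ((h R)⁻¹ • (x - WithLp.toLp 2 R.lo))) := by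
  rw [principalError, Finset.sum_eq_single_of_mem R hR fun R' hR' hne =>
    Set.indicator_of_notMem (Set.disjoint_left.1 (hP.pairwise_disjoint R hR R' hR' hne.symm) hx) _,
    Set.indicator_of_mem hx]

lemma IsTorsionFunction.measurable_indicator {W : Plane → ℝ} (hW : IsTorsionFunction W) :
    Measurable (openSquare.indicator W) := by
  classical
  rw [← Set.piecewise_eq_indicator]
  exact (hW.continuousOn.mono openSquare_subset_closedSquare).measurable_piecewise
    continuousOn_const measurableSet_openSquare

/-- Rescaling a cell to the unit square contributes the Jacobian `h²` and the amplitude `|c| h²`;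
the factor `‖W‖_p^p` is common to all cells. -/
lemma IsPartition.eLpNorm_principalError {P : Finset Rect} (hP : IsPartition P) {W : Plane → ℝ}
    (hW : IsTorsionFunction W) {c h : Rect → ℝ} (hh : ∀ R ∈ P, 0 < h R)
    (hside : ∀ R ∈ P, ∀ i, R.hi i = R.lo i + h R) {p : ℝ} (hp : 0 < p) :
    eLpNorm (principalError P W c h) (ENNReal.ofReal p) (volume.restrict openSquare)
      = ENNReal.ofReal ((∑ R ∈ P, (|c R| * h R ^ 2) ^ p * h R ^ 2) ^ (1 / p)) *
        eLpNorm W (ENNReal.ofReal p) (volume.restrict openSquare) := by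
  have hp0 : ENNReal.ofReal p ≠ 0 := by simpa using hp
  rw [eLpNorm_eq_lintegral_rpow_enorm_toReal hp0 ENNReal.ofReal_ne_top,
    eLpNorm_eq_lintegral_rpow_enorm_toReal hp0 ENNReal.ofReal_ne_top, ENNReal.toReal_ofReal hp.le,
    ← ENNReal.ofReal_rpow_of_nonneg (Finset.sum_nonneg fun R hR => by positivity) (by positivity),
    ← ENNReal.mul_rpow_of_nonneg _ _ (by positivity : 0 ≤ 1 / p)]
  congr 1
  rw [hP.lintegral_eq_sum, ENNReal.ofReal_sum_of_nonneg fun R hR => by positivity, Finset.sum_mul]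
  refine Finset.sum_congr rfl fun R hR => ?_
  have hm : Measurable (openSquare.indicator fun x => ‖W x‖ₑ ^ p) := by
    have : (openSquare.indicator fun x => ‖W x‖ₑ ^ p)
        = fun x => ‖openSquare.indicator W x‖ₑ ^ p := by
      ext x
      by_cases hx : x ∈ openSquare
      · simp [hx]
      · simp [hx, hp]
    rw [this]
    exact hW.measurable_indicator.enorm.pow_const p
  have h0 : 0 ≤ |c R| * h R ^ 2 := by positivity
  calc ∫⁻ x in R.openCell, ‖principalError P W c h x‖ₑ ^ p
      = ∫⁻ x in R.openCell, ENNReal.ofReal ((|c R| * h R ^ 2) ^ p) *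
          ‖W ((h R)⁻¹ • (x - WithLp.toLp 2 R.lo))‖ₑ ^ p := by
        refine setLIntegral_congr_fun R.isOpen_openCell.measurableSet fun x hx => ?_
        rw [hP.principalError_eq W c h hR hx, enorm_neg, enorm_mul,
          ENNReal.mul_rpow_of_nonneg _ _ hp.le, ← ENNReal.ofReal_rpow_of_nonneg h0 hp.le,
          ← ofReal_norm (c R * h R ^ 2), norm_mul, Real.norm_eq_abs,
          Real.norm_of_nonneg (sq_nonneg (h R))]
    _ = _ := by
        rw [lintegral_const_mul' _ _ ENNReal.ofReal_ne_top,
          Rect.lintegral_comp (hh R hR) (hside R hR) hm,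
          ENNReal.ofReal_mul (p := (|c R| * h R ^ 2) ^ p) (by positivity), mul_assoc]

end Integral

lemma volume_openSquare : volume openSquare = 1 := by
  have h := (EuclideanSpace.volume_preserving_symm_measurableEquiv_toLp (Fin 2)).symm
  have e : openSquare = (MeasurableEquiv.toLp 2 (Fin 2 → ℝ)).symm ⁻¹'
      (Set.univ.pi fun _ => Set.Ioo (0 : ℝ) 1) := by
    ext x
    simp [openSquare]
  rw [e, (EuclideanSpace.volume_preserving_symm_measurableEquiv_toLp (Fin 2)).measure_preimage
    (MeasurableSet.univ_pi fun _ => measurableSet_Ioo).nullMeasurableSet, Real.volume_pi_Ioo]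
  simp

instance : IsProbabilityMeasure (volume.restrict openSquare) :=
  ⟨by rw [Measure.restrict_apply_univ, volume_openSquare]⟩

lemma Rect.volume_openCell {R : Rect} {h : ℝ} (hh : 0 < h) (hside : ∀ i, R.hi i = R.lo i + h) :
    volume R.openCell = ENNReal.ofReal (h ^ 2) := by
  have := Rect.lintegral_comp hh hside (F := fun _ => 1)
    (measurable_const.indicator measurableSet_openSquare)
  simpa [volume_openSquare] using this

lemma Rect.norm_sub_le {R : Rect} {h : ℝ} (hh : 0 < h) (hside : ∀ i, R.hi i = R.lo i + h)
    {x y : Plane} (hx : x ∈ R.closedCell) (hy : y ∈ R.closedCell) : ‖x - y‖ ≤ 2 * h := by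
  rw [EuclideanSpace.norm_eq, Fin.sum_univ_two]
  have hb : ∀ i, ‖(x - y) i‖ ^ 2 ≤ h ^ 2 := fun i => by
    have h1 := hx i
    have h2 := hy i
    rw [hside] at h1 h2
    rw [Real.norm_eq_abs, sq_abs]
    simp only [PiLp.sub_apply]
    nlinarith [h1.1, h1.2, h2.1, h2.2]
  refine Real.sqrt_le_iff.2 ⟨by positivity, ?_⟩
  nlinarith [hb 0, hb 1]

lemma aestronglyMeasurable_of_continuousOn {u : Plane → ℝ} (hu : ContinuousOn u closedSquare) :
    AEStronglyMeasurable u (volume.restrict openSquare) :=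
  (hu.mono openSquare_subset_closedSquare).aestronglyMeasurable measurableSet_openSquare

lemma memLp_of_continuousOn {u : Plane → ℝ} (hu : ContinuousOn u closedSquare) (q : ℝ≥0∞) :
    MemLp u q (volume.restrict openSquare) := by
  obtain ⟨C, hC⟩ := isCompact_closedSquare.exists_bound_of_continuousOn hu
  refine MemLp.of_bound (aestronglyMeasurable_of_continuousOn hu) C ?_
  filter_upwards [ae_restrict_mem measurableSet_openSquare] with x hx
  exact hC x (openSquare_subset_closedSquare hx)

lemma IsPartition.nonempty {P : Finset Rect} (hP : IsPartition P) : P.Nonempty := by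
  have h : Rect.unit.center ∈ closedSquare := openSquare_subset_closedSquare Rect.unit.center_mem
  rw [← hP.iUnion_eq] at h
  simp only [Set.mem_iUnion] at h
  obtain ⟨R, hR, -⟩ := h
  exact ⟨R, hR⟩

lemma IsPartition.ae_mem_openCell {P : Finset Rect} (hP : IsPartition P) :
    ∀ᵐ x ∂volume.restrict openSquare, ∃ R ∈ P, x ∈ R.openCell := by
  have h : ∀ᵐ x : Plane, ∀ R ∈ P, x ∉ R.boundary :=
    (eventually_all_finset P).2 fun R _ => measure_eq_zero_iff_ae_notMem.1 R.volume_boundary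
  filter_upwards [ae_restrict_of_ae h, ae_restrict_mem measurableSet_openSquare] with x hx hxo
  have hxc := openSquare_subset_closedSquare hxo
  rw [← hP.iUnion_eq] at hxc
  simp only [Set.mem_iUnion] at hxc
  obtain ⟨R, hR, hxR⟩ := hxc
  refine ⟨R, hR, ?_⟩
  by_contra h'
  exact hx R hR ⟨hxR, h'⟩

lemma aestronglyMeasurable_principalError {P : Finset Rect} {W : Plane → ℝ}
    (hW : IsTorsionFunction W) (c : Rect → ℝ) {h : Rect → ℝ} (hh : ∀ R ∈ P, 0 < h R)
    (hside : ∀ R ∈ P, ∀ i, R.hi i = R.lo i + h R) :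
    AEStronglyMeasurable (principalError P W c h) (volume.restrict openSquare) := by
  refine Finset.aestronglyMeasurable_fun_sum P fun R hR => ?_
  have hm : Measurable fun x : Plane =>
      -(c R * h R ^ 2 * openSquare.indicator W ((h R)⁻¹ • (x - WithLp.toLp 2 R.lo))) :=
    ((hW.measurable_indicator.comp (by fun_prop)).const_mul _).neg
  have he : (R.openCell.indicator fun x =>
      -(c R * h R ^ 2 * W ((h R)⁻¹ • (x - WithLp.toLp 2 R.lo)))) = R.openCell.indicator fun x =>
      -(c R * h R ^ 2 * openSquare.indicator W ((h R)⁻¹ • (x - WithLp.toLp 2 R.lo))) :=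
    Set.indicator_congr fun x hx => by
      rw [Set.indicator_of_mem ((Rect.mem_openCell_iff (hh R hR) (hside R hR) x).1 hx)]
  rw [he]
  exact (hm.indicator R.isOpen_openCell.measurableSet).aestronglyMeasurable

/-- The norm of the error of a harmonic spline on a partition into squares on which the Laplacian is
almost constant. -/
lemma IsInterlineatingSpline.abs_norm_sub_le {f s W : Plane → ℝ} {P : Finset Rect}
    (hs : IsInterlineatingSpline f P s) (hP : IsPartition P) (hf : ContDiffOn ℝ 2 f closedSquare)
    (hW : IsTorsionFunction W) {c h : Rect → ℝ} (hh : ∀ R ∈ P, 0 < h R)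
    (hside : ∀ R ∈ P, ∀ i, R.hi i = R.lo i + h R) {ω κ : ℝ} (hω : 0 ≤ ω)
    (hκ : ∀ R ∈ P, h R ^ 2 ≤ κ)
    (hL : ∀ R ∈ P, ∀ x ∈ R.openCell, |Δ f x - c R| ≤ ω) {p : ℝ} (hp : 1 ≤ p) :
    |(eLpNorm (fun x => f x - s x) (ENNReal.ofReal p) (volume.restrict openSquare)).toReal -
      (∑ R ∈ P, (|c R| * h R ^ 2) ^ p * h R ^ 2) ^ (1 / p) *
        (eLpNorm W (ENNReal.ofReal p) (volume.restrict openSquare)).toReal| ≤ 4 * ω * κ := by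
  have hp1 : 1 ≤ ENNReal.ofReal p := by
    rw [← ENNReal.ofReal_one]
    exact ENNReal.ofReal_le_ofReal hp
  set μ := volume.restrict openSquare
  set q := ENNReal.ofReal p
  set e : Plane → ℝ := fun x => f x - s x
  set E := principalError P W c h
  have he : MemLp e q μ := memLp_of_continuousOn (hf.continuousOn.sub hs.continuousOn) q
  have hEn := hP.eLpNorm_principalError hW (c := c) hh hside (zero_lt_one.trans_le hp)
  have hE : MemLp E q μ := by
    refine ⟨aestronglyMeasurable_principalError hW c hh hside, ?_⟩
    rw [hEn]
    exact ENNReal.mul_lt_top ENNReal.ofReal_lt_top (memLp_of_continuousOn hW.continuousOn q).2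
  -- On a probability space a pointwise almost everywhere bound is an `L_p` bound.
  have hd : eLpNorm (e - E) q μ ≤ ENNReal.ofReal (4 * ω * κ) := by
    have := eLpNorm_le_of_ae_bound (p := q) (μ := μ) (f := e - E) (C := 4 * ω * κ) ?_
    · simpa [μ] using this
    · filter_upwards [hP.ae_mem_openCell] with x hx
      obtain ⟨R, hR, hxR⟩ := hx
      have h1 := hs.abs_sub_add_le hP hf hW hR (hh R hR) (hside R hR) hω (hL R hR) x
        (R.openCell_subset_closedCell hxR)
      have hE' : E x = _ := hP.principalError_eq W c h hR hxR
      rw [Pi.sub_apply, hE', sub_neg_eq_add, Real.norm_eq_abs]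
      refine h1.trans ?_
      have := mul_le_mul_of_nonneg_left (hκ R hR) hω
      linarith
  have hκ0 : 0 ≤ 4 * ω * κ := by
    obtain ⟨R, hR⟩ := hP.nonempty
    have := (sq_nonneg (h R)).trans (hκ R hR)
    positivity
  have hS : 0 ≤ (∑ R ∈ P, (|c R| * h R ^ 2) ^ p * h R ^ 2) ^ (1 / p) :=
    Real.rpow_nonneg (Finset.sum_nonneg fun R _ => by positivity) _
  have hEr : (eLpNorm E q μ).toReal = (∑ R ∈ P, (|c R| * h R ^ 2) ^ p * h R ^ 2) ^ (1 / p) *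
      (eLpNorm W q μ).toReal := by
    rw [hEn, ENNReal.toReal_mul, ENNReal.toReal_ofReal hS]
  rw [← hEr]
  have hdr : (eLpNorm (e - E) q μ).toReal ≤ 4 * ω * κ := ENNReal.toReal_le_of_le_ofReal hκ0 hd
  have t1 : eLpNorm e q μ ≤ eLpNorm (e - E) q μ + eLpNorm E q μ := by
    simpa using eLpNorm_add_le (he.sub hE).1 hE.1 hp1
  have t2 : eLpNorm E q μ ≤ eLpNorm (E - e) q μ + eLpNorm e q μ := by
    simpa using eLpNorm_add_le (hE.sub he).1 he.1 hp1
  rw [eLpNorm_sub_comm] at t2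
  have r1 := ENNReal.toReal_mono (ENNReal.add_ne_top.2 ⟨(he.sub hE).2.ne, hE.2.ne⟩) t1
  have r2 := ENNReal.toReal_mono (ENNReal.add_ne_top.2 ⟨(he.sub hE).2.ne, he.2.ne⟩) t2
  rw [ENNReal.toReal_add (he.sub hE).2.ne hE.2.ne] at r1
  rw [ENNReal.toReal_add (he.sub hE).2.ne he.2.ne] at r2
  exact abs_sub_le_iff.2 ⟨by linarith, by linarith⟩

/-! ### Uniform grids and Riemann sums. -/

/-- The partition of the unit square into `m × m` congruent squares. -/
noncomputable def unitGrid (m : ℕ) : Finset Rect := subdivide {Rect.unit} fun _ => m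

lemma isPartition_unitGrid {m : ℕ} (hm : 0 < m) : IsPartition (unitGrid m) :=
  isPartition_subdivide isPartition_singleton_unit fun _ _ => hm

lemma card_unitGrid (m : ℕ) : (unitGrid m).card = m ^ 2 := by
  rw [unitGrid, isPartition_singleton_unit.card_subdivide]
  simp

lemma side_unitGrid {m : ℕ} {B : Rect} (hB : B ∈ unitGrid m) (i : Fin 2) :
    B.hi i = B.lo i + 1 / m := by
  obtain ⟨R, hR, a, rfl⟩ := mem_subdivide.1 hB
  refine Rect.side_sub (fun i => ?_) m a i
  rw [Finset.mem_singleton.1 hR]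
  simp [Rect.unit]

lemma exists_abs_sub_center_le {φ : Plane → ℝ} (hφ : ContinuousOn φ closedSquare) {δ : ℝ}
    (hδ : 0 < δ) : ∀ᶠ m : ℕ in atTop, ∀ B ∈ unitGrid m, ∀ x ∈ B.closedCell,
      |φ x - φ B.center| ≤ δ := by
  have hu := isCompact_closedSquare.uniformContinuousOn_of_continuous hφ
  obtain ⟨ε, hε, h⟩ := Metric.uniformContinuousOn_iff.1 hu δ hδ
  have h0 : Tendsto (fun m : ℕ => 2 * (1 / (m : ℝ))) atTop (𝓝 0) := by
    simpa using (tendsto_one_div_atTop_nhds_zero_nat (𝕜 := ℝ)).const_mul 2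
  filter_upwards [h0.eventually (gt_mem_nhds hε), eventually_gt_atTop 0] with m hm hm0 B hB x hx
  have hsub := (isPartition_unitGrid hm0).closedCell_subset hB
  have hm0' : (0 : ℝ) < 1 / m := by positivity
  have hc := B.openCell_subset_closedCell B.center_mem
  have := h x (hsub hx) B.center (hsub hc) (by
    rw [dist_eq_norm]
    exact (Rect.norm_sub_le hm0' (side_unitGrid hB) hx hc).trans_lt hm)
  exact (Real.dist_eq _ _ ▸ this).le

lemma tendsto_sum_unitGrid {φ : Plane → ℝ} (hφ : ContinuousOn φ closedSquare) :
    Tendsto (fun m : ℕ => ∑ B ∈ unitGrid m, φ B.center * (1 / (m : ℝ)) ^ 2) atTop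
      (𝓝 (∫ x in openSquare, φ x)) := by
  rw [Metric.tendsto_nhds]
  intro ε hε
  filter_upwards [exists_abs_sub_center_le hφ (half_pos hε), eventually_gt_atTop 0] with m hm hm0
  have hP := isPartition_unitGrid hm0
  have hm0' : (0 : ℝ) < 1 / m := by positivity
  have hint := integrableOn_openSquare hφ
  have hae : openSquare =ᵐ[volume] ⋃ B ∈ unitGrid m, B.openCell := by
    refine openSquare_ae_eq.trans ?_
    rw [← hP.iUnion_eq]
    exact Filter.EventuallyEq.countable_bUnion (unitGrid m).countable_toSet
      fun R _ => R.openCell_ae_eq_closedCell.symm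
  have hsub : ∀ B ∈ unitGrid m, B.openCell ⊆ openSquare := fun B hB =>
    Rect.openCell_subset_openSquare (hP.closedCell_subset hB)
  rw [setIntegral_congr_set hae, integral_biUnion_finset _
    (fun B _ => B.isOpen_openCell.measurableSet)
    (fun R hR R' hR' hne => hP.pairwise_disjoint R hR R' hR' hne)
    (fun B hB => hint.mono_set (hsub B hB)), Real.dist_eq, ← Finset.sum_sub_distrib]
  have hB : ∀ B ∈ unitGrid m, |φ B.center * (1 / (m : ℝ)) ^ 2 - ∫ x in B.openCell, φ x|
      ≤ ε / 2 * (1 / (m : ℝ)) ^ 2 := by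
    intro B hB
    have hv : volume.real B.openCell = (1 / (m : ℝ)) ^ 2 := by
      rw [Measure.real, Rect.volume_openCell hm0' (side_unitGrid hB),
        ENNReal.toReal_ofReal (by positivity)]
    have hfin : volume B.openCell < ∞ := by
      rw [Rect.volume_openCell hm0' (side_unitGrid hB)]
      exact ENNReal.ofReal_lt_top
    have e : φ B.center * (1 / (m : ℝ)) ^ 2 = ∫ x in B.openCell, φ B.center := by
      rw [setIntegral_const, hv, smul_eq_mul, mul_comm]
    rw [e, ← integral_sub (integrableOn_const (C := φ B.center) hfin.ne (by simp))
      (hint.mono_set (hsub B hB)), ← hv, ← Real.norm_eq_abs]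
    refine norm_setIntegral_le_of_norm_le_const hfin fun x hx => ?_
    rw [norm_sub_rev]
    exact hm B hB x (B.openCell_subset_closedCell hx)
  refine (Finset.abs_sum_le_sum_abs _ _).trans_lt ((Finset.sum_le_sum hB).trans_lt ?_)
  rw [Finset.sum_const, card_unitGrid, nsmul_eq_mul]
  push_cast
  have : (m : ℝ) ^ 2 * (ε / 2 * (1 / (m : ℝ)) ^ 2) = ε / 2 := by field_simp
  rw [this]
  exact half_lt_self hε

/-! ### Refinements with a prescribed density of elements. -/

/-- A positive integer whose square is approximately `N * ρ`. -/
noncomputable def gridSize (ρ : ℝ) (N : ℕ) : ℕ := ⌈√ρ * √N⌉₊ + 1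

lemma gridSize_pos (ρ : ℝ) (N : ℕ) : 0 < gridSize ρ N := Nat.succ_pos _

/-- Rounding up makes this hold for every `N`; it bounds the areas of the small squares from above.
-/
lemma mul_le_gridSize_sq {ρ : ℝ} (hρ : 0 ≤ ρ) (N : ℕ) : N * ρ ≤ (gridSize ρ N : ℝ) ^ 2 := by
  have h1 : √ρ * √N ≤ gridSize ρ N := by
    rw [gridSize]
    push_cast
    linarith [Nat.le_ceil (√ρ * √N)]
  have h2 := pow_le_pow_left₀ (by positivity) h1 2
  rw [mul_pow, Real.sq_sqrt hρ, Real.sq_sqrt N.cast_nonneg] at h2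
  linarith

lemma tendsto_gridSize_sq_div {ρ : ℝ} (hρ : 0 ≤ ρ) :
    Tendsto (fun N : ℕ => (gridSize ρ N : ℝ) ^ 2 / N) atTop (𝓝 ρ) := by
  have hs : Tendsto (fun N : ℕ => √(N : ℝ)) atTop atTop :=
    Real.tendsto_sqrt_atTop.comp tendsto_natCast_atTop_atTop
  have h1 := (tendsto_nat_ceil_mul_div_atTop (R := ℝ) (Real.sqrt_nonneg ρ)).comp hs
  have h2 := (h1.add (tendsto_inv_atTop_zero.comp hs)).pow 2
  rw [add_zero, Real.sq_sqrt hρ] at h2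
  refine h2.congr fun N => ?_
  simp only [Function.comp_apply, gridSize]
  push_cast
  rw [← one_div, ← add_div, div_pow, Real.sq_sqrt N.cast_nonneg]

/-- The partition obtained from a partition `P` by subdividing each of its elements `B` into
approximately `N * ρ B` congruent rectangles. -/
noncomputable def refinement (P : Finset Rect) (ρ : Rect → ℝ) (N : ℕ) : Finset Rect :=
  subdivide P fun B => gridSize (ρ B) N

lemma isPartition_refinement {P : Finset Rect} (hP : IsPartition P) (ρ : Rect → ℝ) (N : ℕ) :
    IsPartition (refinement P ρ N) :=
  isPartition_subdivide hP fun _ _ => gridSize_pos _ _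

lemma tendsto_card_refinement {P : Finset Rect} (hP : IsPartition P) {ρ : Rect → ℝ}
    (hρ : ∀ B ∈ P, 0 ≤ ρ B) (hsum : ∑ B ∈ P, ρ B = 1) :
    Tendsto (fun N : ℕ => ((refinement P ρ N).card : ℝ) / N) atTop (𝓝 1) := by
  rw [← hsum]
  refine (tendsto_finsetSum P fun B hB => tendsto_gridSize_sq_div (hρ B hB)).congr fun N => ?_
  rw [refinement, hP.card_subdivide, Nat.cast_sum, Finset.sum_div]
  simp only [Nat.cast_pow]

lemma side_eq_of_mem_grid {B R : Rect} {ν : ℝ} (hB : ∀ i, B.hi i = B.lo i + ν) {n : ℕ}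
    (hR : R ∈ B.grid n) (i : Fin 2) : R.hi i - R.lo i = ν / n := by
  obtain ⟨a, rfl⟩ := Rect.mem_grid.1 hR
  rw [Rect.side_sub hB, add_sub_cancel_left]

lemma mem_refinement {P : Finset Rect} {ρ : Rect → ℝ} {N : ℕ} {R : Rect} :
    R ∈ refinement P ρ N ↔ ∃ B ∈ P, R ∈ B.grid (gridSize (ρ B) N) := by
  simp only [refinement, mem_subdivide, Rect.mem_grid]

lemma numNonSquares_refinement {P : Finset Rect} {ν : ℝ}
    (hside : ∀ B ∈ P, ∀ i, B.hi i = B.lo i + ν) (ρ : Rect → ℝ) (N : ℕ) :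
    numNonSquares (refinement P ρ N) = 0 := by
  classical
  rw [numNonSquares, Finset.card_eq_zero, Finset.filter_eq_empty_iff]
  intro R hR
  obtain ⟨B, hB, hRB⟩ := mem_refinement.1 hR
  rw [not_not, Rect.IsSquare, side_eq_of_mem_grid (hside B hB) hRB,
    side_eq_of_mem_grid (hside B hB) hRB]

/-- The scaled main term of the error on the refinements of a partition. -/
lemma tendsto_refinement_main_term {P : Finset Rect} {ν : ℝ} {ρ c : Rect → ℝ}
    (hρ : ∀ B ∈ P, 0 < ρ B) {p : ℝ} (hp : 0 < p) :
    Tendsto (fun N : ℕ => (N : ℝ) * (∑ B ∈ P, (gridSize (ρ B) N : ℝ) ^ 2 *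
      ((|c B| * (ν / gridSize (ρ B) N) ^ 2) ^ p * (ν / gridSize (ρ B) N) ^ 2)) ^ (1 / p)) atTop
      (𝓝 ((∑ B ∈ P, (|c B| * ν ^ 2 * (ρ B)⁻¹) ^ p * ν ^ 2) ^ (1 / p))) := by
  have h1 : Tendsto (fun N : ℕ => (∑ B ∈ P,
      (|c B| * ν ^ 2 * ((gridSize (ρ B) N : ℝ) ^ 2 / N)⁻¹) ^ p * ν ^ 2) ^ (1 / p)) atTop
      (𝓝 ((∑ B ∈ P, (|c B| * ν ^ 2 * (ρ B)⁻¹) ^ p * ν ^ 2) ^ (1 / p))) := by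
    refine Tendsto.rpow_const (tendsto_finsetSum P fun B hB => ?_) (Or.inr (by positivity))
    exact ((((tendsto_gridSize_sq_div (hρ B hB).le).inv₀ (hρ B hB).ne').const_mul _).rpow_const
      (Or.inr hp.le)).mul_const _
  refine h1.congr fun N => ?_
  have hN : (N : ℝ) = ((N : ℝ) ^ p) ^ (1 / p) := by
    rw [← Real.rpow_mul N.cast_nonneg, mul_one_div_cancel hp.ne', Real.rpow_one]
  conv_rhs => rw [hN]
  rw [← Real.mul_rpow (by positivity) (Finset.sum_nonneg fun B _ => by positivity),
    Finset.mul_sum]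
  congr 1
  refine Finset.sum_congr rfl fun B _ => ?_
  have hk : (0 : ℝ) < gridSize (ρ B) N := by exact_mod_cast gridSize_pos _ _
  have e : |c B| * ν ^ 2 * ((gridSize (ρ B) N : ℝ) ^ 2 / N)⁻¹
      = N * (|c B| * (ν / gridSize (ρ B) N) ^ 2) := by
    rw [inv_div]
    field_simp
  rw [e, Real.mul_rpow N.cast_nonneg (by positivity)]
  field_simp

lemma sum_refinement {P : Finset Rect} (hP : IsPartition P) (ρ : Rect → ℝ) (N : ℕ)
    {F : Rect → ℝ} {F₀ : Rect → ℝ} (h : ∀ B ∈ P, ∀ R ∈ B.grid (gridSize (ρ B) N), F R = F₀ B) :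
    ∑ R ∈ refinement P ρ N, F R = ∑ B ∈ P, (gridSize (ρ B) N : ℝ) ^ 2 * F₀ B := by
  rw [refinement, hP.sum_subdivide]
  refine Finset.sum_congr rfl fun B hB => ?_
  rw [Finset.sum_congr rfl (h B hB), Finset.sum_const, Rect.card_grid, nsmul_eq_mul, Nat.cast_pow]

/-- The partitions and splines that come from a given density of elements, constant on every square
of a given partition. -/
lemma eventually_exists_spline {f W : Plane → ℝ} (hf : ContDiffOn ℝ 2 f closedSquare)
    (hW : IsTorsionFunction W) {P : Finset Rect} (hP : IsPartition P) {ν : ℝ} (hν : 0 < ν)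
    (hside : ∀ B ∈ P, ∀ i, B.hi i = B.lo i + ν) {c a : Rect → ℝ} {α ω : ℝ} (hα : 0 < α)
    (ha : ∀ B ∈ P, α ≤ a B) (hω : 0 ≤ ω) (hc : ∀ B ∈ P, ∀ x ∈ B.openCell, |Δ f x - c B| ≤ ω)
    {p : ℝ} (hp : 1 ≤ p) {δ : ℝ} (hδ : 0 < δ) :
    ∀ᶠ N : ℕ in atTop, ∃ (P' : Finset Rect) (s : Plane → ℝ), IsPartition P' ∧
      IsInterlineatingSpline f P' s ∧ numNonSquares P' = 0 ∧ |(P'.card : ℝ) / N - 1| ≤ δ ∧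
      |N * (eLpNorm (fun x => f x - s x) (ENNReal.ofReal p) (volume.restrict openSquare)).toReal -
        (∑ B ∈ P, a B * ν ^ 2) * (∑ B ∈ P, (|c B| / a B) ^ p * ν ^ 2) ^ (1 / p) *
        (eLpNorm W (ENNReal.ofReal p) (volume.restrict openSquare)).toReal|
      ≤ 4 * ω * (∑ B ∈ P, a B * ν ^ 2) / α + δ := by
  have hp0 : 0 < p := zero_lt_one.trans_le hp
  have ha0 : ∀ B ∈ P, 0 < a B := fun B hB => hα.trans_le (ha B hB)
  set S := ∑ B ∈ P, a B * ν ^ 2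
  have hS : 0 < S := Finset.sum_pos (fun B hB => by have := ha0 B hB; positivity) hP.nonempty
  set w := (eLpNorm W (ENNReal.ofReal p) (volume.restrict openSquare)).toReal
  -- The weights are normalized to total `1`, so that the number of elements is asymptotic to `N`.
  -- In the main term the normalization reappears as the factor `S`.
  set ρ : Rect → ℝ := fun B => a B * ν ^ 2 / S with hρdef
  have hρ : ∀ B ∈ P, 0 < ρ B := fun B hB => by
    have := ha0 B hB
    simp only [hρdef]
    positivity
  have hρ1 : ∑ B ∈ P, ρ B = 1 := by
    simp only [hρdef]
    rw [← Finset.sum_div]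
    exact div_self hS.ne'
  have hT : (∑ B ∈ P, (|c B| * ν ^ 2 * (ρ B)⁻¹) ^ p * ν ^ 2) ^ (1 / p)
      = S * (∑ B ∈ P, (|c B| / a B) ^ p * ν ^ 2) ^ (1 / p) := by
    have hSp : S = (S ^ p) ^ (1 / p) := by
      rw [← Real.rpow_mul hS.le, mul_one_div_cancel hp0.ne', Real.rpow_one]
    conv_rhs => rw [hSp]
    rw [← Real.mul_rpow (by positivity) (Finset.sum_nonneg fun B hB => by
      have := ha0 B hB; positivity), Finset.mul_sum]
    congr 1
    refine Finset.sum_congr rfl fun B hB => ?_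
    have h0 := ha0 B hB
    rw [← mul_assoc, ← Real.mul_rpow hS.le (by positivity)]
    congr 2
    simp only [hρdef]
    field_simp
  have h1 := tendsto_card_refinement hP (fun B hB => (hρ B hB).le) hρ1
  have h2 := (tendsto_refinement_main_term (ν := ν) (c := c) hρ hp0).mul_const w
  rw [hT] at h2
  filter_upwards [Metric.tendsto_nhds.1 h1 δ hδ, Metric.tendsto_nhds.1 h2 δ hδ,
    eventually_gt_atTop 0] with N hN1 hN2 hN0
  have hN0' : (0 : ℝ) < N := by exact_mod_cast hN0
  rw [Real.dist_eq] at hN1 hN2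
  have hP' := isPartition_refinement hP ρ N
  obtain ⟨s, hs⟩ := hP'.exists_spline hf
  refine ⟨refinement P ρ N, s, hP', hs, numNonSquares_refinement hside ρ N, hN1.le, ?_⟩
  obtain ⟨π, hπ⟩ := hP.exists_parent fun B => gridSize (ρ B) N
  set h : Rect → ℝ := fun R => R.hi 0 - R.lo 0 with hh
  have hhB : ∀ B ∈ P, ∀ R ∈ B.grid (gridSize (ρ B) N), h R = ν / gridSize (ρ B) N :=
    fun B hB R hR => side_eq_of_mem_grid (hside B hB) hR 0
  have hX := hs.abs_norm_sub_le hP' hf hW (c := fun R => c (π R)) (h := h)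
    (fun R _ => sub_pos.2 (R.lo_lt_hi 0)) (fun R hR i => by
      obtain ⟨B, hB, hRB⟩ := mem_refinement.1 hR
      rw [hhB B hB R hRB, ← side_eq_of_mem_grid (hside B hB) hRB i]
      -- The lower bound `α` on the weights makes every small square have area at most `S / (N α)`.
      -- After multiplication by `N` the remainder `4 ω κ` becomes `4 ω S / α`, independent of `N`.
      ring) hω (κ := S / (N * α)) (fun R hR => by
      obtain ⟨B, hB, hRB⟩ := mem_refinement.1 hR
      have hk : (0 : ℝ) < gridSize (ρ B) N := by exact_mod_cast gridSize_pos _ _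
      have hk2 := mul_le_gridSize_sq (hρ B hB).le N
      have h0 := ha0 B hB
      have h3 : (N : ℝ) * α * ν ^ 2 ≤ S * (gridSize (ρ B) N : ℝ) ^ 2 := by
        calc (N : ℝ) * α * ν ^ 2 ≤ N * a B * ν ^ 2 := by
              have := ha B hB
              gcongr
          _ = S * (N * ρ B) := by
              simp only [hρdef]
              field_simp
          _ ≤ _ := mul_le_mul_of_nonneg_left hk2 hS.le
      rw [hhB B hB R hRB, div_pow, div_le_div_iff₀ (by positivity) (by positivity)]
      linarith) (fun R hR x hx => by
      obtain ⟨B, hB, hRB⟩ := mem_refinement.1 hR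
      rw [hπ B hB R hRB]
      obtain ⟨b, rfl⟩ := Rect.mem_grid.1 hRB
      exact hc B hB x (B.openCell_sub_subset _ b hx)) hp
  rw [sum_refinement hP ρ N (F₀ := fun B => (|c B| * (ν / gridSize (ρ B) N) ^ 2) ^ p *
    (ν / gridSize (ρ B) N) ^ 2) fun B hB R hR => by rw [hπ B hB R hR, hhB B hB R hR]] at hX
  have hX' := mul_le_mul_of_nonneg_left hX (abs_nonneg (N : ℝ))
  have e : (N : ℝ) * (4 * ω * (S / (N * α))) = 4 * ω * S / α := by field_simp
  rw [← abs_mul, Nat.abs_cast, e, mul_sub, ← mul_assoc] at hX'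
  refine (abs_sub_le _ _ _).trans (add_le_add hX' hN2.le)

/-! ### The regularized optimal density and its limit. -/

/-- The majorant for dominated convergence as `η → 0`. It rests on `p (1 - r) = r` for `r = p / (p +
1)`, which also identifies the limit. -/
lemma div_rpow_rpow_le {p u t : ℝ} (hp : 0 < p) (hu : 0 ≤ u) (hut : u ≤ t) :
    (u / t ^ (p / (p + 1))) ^ p ≤ u ^ (p / (p + 1)) := by
  rcases hu.eq_or_lt with rfl | hu0
  · rw [zero_div, Real.zero_rpow hp.ne', Real.zero_rpow (by positivity)]
  · have h1 : u / t ^ (p / (p + 1)) ≤ u ^ (1 / (p + 1)) := by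
      rw [div_le_iff₀ (Real.rpow_pos_of_pos (hu0.trans_le hut) _)]
      calc u = u ^ (1 / (p + 1)) * u ^ (p / (p + 1)) := by
            rw [← Real.rpow_add hu0, ← add_div, add_comm 1 p, div_self (by positivity),
              Real.rpow_one]
        _ ≤ _ := by gcongr
    have ht : 0 ≤ t := hu.trans hut
    refine (Real.rpow_le_rpow (by positivity) h1 hp.le).trans_eq ?_
    rw [← Real.rpow_mul hu, one_div_mul_eq_div]

lemma tendsto_div_rpow_rpow {p u : ℝ} (hp : 0 < p) (hu : 0 ≤ u) :
    Tendsto (fun η => (u / (u + η) ^ (p / (p + 1))) ^ p) (𝓝[>] 0) (𝓝 (u ^ (p / (p + 1)))) := by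
  rcases hu.eq_or_lt with rfl | hu0
  · simp only [zero_div, Real.zero_rpow hp.ne',
      Real.zero_rpow (div_pos hp (add_pos hp one_pos)).ne', tendsto_const_nhds]
  · have h1 : u ^ (p / (p + 1)) = (u / (u + 0) ^ (p / (p + 1))) ^ p := by
      rw [add_zero]
      nth_rw 2 [← Real.rpow_one u]
      rw [← Real.rpow_sub hu0, ← Real.rpow_mul hu]
      congr 1
      field_simp
      ring
    rw [h1]
    refine Tendsto.mono_left ?_ nhdsWithin_le_nhds
    have hne : (u + 0) ^ (p / (p + 1)) ≠ 0 := by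
      rw [add_zero]
      exact (Real.rpow_pos_of_pos hu0 _).ne'
    refine (Tendsto.div tendsto_const_nhds ?_ hne).rpow_const (Or.inr hp.le)
    exact ((continuous_const.add continuous_id).tendsto 0).rpow_const (Or.inr (by positivity))

variable {L : Plane → ℝ}

lemma continuousOn_abs_add_rpow (hL : ContinuousOn L closedSquare) {p : ℝ} (hp : 0 < p) (η : ℝ) :
    ContinuousOn (fun x => (|L x| + η) ^ (p / (p + 1))) closedSquare :=
  (hL.abs.add continuousOn_const).rpow_const fun _ _ => Or.inr (by positivity)

lemma continuousOn_div_rpow_rpow (hL : ContinuousOn L closedSquare) {p : ℝ} (hp : 0 < p) {η : ℝ}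
    (hη : 0 < η) :
    ContinuousOn (fun x => (|L x| / (|L x| + η) ^ (p / (p + 1))) ^ p) closedSquare :=
  (hL.abs.div (continuousOn_abs_add_rpow hL hp η) fun _ _ => by positivity).rpow_const
    fun _ _ => Or.inr hp.le

/-- The limit of the constants in the error asymptotics for regularized optimal densities. -/
lemma tendsto_regularized_constant (hL : ContinuousOn L closedSquare) {p : ℝ} (hp : 0 < p) :
    Tendsto (fun η => (∫ x in openSquare, (|L x| + η) ^ (p / (p + 1))) *
      (∫ x in openSquare, (|L x| / (|L x| + η) ^ (p / (p + 1))) ^ p) ^ (1 / p)) (𝓝[>] 0)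
      (𝓝 ((∫ x in openSquare, |L x| ^ (p / (p + 1))) ^ (1 / (p / (p + 1))))) := by
  have hr : 0 < p / (p + 1) := by positivity
  have h1 : Tendsto (fun η => ∫ x in openSquare, (|L x| + η) ^ (p / (p + 1))) (𝓝[>] 0)
      (𝓝 (∫ x in openSquare, |L x| ^ (p / (p + 1)))) := by
    refine tendsto_integral_filter_of_dominated_convergence
      (fun x => (|L x| + 1) ^ (p / (p + 1))) ?_ ?_
      (integrableOn_openSquare (continuousOn_abs_add_rpow hL hp 1)) ?_
    · exact Eventually.of_forall fun η =>
        aestronglyMeasurable_of_continuousOn (continuousOn_abs_add_rpow hL hp η)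
    · filter_upwards [Ioo_mem_nhdsGT one_pos] with η hη
      refine Eventually.of_forall fun x => ?_
      have := hη.1
      rw [Real.norm_of_nonneg (by positivity)]
      exact Real.rpow_le_rpow (by positivity) (by linarith [hη.2]) hr.le
    · refine Eventually.of_forall fun x => Tendsto.mono_left ?_ nhdsWithin_le_nhds
      have : Tendsto (fun η => |L x| + η) (𝓝 0) (𝓝 (|L x| + 0)) :=
        (continuous_const.add continuous_id).tendsto 0
      simpa using this.rpow_const (p := p / (p + 1)) (Or.inr hr.le)
  have h2 : Tendsto (fun η => ∫ x in openSquare, (|L x| / (|L x| + η) ^ (p / (p + 1))) ^ p)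
      (𝓝[>] 0) (𝓝 (∫ x in openSquare, |L x| ^ (p / (p + 1)))) := by
    refine tendsto_integral_filter_of_dominated_convergence
      (fun x => |L x| ^ (p / (p + 1))) ?_ ?_ ?_ ?_
    · filter_upwards [self_mem_nhdsWithin] with η hη
      exact aestronglyMeasurable_of_continuousOn (continuousOn_div_rpow_rpow hL hp hη)
    · filter_upwards [self_mem_nhdsWithin] with η hη
      have hη : 0 < η := hη
      refine Eventually.of_forall fun x => ?_
      rw [Real.norm_of_nonneg (by positivity)]
      exact div_rpow_rpow_le hp (abs_nonneg _) (by linarith)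
    · simpa [IntegrableOn] using integrableOn_openSquare (continuousOn_abs_add_rpow hL hp 0)
    · exact Eventually.of_forall fun x => tendsto_div_rpow_rpow hp (abs_nonneg _)
  -- Both integrals tend to the same number `J`, and `J · J^(1/p) = J^(1/r)` because `1 + 1/p =
  -- 1/r`.
  have h3 := h1.mul (h2.rpow_const (p := 1 / p) (Or.inr (by positivity)))
  have e : 1 / (p / (p + 1)) = 1 + 1 / p := by
    field_simp
  rwa [← Real.rpow_one_add' (integral_nonneg fun x => by positivity) (by positivity), ← e] at h3

/-! ### Choice of parameters and passage to a single sequence. -/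

/-- Nearly optimal partitions into squares and their harmonic splines. -/
lemma eventually_exists_nearly_optimal_spline {f W : Plane → ℝ}
    (hf : ContDiffOn ℝ 2 f closedSquare) (hW : IsTorsionFunction W)
    (hL : ContinuousOn L closedSquare) (hfL : Set.EqOn (Δ f) L openSquare) {p : ℝ} (hp : 1 ≤ p)
    {ε : ℝ} (hε : 0 < ε) :
    ∀ᶠ N : ℕ in atTop, ∃ (P : Finset Rect) (s : Plane → ℝ), IsPartition P ∧
      IsInterlineatingSpline f P s ∧ numNonSquares P = 0 ∧ |(P.card : ℝ) / N - 1| ≤ ε ∧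
      |N * (eLpNorm (fun x => f x - s x) (ENNReal.ofReal p) (volume.restrict openSquare)).toReal -
        (∫ x in openSquare, |L x| ^ (p / (p + 1))) ^ (1 / (p / (p + 1))) *
        (eLpNorm W (ENNReal.ofReal p) (volume.restrict openSquare)).toReal| ≤ ε := by
  have hp0 : 0 < p := zero_lt_one.trans_le hp
  have hr : 0 < p / (p + 1) := by positivity
  set w := (eLpNorm W (ENNReal.ofReal p) (volume.restrict openSquare)).toReal
  obtain ⟨η, hη1, hη⟩ := ((Metric.tendsto_nhds.1
    ((tendsto_regularized_constant hL hp0).mul_const w) (ε / 4) (by positivity)).and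
    (self_mem_nhdsWithin : ∀ᶠ η : ℝ in 𝓝[>] 0, 0 < η)).exists
  rw [Real.dist_eq] at hη1
  set A := ∫ x in openSquare, (|L x| + η) ^ (p / (p + 1)) with hA
  have hA0 : 0 ≤ A := integral_nonneg fun x => by positivity
  have hηr : 0 < η ^ (p / (p + 1)) := Real.rpow_pos_of_pos hη _
  -- The order of choices is `η`, `ω`, `m`, `N`. The oscillation `ω` must beat the lower bound `η^r`
  -- of the weights, and `A + 1` bounds their Riemann sums for large `m`.
  obtain ⟨ω, hω0, hω⟩ : ∃ ω : ℝ, 0 < ω ∧ 4 * ω * (A + 1) / η ^ (p / (p + 1)) ≤ ε / 4 := by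
    refine ⟨ε / 4 * η ^ (p / (p + 1)) / (4 * (A + 1)), by positivity, le_of_eq ?_⟩
    field_simp
  have hs1 := tendsto_sum_unitGrid (continuousOn_abs_add_rpow hL hp0 η)
  have hs2 := tendsto_sum_unitGrid (continuousOn_div_rpow_rpow hL hp0 hη)
  have hs3 := (hs1.mul (hs2.rpow_const (p := 1 / p) (Or.inr (by positivity)))).mul_const w
  obtain ⟨m, hm0, hmω, hm1, hm2⟩ := ((eventually_gt_atTop 0).and
    ((exists_abs_sub_center_le hL hω0).and ((hs1.eventually (gt_mem_nhds (lt_add_one _))).and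
    (Metric.tendsto_nhds.1 hs3 (ε / 4) (by positivity))))).exists
  rw [Real.dist_eq] at hm2
  have hP := isPartition_unitGrid hm0
  have hν : (0 : ℝ) < 1 / m := by positivity
  have hmain := eventually_exists_spline hf hW hP hν (fun B hB => side_unitGrid hB)
    (c := fun B => L B.center) (a := fun B => (|L B.center| + η) ^ (p / (p + 1))) hηr
    (fun B _ => Real.rpow_le_rpow hη.le (by linarith [abs_nonneg (L B.center)]) hr.le) hω0.le
    (fun B hB x hx => by
      rw [hfL (Rect.openCell_subset_openSquare (hP.closedCell_subset hB) hx)]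
      exact hmω B hB x (B.openCell_subset_closedCell hx)) hp (δ := ε / 4) (by positivity)
  filter_upwards [hmain] with N hN
  obtain ⟨P, s, h1, h2, h3, h4, h5⟩ := hN
  refine ⟨P, s, h1, h2, h3, h4.trans (by linarith), ?_⟩
  have h6 : 4 * ω * (∑ B ∈ unitGrid m, (|L B.center| + η) ^ (p / (p + 1)) * (1 / (m : ℝ)) ^ 2) /
      η ^ (p / (p + 1)) ≤ ε / 4 := by
    refine le_trans ?_ hω
    gcongr
  refine (abs_sub_le _ _ _).trans ((add_le_add h5 ((abs_sub_le _ _ _).trans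
    (add_le_add hm2.le hη1.le))).trans ?_)
  linarith

/-- Needed for an exponent below `1`, where `eLpNorm` is not a norm; only its integral formula
enters. -/
lemma eLpNorm_laplacian {f : Plane → ℝ} (hL : ContinuousOn L closedSquare)
    (hfL : Set.EqOn (Δ f) L openSquare) {r : ℝ} (hr : 0 < r) :
    eLpNorm (Δ f) (ENNReal.ofReal r) (volume.restrict openSquare)
      = ENNReal.ofReal ((∫ x in openSquare, |L x| ^ r) ^ (1 / r)) := by
  have hae : Δ f =ᵐ[volume.restrict openSquare] L :=
    (ae_restrict_mem measurableSet_openSquare).mono hfL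
  rw [eLpNorm_congr_ae hae, (memLp_of_continuousOn hL _).eLpNorm_eq_integral_rpow_norm
    (by simpa using hr) ENNReal.ofReal_ne_top, ENNReal.toReal_ofReal hr.le, one_div]
  rfl

/-- Replaces a diagonal argument: for each `N` take an index within `1 / (N + 1)` of the infimum,
and the infima tend to `0`. -/
lemma exists_tendsto_zero_of_forall_eventually_exists {ι : Type*} [Nonempty ι] {d : ℕ → ι → ℝ}
    (hd : ∀ N i, 0 ≤ d N i) (h : ∀ ε > 0, ∀ᶠ N in atTop, ∃ i, d N i ≤ ε) :
    ∃ u : ℕ → ι, Tendsto (fun N => d N (u N)) atTop (𝓝 0) := by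
  have hu : ∀ N : ℕ, ∃ i, d N i < (⨅ i, d N i) + 1 / ((N : ℝ) + 1) := fun N =>
    exists_lt_of_ciInf_lt (lt_add_of_pos_right _ (by positivity))
  choose u hu using hu
  have h0 : Tendsto (fun N => ⨅ i, d N i) atTop (𝓝 0) := by
    rw [Metric.tendsto_nhds]
    intro ε hε
    filter_upwards [h (ε / 2) (half_pos hε)] with N hN
    obtain ⟨i, hi⟩ := hN
    rw [Real.dist_0_eq_abs, abs_of_nonneg (Real.iInf_nonneg (hd N))]
    exact ((ciInf_le ⟨0, Set.forall_mem_range.2 (hd N)⟩ i).trans hi).trans_lt (half_lt_self hε)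
  refine ⟨u, squeeze_zero (fun N => hd N _) (fun N => (hu N).le) ?_⟩
  simpa using h0.add tendsto_one_div_add_atTop_nhds_zero_nat

lemma exists_optimal_splines {f W : Plane → ℝ} (hf : ContDiffOn ℝ 2 f closedSquare)
    (hW : IsTorsionFunction W) (hL : ContinuousOn L closedSquare)
    (hfL : Set.EqOn (Δ f) L openSquare) {p : ℝ} (hp : 1 ≤ p) :
    ∃ (P : ℕ → Finset Rect) (s : ℕ → Plane → ℝ), (∀ N, IsPartition (P N)) ∧
      Tendsto (fun N => ((P N).card : ℝ) / N) atTop (𝓝 1) ∧ (∀ N, numNonSquares (P N) = 0) ∧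
      (∀ N, IsInterlineatingSpline f (P N) (s N)) ∧
      Tendsto (fun N : ℕ => (N : ℝ≥0∞) *
          eLpNorm (fun x => f x - s N x) (ENNReal.ofReal p) (volume.restrict openSquare)) atTop
        (𝓝 (eLpNorm W (ENNReal.ofReal p) (volume.restrict openSquare) *
          eLpNorm (Δ f) (ENNReal.ofReal (p / (p + 1))) (volume.restrict openSquare))) := by
  have hr : 0 < p / (p + 1) := by positivity
  set T := (∫ x in openSquare, |L x| ^ (p / (p + 1))) ^ (1 / (p / (p + 1)))
  have hT : 0 ≤ T := Real.rpow_nonneg (integral_nonneg fun x => by positivity) _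
  set w := (eLpNorm W (ENNReal.ofReal p) (volume.restrict openSquare)).toReal with hw
  let V := {q : Finset Rect × (Plane → ℝ) //
    IsPartition q.1 ∧ IsInterlineatingSpline f q.1 q.2 ∧ numNonSquares q.1 = 0}
  let X : V → ℝ := fun q =>
    (eLpNorm (fun x => f x - q.1.2 x) (ENNReal.ofReal p) (volume.restrict openSquare)).toReal
  have hV : Nonempty V := by
    obtain ⟨N, P, s, h1, h2, h3, -⟩ :=
      (eventually_exists_nearly_optimal_spline hf hW hL hfL hp one_pos).exists
    exact ⟨⟨(P, s), h1, h2, h3⟩⟩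
  -- One defect controls both the number of elements and the scaled error, so that a single
  -- selection serves both limits.
  obtain ⟨u, hu⟩ := exists_tendsto_zero_of_forall_eventually_exists
    (d := fun N (q : V) => |(q.1.1.card : ℝ) / N - 1| + |N * X q - T * w|)
    (fun N q => by positivity) (fun ε hε => by
      filter_upwards [eventually_exists_nearly_optimal_spline hf hW hL hfL hp (half_pos hε)]
        with N hN
      obtain ⟨P, s, h1, h2, h3, h4, h5⟩ := hN
      exact ⟨⟨(P, s), h1, h2, h3⟩, (add_le_add h4 h5).trans_eq (add_halves ε)⟩)
  refine ⟨fun N => (u N).1.1, fun N => (u N).1.2, fun N => (u N).2.1, ?_, fun N => (u N).2.2.2,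
    fun N => (u N).2.2.1, ?_⟩
  · rw [tendsto_iff_dist_tendsto_zero]
    refine squeeze_zero (fun _ => dist_nonneg) (fun N => ?_) hu
    rw [Real.dist_eq]
    exact le_add_of_nonneg_right (abs_nonneg _)
  · have h1 : Tendsto (fun N : ℕ => N * X (u N)) atTop (𝓝 (T * w)) := by
      rw [tendsto_iff_dist_tendsto_zero]
      refine squeeze_zero (fun _ => dist_nonneg) (fun N => ?_) hu
      rw [Real.dist_eq]
      exact le_add_of_nonneg_left (abs_nonneg _)
    have h2 := ENNReal.tendsto_ofReal h1
    rw [eLpNorm_laplacian hL hfL hr, mul_comm]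
    rw [ENNReal.ofReal_mul hT, hw,
      ENNReal.ofReal_toReal (memLp_of_continuousOn hW.continuousOn _).2.ne] at h2
    refine h2.congr fun N => ?_
    have hX : MemLp (fun x => f x - (u N).1.2 x) (ENNReal.ofReal p) (volume.restrict openSquare) :=
      memLp_of_continuousOn (hf.continuousOn.sub (u N).2.2.1.continuousOn) _
    rw [ENNReal.ofReal_mul N.cast_nonneg, ENNReal.ofReal_natCast, ENNReal.ofReal_toReal hX.2.ne]

end HarmonicSpline

theorem theorem1 (p : ℝ) (hp : 1 ≤ p) (f : Plane → ℝ) (hf : ContDiffOn ℝ 2 f closedSquare) :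
    -- the Green's function of the square exists and the norms on the right-hand side are finite
    (∀ x ∈ openSquare,
      IsGreenRegularPart openSquare x (greenRegularPart openSquare x) ∧
      IntegrableOn (greenFunction openSquare x) openSquare) ∧
    MemLp greenIntegral (ENNReal.ofReal p) (volume.restrict openSquare) ∧
    MemLp (Laplacian.laplacian f) (ENNReal.ofReal (p / (p + 1)))
      (volume.restrict openSquare) ∧
    -- the partitions, the splines and the asymptotics of the error
    ∃ (P : ℕ → Finset Rect) (s : ℕ → Plane → ℝ),
      (∀ N, IsPartition (P N)) ∧
      Tendsto (fun N => ((P N).card : ℝ) / N) atTop (𝓝 1) ∧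
      Tendsto (fun N => (numNonSquares (P N) : ℝ) / N) atTop (𝓝 0) ∧
      (∀ N, IsInterlineatingSpline f (P N) (s N)) ∧
      Tendsto
        (fun N : ℕ => (N : ℝ≥0∞) *
          eLpNorm (fun x => f x - s N x) (ENNReal.ofReal p) (volume.restrict openSquare))
        atTop
        (𝓝 (eLpNorm greenIntegral (ENNReal.ofReal p) (volume.restrict openSquare) *
          eLpNorm (Laplacian.laplacian f) (ENNReal.ofReal (p / (p + 1)))
            (volume.restrict openSquare))) := by
  obtain ⟨W, hW⟩ := exists_isTorsionFunction
  obtain ⟨L, hL, hfL⟩ := exists_continuousOn_eqOn_laplacian hf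
  have hIW : greenIntegral =ᵐ[volume.restrict openSquare] W :=
    (ae_restrict_mem measurableSet_openSquare).mono hW.eqOn_greenIntegral
  have hΔL : Laplacian.laplacian f =ᵐ[volume.restrict openSquare] L :=
    (ae_restrict_mem measurableSet_openSquare).mono hfL
  obtain ⟨P, s, h1, h2, h3, h4, h5⟩ := exists_optimal_splines hf hW hL hfL hp
  refine ⟨fun x hx => ⟨isGreenRegularPart_greenRegularPart hx, integrableOn_greenFunction hx⟩,
    (memLp_congr_ae hIW).2 (memLp_of_continuousOn hW.continuousOn _),
    (memLp_congr_ae hΔL).2 (memLp_of_continuousOn hL _), P, s, h1, h2, ?_, h4, ?_⟩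
  · simp only [h3, Nat.cast_zero, zero_div, tendsto_const_nhds]
  · rwa [eLpNorm_congr_ae hIW]
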